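/- Let $\mathbb K$ be a field of characteristic zero, $m,n\ge 0$, $d=m+n$, and let $x_1,\dots,x_d$ be a basis of a super vector space $V$ with parities $\hat i=0$ for $i\le m$ and $\hat i=1$ for $i>m$. Let $q\in\mathbb K^\times$ be not a root of unity other than $1$, and let $p_{ij},q_{ij}\in\mathbb K^\times$ $(1\le i,j\le d)$ satisfy $p_{ii}=q_{ii}=1$, $p_{ji}=p_{ij}^{-1}$, $q_{ji}=q_{ij}^{-1}$, and $p_{ij}q_{ij}=q^{\varepsilon_{ij}}$, $\varepsilon_{ij}=\pm1$ for $i\ne j$, with $(\varepsilon_{ik}-\varepsilon_{ij})(\varepsilon_{jk}-\varepsilon_{ik})=0$ for $i<j<k$. Put $$R^{kl}_{ij}=\frac{q-p_{ij}q_{ij}}{1+p_{ij}q_{ij}}\,\delta^k_i\delta^l_j+(-1)^{\hat i\hat j}\frac{p_{ij}(q+1)}{1+p_{ij}q_{ij}}\,\delta^k_j\delta^l_i,\qquad R(x_i\otimes x_j)=\sum_{k,l} x_k\otimes x_l\,R^{kl}_{ij}.$$ A matrix $(z^j_i)$ over a $\mathbb K$-algebra ($j$ the row index) is a quantum super matrix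 if, for all $i,j,k,l$, $$\sum_{a,s}(-1)^{\hat s(\hat i+\hat a)}R^{kl}_{as}z^a_iz^s_j=\sum_{a,s}(-1)^{\hat l(\hat a+\hat k)}z^k_az^l_sR^{as}_{ij},$$ and a quantum matrix if, moreover, all indices have the same parity. Let $H$ be the algebra of functions on $GL_q(m|n)$: the $\mathbb K$-algebra generated by $z^j_i,t^j_i$ subject to these relations for $Z=(z^j_i)$ and $$\sum_k(-1)^{\hat i(\hat k+1)}z^j_kt^k_i=\sum_k(-1)^{\hat k(\hat j+1)}t^j_kz^k_i=\delta^j_i .$$ Write $Z=\begin{pmatrix}A&B\\ C&D\end{pmatrix}$ with $A$ of size $m\times m$ and $D$ of size $n\times n$. For an $m\times m$ matrix $M$ on the even indices and an $n\times n$ matrix $N$ on the odd indices (renumbered $1,\dots,n$) let $$\det{}_qM=\sum_{\sigma\in\mathfrak S_m}\Big(\prod_{i<j,\ \sigma i>\sigma j}-p_{\sigma i,\sigma j}\Big)M_1^{\sigma 1}\cdots M_m^{\sigma m},\qquad \det{}_qN=\sum_{\sigma\in\mathfrak S_n}\Big(\prod_{i<j,\ \sigma i>\sigma j}-q_{\sigma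 i,\sigma j}^{-1}\Big)N_1^{\sigma 1}\cdots N_n^{\sigma n}.$$ Let $\Lambda=T(V)/(\operatorname{Im}(R+1))$ and $S^\vee=T(V^*)/(\operatorname{Im}(R^*-q))$, where $V^*$ has basis $\xi^1,\dots,\xi^d$ with $\xi^i$ of parity $\hat i$, and $R^*(\xi^i\otimes\xi^j)=\sum_{k,l}\xi^k\otimes\xi^lR^{ji}_{lk}$. On $\Lambda\otimes S^\vee$ let $\mathrm D(u\otimes w)=\sum_iux_i\otimes\xi^iw$ be the Koszul differential, and let $\delta$ be the coaction of $H$ given by $x_i\mapsto\sum_jx_j\otimes z^j_i$ and $\xi^i\mapsto\sum_j\xi^j\otimes t^i_j$, extended multiplicatively with the rule of signs. Let $\omega=x_1\cdots x_m\otimes\xi^{m+1}\cdots\xi^{m+n}$. The quantum Berezinian $\mathrm{Ber}_qZ$ is the element $b\in H$ by which $H$ coacts on the cohomology class of $\omega$: $$\delta(\omega)\equiv\omega\otimes b\pmod{\operatorname{Im}\mathrm D\otimes H}.$$ Then there is exactly one such $b=\mathrm{Ber}_qZ$, and it is invertible in $H$; the matrix $D$ is an invertible quantum matrix, $A-BD^{-1}C$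 is a quantum matrix, $\det_q(A-BD^{-1}C)$ is invertible in $H$, and $$(\mathrm{Ber}_qZ)^{-1}=\det{}_qD\cdot\det{}_q(A-BD^{-1}C)^{-1}.$$ -/

import Mathlib

open scoped TensorProduct

noncomputable section

namespace QuantumBerezinian

/-- The standing assumptions on the deformation parameters `q`, `p i j` and `r i j` (`r i j` is the
second family of parameters, usually written `q_{ij}`): all are nonzero, `q` is not a root of unity
other than `1`, `p j i = (p i j)⁻¹`, `r j i = (r i j)⁻¹`, `p i i = r i i = 1`, and
`p i j * r i j = q ^ ε i j` for signs `ε i j = ±1` without cyclic triples. -/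
structure IsMultiparameter {k : Type*} [Field k] {d : ℕ} (q : k) (p r : Fin d → Fin d → k) :
    Prop where
  q_ne_zero : q ≠ 0
  eq_one_of_pow_eq_one : ∀ N : ℕ, 0 < N → q ^ N = 1 → q = 1
  p_ne_zero : ∀ i j, p i j ≠ 0
  r_ne_zero : ∀ i j, r i j ≠ 0
  p_swap : ∀ i j, p j i = (p i j)⁻¹
  r_swap : ∀ i j, r j i = (r i j)⁻¹
  p_self : ∀ i, p i i = 1
  r_self : ∀ i, r i i = 1
  exists_sign : ∃ ε : Fin d → Fin d → ℤ,
    (∀ i j, i ≠ j → (ε i j = 1 ∨ ε i j = -1) ∧ p i j * r i j = q ^ ε i j) ∧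
    ∀ i j l, i < j → j < l → (ε i l - ε i j) * (ε j l - ε i l) = 0

section Matrices

variable {k : Type*} [Field k] {d : ℕ}

/-- The coefficient `R^{ab}_{ij}` of the operator `R (x_i ⊗ x_j) = ∑ x_a ⊗ x_b R^{ab}_{ij}` on the
super vector space with homogeneous basis `x_i` of parity `par i`. -/
def rCoeff (par : Fin d → ℕ) (q : k) (p r : Fin d → Fin d → k) (a b i j : Fin d) : k :=
  (q - p i j * r i j) / (1 + p i j * r i j) * (if a = i ∧ b = j then 1 else 0)
    + (-1) ^ (par i * par j) * (p i j * (q + 1) / (1 + p i j * r i j))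
      * (if a = j ∧ b = i then 1 else 0)

variable {K : Type*} [Ring K] [Algebra k K]

/-- `∑_{a,s} (-1)^{ŝ(î+â)} R^{uv}_{as} z^a_i z^s_j`, where `z^a_i = Z a i`. -/
def zRelLeft (par : Fin d → ℕ) (q : k) (p r : Fin d → Fin d → k)
    (Z : Matrix (Fin d) (Fin d) K) (u v i j : Fin d) : K :=
  ∑ a, ∑ s, ((-1 : k) ^ (par s * (par i + par a)) * rCoeff par q p r u v a s) • (Z a i * Z s j)

/-- `∑_{a,s} (-1)^{v̂(â+û)} z^u_a z^v_s R^{as}_{ij}`, where `z^u_a = Z u a`. -/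
def zRelRight (par : Fin d → ℕ) (q : k) (p r : Fin d → Fin d → k)
    (Z : Matrix (Fin d) (Fin d) K) (u v i j : Fin d) : K :=
  ∑ a, ∑ s, ((-1 : k) ^ (par v * (par a + par u)) * rCoeff par q p r a s i j) • (Z u a * Z v s)

/-- `Z` is a quantum (super) matrix for the parities `par` and the parameters `q`, `p`, `r`; the row
index of `Z` is the upper index of `z^j_i`. -/
def IsQuantumMatrix (par : Fin d → ℕ) (q : k) (p r : Fin d → Fin d → k)
    (Z : Matrix (Fin d) (Fin d) K) : Prop :=
  ∀ u v i j, zRelLeft par q p r Z u v i j = zRelRight par q p r Z u v i j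

/-- `∑_σ σ(-c) z_1^{σ(1)} z_2^{σ(2)} ⋯ z_d^{σ(d)}` with
`σ(-c) = ∏_{i < j, σ i > σ j} (-c (σ i) (σ j))`. -/
def qDet (c : Fin d → Fin d → k) (Z : Matrix (Fin d) (Fin d) K) : K :=
  ∑ σ : Equiv.Perm (Fin d),
    (∏ i, ∏ j, if i < j ∧ σ j < σ i then -c (σ i) (σ j) else 1) •
      (List.ofFn fun i => Z (σ i) i).prod

/-- The quantum determinant when all parameters are even: the coefficient of the coaction on
`x_1 x_2 ⋯ x_d` in `Λ`, where `x_i x_j = -p_{ij} x_j x_i`. -/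
def qDetEven (p : Fin d → Fin d → k) (Z : Matrix (Fin d) (Fin d) K) : K :=
  qDet p Z

/-- The quantum determinant when all parameters are odd: the coefficient of the coaction on
`x_1 x_2 ⋯ x_d` in `S`, where `x_i x_j = -r_{ij}⁻¹ x_j x_i`. -/
def qDetOdd (r : Fin d → Fin d → k) (Z : Matrix (Fin d) (Fin d) K) : K :=
  qDet (fun i j => (r i j)⁻¹) Z

end Matrices

section Super

variable {k : Type*} [Field k]

/-- The parity of the `i`-th basis vector in standard format: the first `m` are even, the last `n`
are odd. -/
def parity (m n : ℕ) (i : Fin (m + n)) : ℕ :=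
  if (i : ℕ) < m then 0 else 1

/-- The generators of the function algebra on the quantum super group: `z j i` is `z^j_i` and
`t j i` is `t^j_i` (upper index first). -/
inductive Gen (d : ℕ) : Type
  | z (j i : Fin d) : Gen d
  | t (j i : Fin d) : Gen d

variable {m n : ℕ}

/-- The free generators `z^j_i`, as a matrix. -/
def freeZ (k : Type*) [Field k] (d : ℕ) : Matrix (Fin d) (Fin d) (FreeAlgebra k (Gen d)) :=
  Matrix.of fun j i => FreeAlgebra.ι k (Gen.z j i)

/-- The free generators `t^j_i`, as a matrix. -/
def freeT (k : Type*) [Field k] (d : ℕ) : Matrix (Fin d) (Fin d) (FreeAlgebra k (Gen d)) :=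
  Matrix.of fun j i => FreeAlgebra.ι k (Gen.t j i)

/-- The defining relations: `Z` is a quantum super matrix, and `((-1)^{î(ĵ+1)} t^j_i)` is its
two-sided inverse. -/
inductive GLRel (m n : ℕ) (q : k) (p r : Fin (m + n) → Fin (m + n) → k) :
    FreeAlgebra k (Gen (m + n)) → FreeAlgebra k (Gen (m + n)) → Prop
  | zz (u v i j : Fin (m + n)) : GLRel m n q p r
      (zRelLeft (parity m n) q p r (freeZ k (m + n)) u v i j)
      (zRelRight (parity m n) q p r (freeZ k (m + n)) u v i j)
  | zt (j i : Fin (m + n)) : GLRel m n q p r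
      (∑ l, (-1 : k) ^ (parity m n i * (parity m n l + 1)) •
        (freeZ k (m + n) j l * freeT k (m + n) l i))
      (if i = j then 1 else 0)
  | tz (j i : Fin (m + n)) : GLRel m n q p r
      (∑ l, (-1 : k) ^ (parity m n l * (parity m n j + 1)) •
        (freeT k (m + n) j l * freeZ k (m + n) l i))
      (if i = j then 1 else 0)

/-- The algebra of functions on the quantum super group `GL_q(m|n)`: the Hopf envelope of the
algebra of functions on `M_q(m|n)`. -/
def QGL (m n : ℕ) (q : k) (p r : Fin (m + n) → Fin (m + n) → k) : Type _ :=
  RingQuot (GLRel m n q p r)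

instance (q : k) (p r : Fin (m + n) → Fin (m + n) → k) : Ring (QGL m n q p r) :=
  inferInstanceAs (Ring (RingQuot (GLRel m n q p r)))

instance (q : k) (p r : Fin (m + n) → Fin (m + n) → k) : Algebra k (QGL m n q p r) :=
  inferInstanceAs (Algebra k (RingQuot (GLRel m n q p r)))

/-- The quotient map. -/
def QGL.mk (q : k) (p r : Fin (m + n) → Fin (m + n) → k) :
    FreeAlgebra k (Gen (m + n)) →ₐ[k] QGL m n q p r :=
  RingQuot.mkAlgHom k (GLRel m n q p r)

/-- The generic quantum super matrix `Z = (z^j_i)`, with `j` the row index. -/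
def matZ (q : k) (p r : Fin (m + n) → Fin (m + n) → k) :
    Matrix (Fin (m + n)) (Fin (m + n)) (QGL m n q p r) :=
  (freeZ k (m + n)).map (QGL.mk q p r)

/-- The matrix `T = (t^j_i)`, with `j` the row index. -/
def matT (q : k) (p r : Fin (m + n) → Fin (m + n) → k) :
    Matrix (Fin (m + n)) (Fin (m + n)) (QGL m n q p r) :=
  (freeT k (m + n)).map (QGL.mk q p r)

/-- The even-even block of `Z = (A B; C D)`. -/
def blockA (q : k) (p r : Fin (m + n) → Fin (m + n) → k) :
    Matrix (Fin m) (Fin m) (QGL m n q p r) :=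
  (matZ q p r).submatrix (Fin.castAdd n) (Fin.castAdd n)

/-- The even-odd block of `Z = (A B; C D)`. -/
def blockB (q : k) (p r : Fin (m + n) → Fin (m + n) → k) :
    Matrix (Fin m) (Fin n) (QGL m n q p r) :=
  (matZ q p r).submatrix (Fin.castAdd n) (Fin.natAdd m)

/-- The odd-even block of `Z = (A B; C D)`. -/
def blockC (q : k) (p r : Fin (m + n) → Fin (m + n) → k) :
    Matrix (Fin n) (Fin m) (QGL m n q p r) :=
  (matZ q p r).submatrix (Fin.natAdd m) (Fin.castAdd n)

/-- The odd-odd block of `Z = (A B; C D)`. -/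
def blockD (q : k) (p r : Fin (m + n) → Fin (m + n) → k) :
    Matrix (Fin n) (Fin n) (QGL m n q p r) :=
  (matZ q p r).submatrix (Fin.natAdd m) (Fin.natAdd m)

/-- The restriction of a family of parameters to the even indices. -/
def evenPart (p : Fin (m + n) → Fin (m + n) → k) (i j : Fin m) : k :=
  p (Fin.castAdd n i) (Fin.castAdd n j)

/-- The restriction of a family of parameters to the odd indices. -/
def oddPart (p : Fin (m + n) → Fin (m + n) → k) (i j : Fin n) : k :=
  p (Fin.natAdd m i) (Fin.natAdd m j)

/-! The Koszul complex. -/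

/-- The relations `(R + 1)(x_i ⊗ x_j) = 0` of the quantum exterior algebra `Λ` on `V`. -/
inductive ExtRel (m n : ℕ) (q : k) (p r : Fin (m + n) → Fin (m + n) → k) :
    FreeAlgebra k (Fin (m + n)) → FreeAlgebra k (Fin (m + n)) → Prop
  | rel (i j : Fin (m + n)) : ExtRel m n q p r
      (∑ a, ∑ b, rCoeff (parity m n) q p r a b i j •
        (FreeAlgebra.ι k a * FreeAlgebra.ι k b))
      (-(FreeAlgebra.ι k i * FreeAlgebra.ι k j))

/-- The relations `(R* - q)(ξ^i ⊗ ξ^j) = 0` of the quantum symmetric algebra `S^∨` on the dual `V*`,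
where `R* (ξ^i ⊗ ξ^j) = ∑ ξ^a ⊗ ξ^b R^{ji}_{ba}`. -/
inductive SymDualRel (m n : ℕ) (q : k) (p r : Fin (m + n) → Fin (m + n) → k) :
    FreeAlgebra k (Fin (m + n)) → FreeAlgebra k (Fin (m + n)) → Prop
  | rel (i j : Fin (m + n)) : SymDualRel m n q p r
      (∑ a, ∑ b, rCoeff (parity m n) q p r j i b a •
        (FreeAlgebra.ι k a * FreeAlgebra.ι k b))
      (q • (FreeAlgebra.ι k i * FreeAlgebra.ι k j))

/-- The quantum exterior algebra `Λ = T(V) / (Im (R + 1))`. -/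
def Ext (m n : ℕ) (q : k) (p r : Fin (m + n) → Fin (m + n) → k) : Type _ :=
  RingQuot (ExtRel m n q p r)

instance (q : k) (p r : Fin (m + n) → Fin (m + n) → k) : Ring (Ext m n q p r) :=
  inferInstanceAs (Ring (RingQuot (ExtRel m n q p r)))

instance (q : k) (p r : Fin (m + n) → Fin (m + n) → k) : Algebra k (Ext m n q p r) :=
  inferInstanceAs (Algebra k (RingQuot (ExtRel m n q p r)))

/-- The quotient map. -/
def Ext.mk (q : k) (p r : Fin (m + n) → Fin (m + n) → k) :
    FreeAlgebra k (Fin (m + n)) →ₐ[k] Ext m n q p r :=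
  RingQuot.mkAlgHom k (ExtRel m n q p r)

/-- The quantum symmetric algebra `S^∨ = T(V*) / (Im (R* - q))`. -/
def SymDual (m n : ℕ) (q : k) (p r : Fin (m + n) → Fin (m + n) → k) : Type _ :=
  RingQuot (SymDualRel m n q p r)

instance (q : k) (p r : Fin (m + n) → Fin (m + n) → k) : Ring (SymDual m n q p r) :=
  inferInstanceAs (Ring (RingQuot (SymDualRel m n q p r)))

instance (q : k) (p r : Fin (m + n) → Fin (m + n) → k) : Algebra k (SymDual m n q p r) :=
  inferInstanceAs (Algebra k (RingQuot (SymDualRel m n q p r)))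

/-- The quotient map. -/
def SymDual.mk (q : k) (p r : Fin (m + n) → Fin (m + n) → k) :
    FreeAlgebra k (Fin (m + n)) →ₐ[k] SymDual m n q p r :=
  RingQuot.mkAlgHom k (SymDualRel m n q p r)

/-- The generator `x_i` of `Λ`. -/
def extX (q : k) (p r : Fin (m + n) → Fin (m + n) → k) (i : Fin (m + n)) : Ext m n q p r :=
  Ext.mk q p r (FreeAlgebra.ι k i)

/-- The generator `ξ^i` of `S^∨`. -/
def symXi (q : k) (p r : Fin (m + n) → Fin (m + n) → k) (i : Fin (m + n)) : SymDual m n q p r :=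
  SymDual.mk q p r (FreeAlgebra.ι k i)

/-- The total space `⨁_{a,b} Λ_a ⊗ S^∨_b` of the Koszul complexes. -/
abbrev Koszul (m n : ℕ) (q : k) (p r : Fin (m + n) → Fin (m + n) → k) : Type _ :=
  Ext m n q p r ⊗[k] SymDual m n q p r

/-- The Koszul differential `D (u ⊗ w) = ∑_i u x_i ⊗ ξ^i w`; it maps `Λ_a ⊗ S^∨_b` to
`Λ_{a+1} ⊗ S^∨_{b+1}`. -/
def koszulD (q : k) (p r : Fin (m + n) → Fin (m + n) → k) :
    Koszul m n q p r →ₗ[k] Koszul m n q p r :=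
  ∑ i, TensorProduct.map (LinearMap.mulRight k (extX q p r i)) (LinearMap.mulLeft k (symXi q p r i))

/-- The monomial `x_{I 1} ⋯ x_{I a} ⊗ ξ^{I' 1} ⋯ ξ^{I' b}`. -/
def koszulMonomial (q : k) (p r : Fin (m + n) → Fin (m + n) → k) {a b : ℕ}
    (I : Fin a → Fin (m + n)) (I' : Fin b → Fin (m + n)) : Koszul m n q p r :=
  (List.ofFn fun s => extX q p r (I s)).prod ⊗ₜ[k] (List.ofFn fun s => symXi q p r (I' s)).prod

/-- The exponent of the sign that the rule of signs gives when `(v_1 ⊗ c_1)(v_2 ⊗ c_2) ⋯` is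
rewritten as `± v_1 v_2 ⋯ ⊗ c_1 c_2 ⋯`: every `c_s` moves past every `v_t` with `s < t`. -/
def koszulSign {N : ℕ} (v c : Fin N → ℕ) : ℕ :=
  ∑ s, ∑ t, if s < t then c s * v t else 0

/-- The coaction on a monomial: it is multiplicative (with the rule of signs) and given by
`x_i ↦ ∑_j x_j ⊗ z^j_i` and `ξ^i ↦ ∑_j ξ^j ⊗ t^i_j` on the generators. -/
def koszulCoaction (q : k) (p r : Fin (m + n) → Fin (m + n) → k) {a b : ℕ}
    (I : Fin a → Fin (m + n)) (I' : Fin b → Fin (m + n)) :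
    Koszul m n q p r ⊗[k] QGL m n q p r :=
  ∑ J : Fin a → Fin (m + n), ∑ J' : Fin b → Fin (m + n),
    ((-1 : k) ^ koszulSign
        (Fin.append (fun s => parity m n (J s)) (fun s => parity m n (J' s)))
        (Fin.append (fun s => parity m n (J s) + parity m n (I s))
          (fun s => parity m n (J' s) + parity m n (I' s)))) •
      (koszulMonomial q p r J J' ⊗ₜ[k]
        ((List.ofFn fun s => matZ q p r (J s) (I s)).prod *
          (List.ofFn fun s => matT q p r (I' s) (J' s)).prod))

/-- `b` is the quantum Berezinian of `Z`: the coaction on the cohomology class of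
`ω = x_1 ⋯ x_m ⊗ ξ^{m+1} ⋯ ξ^{m+n}` is `[ω] ↦ [ω] ⊗ b`, that is, `δ(ω) = ω ⊗ b` modulo
`Im D ⊗ H`, where `H` is the algebra of functions on `GL_q(m|n)`. -/
def IsBerezinian (q : k) (p r : Fin (m + n) → Fin (m + n) → k) (b : QGL m n q p r) : Prop :=
  koszulCoaction q p r (Fin.castAdd n) (Fin.natAdd m)
      - koszulMonomial q p r (Fin.castAdd n) (Fin.natAdd m) ⊗ₜ[k] b
    ∈ LinearMap.range (LinearMap.rTensor (QGL m n q p r) (koszulD (m := m) (n := n) q p r))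

/-- The matrix `A - B D⁻¹ C` (meaningful when `D` is invertible). -/
def schurD (q : k) (p r : Fin (m + n) → Fin (m + n) → k) :
    Matrix (Fin m) (Fin m) (QGL m n q p r) :=
  blockA q p r - blockB q p r * Ring.inverse (blockD q p r) * blockC q p r

end Super

end QuantumBerezinian

end

noncomputable section

namespace QuantumBerezinian

/-! ### Quantum affine superspaces -/

section QAlg

variable {k : Type*} [Field k] {ι : Type*}

/-! The Koszul complex has one-dimensional cohomology in the relevant degree, spanned by ω, and a
coaction that commutes with D and has an inverse must act on that line by an invertible scalar. The
inverse scalar can be computed explicitly, and it is the right-hand side of the formula.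

Cohomology. Both Λ and S^∨ are quantum affine superspaces `QAlg c` and `QAlg (-c)`, where c_ii = 1
forces x_i² = 0 and c_ii = -1 leaves x_i free. Skew derivations give a homotopy h, and hD + Dh is
diagonal on words with eigenvalue ∑_i (1 + c_ii (N'_i - N_i)), N_i and N'_i being letter counts
(`laplacian_monomial`). Nonzero words have natural-number eigenvalues, and only rearrangements of ω
have eigenvalue zero (`monomial_mem_span_of_lapWeight`). Hence every cocycle is a multiple of ω
modulo Im D, also with coefficients in H. A functional that reads off the coefficient of ω and kills
Im D makes the multiple unique (`exists_functional`).

Signs. Tensoring with two anticommuting involutions g, θ, realised as 2×2 matrices, turns a quantum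
super matrix into a matrix Z with the sign-free relations R Z₁Z₂ = Z₁Z₂ R (`rRel_boseZ`). The
theorem is proved for such Z and its inverse W, and the result is read off from the first row.

Invertibility. The coaction uses Z on Λ and Wᵀ on S^∨. Its inverse needs an inverse of Wᵀ, which
over a noncommutative ring is not formal. It exists because the square of the antipode is diagonal:
a rescaled Zᵀ is inverse to Wᵀ (`RRel.exists_twisted`, `RRel.exists_transpose_inverse`). The two
coactions then act on the class of ω by mutually inverse b and b' (`exists_berezinian`).

Formula. The functional gives b' = (row determinant of D) · (reversed determinant of W₁), where W₁
is the even block of W. Block elimination shows that W₁ is inverse to the Schur complement S = A -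
BD⁻¹C, so the second factor is det(S)⁻¹. The invertibility of D is itself deduced from that of b' by
Cramer's rule (`isUnit_block_and_qDet_eq`). Row and column determinants of D agree because a double
expansion computes both with the same coefficient, a nonzero multiple of a quantum factorial
(`qDetRev_transpose_eq_qDet`); this is where q must not be a nontrivial root of unity in an
essential way. -/

/-- The relations `x_i x_j = -c_{ij} x_j x_i`, for all `i` and `j`. -/
inductive QRel (c : ι → ι → k) : FreeAlgebra k ι → FreeAlgebra k ι → Prop
  | rel (i j : ι) : QRel c (FreeAlgebra.ι k i * FreeAlgebra.ι k j)
      (-(c i j) • (FreeAlgebra.ι k j * FreeAlgebra.ι k i))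

/-- The algebra with generators `x_i` and relations `x_i x_j = -c_{ij} x_j x_i`. -/
def QAlg (c : ι → ι → k) : Type _ := RingQuot (QRel c)

instance (c : ι → ι → k) : Ring (QAlg c) := inferInstanceAs (Ring (RingQuot (QRel c)))

instance (c : ι → ι → k) : Algebra k (QAlg c) :=
  inferInstanceAs (Algebra k (RingQuot (QRel c)))

/-- A family of elements with `y_i y_j = -c_{ij} y_j y_i`. -/
def IsQComm {B : Type*} [Ring B] [Algebra k B] (c : ι → ι → k) (y : ι → B) : Prop :=
  ∀ i j, y i * y j = -(c i j) • (y j * y i)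

namespace QAlg

/-- The generators. -/
def gen (c : ι → ι → k) (i : ι) : QAlg c :=
  RingQuot.mkAlgHom k (QRel c) (FreeAlgebra.ι k i)

theorem gen_isQComm (c : ι → ι → k) : IsQComm c (gen c) := by
  intro i j
  have := RingQuot.mkAlgHom_rel k (QRel.rel (c := c) i j)
  rw [map_mul, map_smul, map_mul] at this
  exact this

variable {B : Type*} [Ring B] [Algebra k B]

/-- The universal property. -/
def lift (c : ι → ι → k) (y : ι → B) (hy : IsQComm c y) : QAlg c →ₐ[k] B :=
  RingQuot.liftAlgHom k ⟨FreeAlgebra.lift k y, by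
    rintro _ _ ⟨i, j⟩
    simpa using hy i j⟩

@[simp] theorem lift_gen (c : ι → ι → k) (y : ι → B) (hy : IsQComm c y) (i : ι) :
    lift c y hy (gen c i) = y i := by
  simp only [lift, gen]
  erw [RingQuot.liftAlgHom_mkAlgHom_apply]
  simp

theorem induction {c : ι → ι → k} {P : QAlg c → Prop}
    (hs : ∀ r : k, P (algebraMap k _ r)) (hg : ∀ i, P (gen c i))
    (ha : ∀ u v, P u → P v → P (u + v)) (hm : ∀ u v, P u → P v → P (u * v)) (u : QAlg c) :
    P u := by
  obtain ⟨w, rfl⟩ := RingQuot.mkAlgHom_surjective k (QRel c) u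
  induction w using FreeAlgebra.induction with
  | grade0 r => rw [AlgHom.commutes]; exact hs r
  | grade1 i => exact hg i
  | mul a b h1 h2 => rw [map_mul]; exact hm _ _ h1 h2
  | add a b h1 h2 => rw [map_add]; exact ha _ _ h1 h2

theorem algHom_ext {c : ι → ι → k} {f g : QAlg c →ₐ[k] B}
    (h : ∀ i, f (gen c i) = g (gen c i)) : f = g := by
  ext u
  induction u using QAlg.induction with
  | hs r => simp
  | hg i => exact h i
  | ha u v h1 h2 => simp [h1, h2]
  | hm u v h1 h2 => simp [h1, h2]

/-- The augmentation. -/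
def aug (c : ι → ι → k) : QAlg c →ₐ[k] k := lift c (fun _ => 0) (by intro i j; simp)

/-! #### Skew derivations -/

section Derivations

variable [DecidableEq ι] {c : ι → ι → k} (hc : ∀ i j, c i j * c j i = 1)
include hc

/-- A skew derivation is packaged as an algebra map into triangular 2×2 matrices: the twisted
Leibniz rule becomes matrix multiplication, and well-definedness becomes the defining relation for
the images of the generators. The off-diagonal entry is the one that needs c_ij c_ji = 1. -/
theorem isQComm_upper (i : ι) : IsQComm c fun j =>
    (!![gen c j, if i = j then 1 else 0; 0, -(c i j) • gen c j] :
      Matrix (Fin 2) (Fin 2) (QAlg c)) := by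
  intro j l
  have h1 := gen_isQComm c j l
  have h2 := hc j l
  ext a b
  fin_cases a <;> fin_cases b
  · by_cases hl : i = l <;> simpa [Matrix.mul_apply, hl] using h1
  · by_cases hj : i = j <;> by_cases hl : i = l
    · subst hj; subst hl
      simp [Matrix.mul_apply, smul_smul, smul_add, hc]
      abel
    · subst hj; simp [Matrix.mul_apply, hl]
    · subst hl; simp [Matrix.mul_apply, hj, smul_smul, h2]
    · simp [Matrix.mul_apply, hj, hl]
  · simp [Matrix.mul_apply]
  · simp [Matrix.mul_apply, h1, smul_smul]
    ring_nf

theorem isQComm_lower (i : ι) : IsQComm c fun j =>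
    (!![gen c j, 0; if i = j then 1 else 0, -(c j i) • gen c j] :
      Matrix (Fin 2) (Fin 2) (QAlg c)) := by
  intro j l
  have h1 := gen_isQComm c j l
  have h2 := hc j l
  ext a b
  fin_cases a <;> fin_cases b
  · simpa [Matrix.mul_apply] using h1
  · simp [Matrix.mul_apply]
  · by_cases hj : i = j <;> by_cases hl : i = l
    · subst hj; subst hl
      simp [Matrix.mul_apply, smul_smul, smul_add, hc]
      abel
    · subst hj; simp [Matrix.mul_apply, hl, smul_smul, h2]
    · subst hl; simp [Matrix.mul_apply, hj]
    · simp [Matrix.mul_apply, hj, hl]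
  · by_cases hl : i = l
    · simp [Matrix.mul_apply, h1, smul_smul, hl]
      ring_nf
    · simp [Matrix.mul_apply, h1, smul_smul, hl]
      ring_nf

/-- The algebra map `u ↦ (u, ∂_i u; 0, τ_i u)`. -/
def upper (i : ι) : QAlg c →ₐ[k] Matrix (Fin 2) (Fin 2) (QAlg c) :=
  lift c _ (isQComm_upper hc i)

/-- The algebra map `u ↦ (u, 0; ∂'_i u, τ'_i u)`. -/
def lower (i : ι) : QAlg c →ₐ[k] Matrix (Fin 2) (Fin 2) (QAlg c) :=
  lift c _ (isQComm_lower hc i)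

theorem upper_zero (i : ι) (u : QAlg c) : upper hc i u 0 0 = u ∧ upper hc i u 1 0 = 0 := by
  induction u using QAlg.induction with
  | hs r => simp [Matrix.algebraMap_matrix_apply]
  | hg i => simp [upper]
  | ha u v h1 h2 => simp [h1, h2]
  | hm u v h1 h2 => simp [h1, h2, Matrix.mul_apply]

theorem lower_zero (i : ι) (u : QAlg c) : lower hc i u 0 0 = u ∧ lower hc i u 0 1 = 0 := by
  induction u using QAlg.induction with
  | hs r => simp [Matrix.algebraMap_matrix_apply]
  | hg i => simp [lower]
  | ha u v h1 h2 => simp [h1, h2]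
  | hm u v h1 h2 => simp [h1, h2, Matrix.mul_apply]

/-- The right skew derivation `∂_i (u x_j) = δ_{ij} u - c_{ij} ∂_i (u) x_j`. -/
def pdR (i : ι) : QAlg c →ₗ[k] QAlg c :=
  (Matrix.entryLinearMap k (QAlg c) 0 1) ∘ₗ (upper hc i).toLinearMap

/-- The left skew derivation `∂'_i (x_j u) = δ_{ij} u - c_{ji} x_j ∂'_i (u)`. -/
def pdL (i : ι) : QAlg c →ₗ[k] QAlg c :=
  (Matrix.entryLinearMap k (QAlg c) 1 0) ∘ₗ (lower hc i).toLinearMap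

theorem pdR_mul (i : ι) (u v : QAlg c) :
    pdR hc i (u * v) = u * pdR hc i v + pdR hc i u * upper hc i v 1 1 := by
  simp [pdR, Matrix.mul_apply, upper_zero]

theorem pdL_mul (i : ι) (u v : QAlg c) :
    pdL hc i (u * v) = pdL hc i u * v + lower hc i u 1 1 * pdL hc i v := by
  simp [pdL, Matrix.mul_apply, lower_zero]

theorem pdR_gen (i j : ι) : pdR hc i (gen c j) = if i = j then 1 else 0 := by
  simp [pdR, upper]

theorem pdL_gen (i j : ι) : pdL hc i (gen c j) = if i = j then 1 else 0 := by
  simp [pdL, lower]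

theorem pdR_one (i : ι) : pdR hc i 1 = 0 := by simp [pdR]

theorem pdL_one (i : ι) : pdL hc i 1 = 0 := by simp [pdL]

theorem pdR_mul_gen (i j : ι) (u : QAlg c) :
    pdR hc i (u * gen c j) = (if i = j then u else 0) - c i j • (pdR hc i u * gen c j) := by
  have : upper hc i (gen c j) 1 1 = -(c i j) • gen c j := by simp [upper]
  rw [pdR_mul, pdR_gen, this, mul_ite, mul_one, mul_zero, mul_smul_comm, neg_smul, sub_eq_add_neg]

theorem pdL_gen_mul (i j : ι) (u : QAlg c) :
    pdL hc i (gen c j * u) = (if i = j then u else 0) - c j i • (gen c j * pdL hc i u) := by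
  have : lower hc i (gen c j) 1 1 = -(c j i) • gen c j := by simp [lower]
  rw [pdL_mul, pdL_gen, this, ite_mul, one_mul, zero_mul, smul_mul_assoc, neg_smul,
    sub_eq_add_neg]

/-- The number operators satisfy `N_i (u x_j) = N_i (u) x_j + δ_{ij} u x_j`. -/
theorem pdR_mul_gen_mul (i j : ι) (u : QAlg c) :
    pdR hc i (u * gen c j) * gen c i =
      pdR hc i u * gen c i * gen c j + if i = j then u * gen c j else 0 := by
  rw [pdR_mul_gen, sub_mul, mul_assoc (pdR hc i u), gen_isQComm c i j]
  split_ifs with h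
  · subst h; simp [mul_assoc]; abel
  · simp [mul_assoc]

theorem gen_mul_pdL_gen_mul (i j : ι) (u : QAlg c) :
    gen c i * pdL hc i (gen c j * u) =
      gen c j * (gen c i * pdL hc i u) + if i = j then gen c j * u else 0 := by
  rw [pdL_gen_mul, mul_sub, ← mul_assoc (gen c j), gen_isQComm c j i]
  split_ifs with h
  · subst h; simp [mul_assoc]; abel
  · simp [mul_assoc]

/-- The number operators are diagonal on words. Working with words as eigenvectors avoids any need
for a basis of `QAlg c`. -/
theorem pdR_list_prod_mul (i : ι) (l : List ι) :
    pdR hc i (l.map (gen c)).prod * gen c i = (l.count i : k) • (l.map (gen c)).prod := by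
  induction l using List.reverseRecOn with
  | nil => simp [pdR_one]
  | append_singleton l a ih =>
    rw [List.map_append, List.prod_append, List.map_singleton, List.prod_singleton,
      pdR_mul_gen_mul, ih, List.count_append, List.count_singleton]
    by_cases h : i = a
    · subst h; simp [add_smul]
    · simp [h, Ne.symm h]

theorem mul_pdL_list_prod (i : ι) (l : List ι) :
    gen c i * pdL hc i (l.map (gen c)).prod = (l.count i : k) • (l.map (gen c)).prod := by
  induction l with
  | nil => simp [pdL_one]
  | cons a l ih =>
    rw [List.map_cons, List.prod_cons, gen_mul_pdL_gen_mul, ih, List.count_cons]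
    by_cases h : i = a
    · subst h; simp [add_smul]
    · simp [h, Ne.symm h]

theorem pdR_list_prod_eq_zero {i : ι} {l : List ι} (h : i ∉ l) :
    pdR hc i (l.map (gen c)).prod = 0 := by
  induction l with
  | nil => simp [pdR_one]
  | cons a l ih =>
    simp only [List.mem_cons, not_or] at h
    rw [List.map_cons, List.prod_cons, pdR_mul, ih h.2, pdR_gen, if_neg h.1]
    simp

/-- The functional `aug ∘ ∂_{l_1} ∘ ⋯ ∘ ∂_{l_r}`. -/
def coeffList (l : List ι) : QAlg c →ₗ[k] k :=
  l.foldl (fun f i => f ∘ₗ pdR hc i) (aug c).toLinearMap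

end Derivations

end QAlg

/-! #### Sorting words -/

section Sorting

variable [LinearOrder ι] {B : Type*} [Ring B] [Algebra k B]

/-- The scalar that appears when a word is sorted. -/
def sortWeight (c : ι → ι → k) : List ι → k
  | [] => 1
  | a :: l => (l.map fun b => if b < a then -c a b else 1).prod * sortWeight c l

theorem IsQComm.mul_list_prod_sorted {c : ι → ι → k} {y : ι → B} (hy : IsQComm c y) (a : ι)
    (l : List ι) (hl : l.Pairwise (· ≤ ·)) :
    y a * (l.map y).prod = (l.map fun b => if b < a then -c a b else 1).prod •
      ((l.orderedInsert (· ≤ ·) a).map y).prod := by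
  induction l with
  | nil => simp
  | cons b l ih =>
    rw [List.pairwise_cons] at hl
    rw [List.orderedInsert_cons]
    split_ifs with h
    · have : ((b :: l).map fun b => if b < a then -c a b else 1) =
          (b :: l).map fun _ => (1 : k) := by
        refine List.map_congr_left fun x hx => if_neg (not_lt.2 ?_)
        rcases List.mem_cons.1 hx with rfl | hx
        · exact h
        · exact h.trans (hl.1 x hx)
      rw [this]
      simp
    · rw [List.map_cons, List.prod_cons, ← mul_assoc, hy a b, smul_mul_assoc, mul_assoc, ih hl.2,
        List.map_cons, List.prod_cons, List.map_cons, List.prod_cons, if_pos (not_le.1 h),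
        mul_smul_comm, smul_smul]

theorem IsQComm.list_prod_eq_smul_sorted {c : ι → ι → k} {y : ι → B} (hy : IsQComm c y)
    (l : List ι) :
    (l.map y).prod = sortWeight c l • ((l.insertionSort (· ≤ ·)).map y).prod := by
  induction l with
  | nil => simp [sortWeight]
  | cons a l ih =>
    rw [List.map_cons, List.prod_cons, ih, mul_smul_comm,
      hy.mul_list_prod_sorted a _ (List.pairwise_insertionSort _ _), smul_smul, sortWeight,
      List.insertionSort_cons, mul_comm]
    congr 2
    exact ((List.perm_insertionSort _ l).map _).prod_eq

/-- A word in which a letter with `c_{aa} = 1` occurs twice vanishes. -/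
theorem IsQComm.list_prod_eq_zero [CharZero k] {c : ι → ι → k} {y : ι → B} (hy : IsQComm c y)
    {a : ι} (ha : c a a = 1) {l : List ι} (hl : 2 ≤ l.count a) : (l.map y).prod = 0 := by
  have haa : y a * y a = 0 := by
    have h := hy a a
    rw [ha, neg_smul, one_smul] at h
    have h2 : (2 : k) • (y a * y a) = 0 := by rw [two_smul]; nth_rewrite 1 [h]; simp
    exact (smul_eq_zero.1 h2).resolve_left two_ne_zero
  -- Sorting makes the two copies of `a` adjacent, and the square of `y a` is zero.
  rw [hy.list_prod_eq_smul_sorted]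
  have hs := List.pairwise_insertionSort (· ≤ ·) l
  rw [← (List.perm_insertionSort (· ≤ ·) l).count_eq] at hl
  generalize l.insertionSort (· ≤ ·) = l' at hs hl
  rw [smul_eq_zero]
  right
  induction l' with
  | nil => simp at hl
  | cons b l' ih =>
    rw [List.pairwise_cons] at hs
    by_cases hab : b = a
    · subst hab
      rcases l' with _ | ⟨e, l'⟩
      · simp at hl
      · have he : e = b := by
          have hb : b ∈ e :: l' := by
            rw [← List.count_pos_iff]
            rw [List.count_cons_self] at hl; omega
          rw [List.pairwise_cons] at hs
          have h1 := hs.1 e (by simp)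
          rcases List.mem_cons.1 hb with h | h
          · exact h.symm
          · exact le_antisymm (hs.2.1 b h) h1
        subst he
        rw [List.map_cons, List.map_cons, List.prod_cons, List.prod_cons, ← mul_assoc, haa,
          zero_mul]
    · rw [List.count_cons_of_ne hab] at hl
      rw [List.map_cons, List.prod_cons, ih hs.2 hl, mul_zero]

end Sorting

end QAlg

/-! ### Coefficients of square-free monomials and quantum determinants -/

section TopCoefficient

variable {k : Type*} [Field k]

/-- Insertion sort contributes one factor for each inversion; this is the link with the coefficients
in `qDet`. -/
theorem sortWeight_ofFn {ι : Type*} [LinearOrder ι] (c : ι → ι → k) {N : ℕ} (J : Fin N → ι) :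
    sortWeight c (List.ofFn J) =
      ∏ i, ∏ j, if i < j ∧ J j < J i then -c (J i) (J j) else 1 := by
  induction N with
  | zero => simp [sortWeight]
  | succ N ih =>
    rw [List.ofFn_succ, sortWeight, ih, Fin.prod_univ_succ, List.map_ofFn, List.prod_ofFn]
    congr 1
    · rw [Fin.prod_univ_succ]
      simp
    · refine Finset.prod_congr rfl fun i _ => ?_
      rw [Fin.prod_univ_succ]
      simp

/-- The derivation applied first strips the last letter with coefficient one, as that letter occurs
nowhere else. In particular a word without repetitions is nonzero in `QAlg c`. -/
theorem QAlg.coeffList_list_prod {ι : Type*} [DecidableEq ι] {c : ι → ι → k}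
    (hc : ∀ i j, c i j * c j i = 1) {l : List ι} (hl : l.Nodup) :
    QAlg.coeffList hc l (l.map (QAlg.gen c)).prod = 1 := by
  have key : ∀ (l : List ι) (a : ι) (u : QAlg c),
      QAlg.coeffList hc (l ++ [a]) u = QAlg.coeffList hc l (QAlg.pdR hc a u) := by
    intro l a u
    simp [QAlg.coeffList, List.foldl_append]
  induction l using List.reverseRecOn with
  | nil => simp [QAlg.coeffList]
  | append_singleton l a ih =>
    rw [List.nodup_append] at hl
    have ha : a ∉ l := fun h => hl.2.2 a h a (by simp) rfl
    rw [key, List.map_append, List.prod_append, List.map_singleton, List.prod_singleton,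
      QAlg.pdR_mul_gen, QAlg.pdR_list_prod_eq_zero hc ha]
    simpa using ih hl.1

variable {n : ℕ}

/-- The coefficient of `x_1 ⋯ x_n` in `x_{J 1} ⋯ x_{J n}` if `x_i x_j = -c_{ij} x_j x_i` and
`x_i ^ 2 = 0`. -/
def topCoeff (c : Fin n → Fin n → k) (J : Fin n → Fin n) : k :=
  if Function.Bijective J then ∏ i, ∏ j, if i < j ∧ J j < J i then -c (J i) (J j) else 1 else 0

theorem sum_ite_bijective {M : Type*} [AddCommMonoid M] (F : (Fin n → Fin n) → M) :
    (∑ J, if Function.Bijective J then F J else 0) = ∑ σ : Equiv.Perm (Fin n), F σ := by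
  rw [← Finset.sum_filter]
  refine Finset.sum_bij' (fun J hJ => Equiv.ofBijective J (Finset.mem_filter.1 hJ).2)
    (fun σ _ => σ) ?_ ?_ ?_ ?_ ?_
  · simp
  · intro σ _; exact Finset.mem_filter.2 ⟨Finset.mem_univ _, σ.bijective⟩
  · intro J _; rfl
  · intro σ _; ext; rfl
  · intro J _; rfl

/-- Summing over all maps rather than permutations matches the expansion of a coaction into words,
where words with repeated letters have coefficient zero. -/
theorem qDet_eq_sum_topCoeff {K : Type*} [Ring K] [Algebra k K] (c : Fin n → Fin n → k)
    (Z : Matrix (Fin n) (Fin n) K) :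
    qDet c Z = ∑ J : Fin n → Fin n, topCoeff c J • (List.ofFn fun i => Z (J i) i).prod := by
  rw [qDet, ← sum_ite_bijective fun J => (∏ i, ∏ j, if i < j ∧ J j < J i then -c (J i) (J j)
    else 1) • (List.ofFn fun i => Z (J i) i).prod]
  refine Finset.sum_congr rfl fun J _ => ?_
  rw [topCoeff]
  split_ifs <;> simp

/-- A word of length n in n letters either repeats a letter, and vanishes, or sorts to the top
monomial at the cost of its inversions. -/
theorem IsQComm.list_prod_ofFn [CharZero k] {B : Type*} [Ring B] [Algebra k B]
    {c : Fin n → Fin n → k} {y : Fin n → B} (hy : IsQComm c y) (hc : ∀ i, c i i = 1)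
    (J : Fin n → Fin n) :
    (List.ofFn fun s => y (J s)).prod = topCoeff c J • (List.ofFn y).prod := by
  have h1 : (List.ofFn fun s => y (J s)) = (List.ofFn J).map y := by rw [List.map_ofFn]; rfl
  rw [topCoeff]
  split_ifs with hJ
  · have h2 : (List.ofFn J).insertionSort (· ≤ ·) = List.finRange n := by
      refine List.Perm.eq_of_pairwise (le := (· ≤ ·)) (fun a b _ _ => le_antisymm)
        (List.pairwise_insertionSort _ _) (List.pairwise_le_finRange n) ?_
      refine (List.perm_insertionSort _ _).trans ((List.perm_ext_iff_of_nodup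
        (List.nodup_ofFn.2 hJ.1) (List.nodup_finRange n)).2 fun a => ?_)
      simpa [List.mem_ofFn] using hJ.2 a
    rw [h1, hy.list_prod_eq_smul_sorted, h2, sortWeight_ofFn, List.ofFn_eq_map]
  · have : ∃ a, 2 ≤ (List.ofFn J).count a := by
      by_contra! h
      apply hJ
      rw [← Finite.injective_iff_bijective, ← List.nodup_ofFn, List.nodup_iff_count_le_one]
      exact fun a => Nat.le_of_lt_succ (h a)
    obtain ⟨a, ha⟩ := this
    rw [h1, hy.list_prod_eq_zero (hc a) ha, zero_smul]

theorem QAlg.exists_top [CharZero k] {c : Fin n → Fin n → k} (hc : ∀ i j, c i j * c j i = 1)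
    (hc1 : ∀ i, c i i = 1) :
    ∃ φ : QAlg c →ₗ[k] k, ∀ J : Fin n → Fin n,
      φ (List.ofFn fun s => QAlg.gen c (J s)).prod = topCoeff c J := by
  refine ⟨QAlg.coeffList hc (List.finRange n), fun J => ?_⟩
  rw [(QAlg.gen_isQComm c).list_prod_ofFn hc1, map_smul, List.ofFn_eq_map,
    QAlg.coeffList_list_prod hc (List.nodup_finRange n), smul_eq_mul, mul_one]

/-- The coefficient of `x_{e 1} ⋯ x_{e r}`, for an injective map `e`. -/
theorem QAlg.exists_coeff [CharZero k] {ι : Type*} {c : ι → ι → k} {r : ℕ}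
    (hc : ∀ i j, c i j * c j i = 1) (e : Fin r → ι) (he : Function.Injective e)
    (hc1 : ∀ i, c (e i) (e i) = 1) :
    ∃ φ : QAlg c →ₗ[k] k,
      (∀ J : Fin r → Fin r, φ (List.ofFn fun s => QAlg.gen c (e (J s))).prod =
        topCoeff (fun i j => c (e i) (e j)) J) ∧
      ∀ j, j ∉ Set.range e → ∀ u v, φ (u * QAlg.gen c j * v) = 0 := by
  classical
  obtain ⟨φ, hφ⟩ := QAlg.exists_top (c := fun i j => c (e i) (e j)) (fun i j => hc _ _) hc1
  -- Sending the generators outside the range of `e` to zero respects the relations and reduces the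
  -- claim to the top coefficient.
  let y : ι → QAlg (fun i j => c (e i) (e j)) := fun j =>
    if h : ∃ i, e i = j then QAlg.gen _ h.choose else 0
  have hye : ∀ i, y (e i) = QAlg.gen _ i := by
    intro i
    have h : ∃ i', e i' = e i := ⟨i, rfl⟩
    simp only [y, dif_pos h]
    rw [he h.choose_spec]
  have hy0 : ∀ j, j ∉ Set.range e → y j = 0 := fun j hj => dif_neg hj
  have hy : IsQComm c y := by
    intro i j
    by_cases hi : i ∈ Set.range e
    · by_cases hj : j ∈ Set.range e
      · obtain ⟨i, rfl⟩ := hi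
        obtain ⟨j, rfl⟩ := hj
        rw [hye, hye]
        exact QAlg.gen_isQComm _ i j
      · simp [hy0 j hj]
    · simp [hy0 i hi]
  refine ⟨φ ∘ₗ (QAlg.lift c y hy).toLinearMap, fun J => ?_, fun j hj u v => ?_⟩
  · rw [← hφ]
    simp [map_list_prod, List.map_ofFn, Function.comp_def, hye]
  · simp [hy0 j hj]

theorem QAlg.sum_coeff {ι : Type*} [Fintype ι] {c : ι → ι → k} {r : ℕ} {e : Fin r → ι}
    (he : Function.Injective e) {φ : QAlg c →ₗ[k] k}
    (h1 : ∀ J : Fin r → Fin r, φ (List.ofFn fun s => QAlg.gen c (e (J s))).prod =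
        topCoeff (fun i j => c (e i) (e j)) J)
    (h2 : ∀ j, j ∉ Set.range e → ∀ u v, φ (u * QAlg.gen c j * v) = 0)
    {M : Type*} [AddCommMonoid M] [Module k M] (F : (Fin r → ι) → M) :
    ∑ J, φ (List.ofFn fun s => QAlg.gen c (J s)).prod • F J =
      ∑ J : Fin r → Fin r, topCoeff (fun i j => c (e i) (e j)) J • F (fun s => e (J s)) := by
  have hinj : Function.Injective fun (J : Fin r → Fin r) s => e (J s) := fun J J' h =>
    funext fun s => he (congrFun h s)
  rw [← Fintype.sum_of_injective _ hinj (fun J => topCoeff (fun i j => c (e i) (e j)) J •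
    F (fun s => e (J s))) _ ?_ fun J => by rw [← h1]]
  intro J hJ
  have : ∃ s, J s ∉ Set.range e := by
    by_contra! h
    choose J' hJ' using h
    exact hJ ⟨J', funext hJ'⟩
  obtain ⟨s, hs⟩ := this
  obtain ⟨l1, l2, hl⟩ := List.append_of_mem
    (List.mem_ofFn.2 ⟨s, rfl⟩ : QAlg.gen c (J s) ∈ List.ofFn fun s => QAlg.gen c (J s))
  rw [hl, List.prod_append, List.prod_cons, ← mul_assoc, h2 _ hs, zero_smul]

end TopCoefficient

/-! ### The Koszul complex -/

open Classical in
/-- If `D ^ 2 = 0`, a cocycle for `D` is cohomologous to its part in the kernel of the Laplacian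
`hD + Dh`. -/
theorem sum_eigenvectors_mem_range {k V κ : Type*} [Field k] [AddCommGroup V] [Module k V]
    (D h : Module.End k V) (hD : D * D = 0) (s : Finset κ) (x : κ → V) (e : κ → k)
    (hx : ∀ i, (h * D + D * h) (x i) = e i • x i) (hv : D (∑ i ∈ s, x i) = 0) :
    (∑ i ∈ s, if e i = 0 then 0 else x i) ∈ LinearMap.range D := by
  set L := h * D + D * h with hL
  set v := ∑ i ∈ s, x i with hv'
  -- `g` annihilates the eigenvectors with nonzero eigenvalue, and g(0) ≠ 0. On cocycles L = Dh, so
  -- g = X·g₁ + g(0) writes g(L)v as an exact term plus g(0)v. The individual `x i` need not be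
  -- cocycles.
  let g : Polynomial k := ∏ i ∈ s, if e i = 0 then 1 else Polynomial.X - Polynomial.C (e i)
  have hg0 : g.coeff 0 ≠ 0 := by
    rw [Polynomial.coeff_zero_eq_eval_zero, Polynomial.eval_prod, Finset.prod_ne_zero_iff]
    intro i _
    split_ifs with h0
    · simp
    · simpa using h0
  have hgx : ∀ i, Polynomial.aeval L g (x i) = g.eval (e i) • x i := fun i =>
    Module.End.aeval_apply_of_mem_apply_eq_smul (hx i)
  have hgv : Polynomial.aeval L g v = g.coeff 0 • (v - ∑ i ∈ s, if e i = 0 then 0 else x i) := by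
    rw [hv', map_sum, ← Finset.sum_sub_distrib, Finset.smul_sum]
    refine Finset.sum_congr rfl fun i hi => ?_
    rw [hgx]
    split_ifs with h0
    · rw [h0, Polynomial.coeff_zero_eq_eval_zero, sub_zero]
    · have : g.eval (e i) = 0 := by
        rw [Polynomial.eval_prod]
        refine Finset.prod_eq_zero hi ?_
        rw [if_neg h0]; simp
      rw [this, sub_self, zero_smul, smul_zero]
  have hDL : Commute D L := by
    simp only [Commute, SemiconjBy, hL, mul_add, add_mul, ← mul_assoc, hD]
    simp [mul_assoc, hD]
  set w := Polynomial.aeval L g.divX v with hw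
  have hDw : D w = 0 := by
    have : Commute D (Polynomial.aeval L g.divX) := by
      induction g.divX using Polynomial.induction_on' with
      | add p r hp hr => rw [map_add]; exact hp.add_right hr
      | monomial n a =>
        rw [Polynomial.aeval_monomial]
        exact (show Commute D _ from (Algebra.commutes' a D).symm).mul_right (hDL.pow_right n)
    rw [hw, ← Module.End.mul_apply, this.eq, Module.End.mul_apply, hv, map_zero]
  have hLw : L w = D (h w) := by
    simp [hL, hDw]
  have hsplit : Polynomial.aeval L g v = L w + g.coeff 0 • v := by
    conv_lhs => rw [← Polynomial.X_mul_divX_add g]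
    simp only [map_add, map_mul, Polynomial.aeval_X, Polynomial.aeval_C, LinearMap.add_apply,
      Module.End.mul_apply, Module.algebraMap_end_apply, hw]
  rw [hgv, hLw, smul_sub] at hsplit
  refine ⟨-(g.coeff 0)⁻¹ • h w, ?_⟩
  have : g.coeff 0 • (∑ i ∈ s, if e i = 0 then 0 else x i) = - D (h w) := by
    rw [add_comm, sub_eq_iff_eq_add, add_assoc, left_eq_add, add_comm] at hsplit
    exact (neg_eq_of_add_eq_zero_left hsplit).symm
  rw [map_smul, neg_smul, ← smul_neg, ← this, smul_smul, inv_mul_cancel₀ hg0, one_smul]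

section Complex

variable {k : Type*} [Field k] {ι : Type*} [Fintype ι] (c : ι → ι → k)

/-- The differential `u ⊗ w ↦ ∑_i u x_i ⊗ ξ^i w`. -/
def qKoszulD : Module.End k (QAlg c ⊗[k] QAlg (-c)) :=
  ∑ i, TensorProduct.map (LinearMap.mulRight k (QAlg.gen c i))
    (LinearMap.mulLeft k (QAlg.gen (-c) i))

theorem qKoszulD_tmul (u : QAlg c) (w : QAlg (-c)) :
    qKoszulD c (u ⊗ₜ w) = ∑ i, (u * QAlg.gen c i) ⊗ₜ (QAlg.gen (-c) i * w) := by
  simp [qKoszulD, LinearMap.sum_apply]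

variable {c}

/-- Exchanging x_i with x_j costs -c_ij and exchanging ξ^j with ξ^i costs c_ji. The product is -1,
so the double sum is antisymmetric. -/
theorem qKoszulD_mul_self [CharZero k] (hc : ∀ i j, c i j * c j i = 1) :
    qKoszulD c * qKoszulD c = 0 := by
  refine TensorProduct.ext' fun u w => ?_
  rw [Module.End.mul_apply, qKoszulD_tmul, map_sum, LinearMap.zero_apply]
  simp_rw [qKoszulD_tmul]
  set a : ι → ι → QAlg c ⊗[k] QAlg (-c) := fun i j =>
    (u * QAlg.gen c i * QAlg.gen c j) ⊗ₜ (QAlg.gen (-c) j * (QAlg.gen (-c) i * w)) with ha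
  have h1 : ∀ i j, a i j = - a j i := by
    intro i j
    simp only [ha]
    rw [mul_assoc u, QAlg.gen_isQComm c i j, ← mul_assoc _ _ w, QAlg.gen_isQComm (-c) j i]
    simp only [Pi.neg_apply, neg_neg, mul_smul_comm, smul_mul_assoc, TensorProduct.tmul_smul,
      ← TensorProduct.smul_tmul', hc, ← mul_assoc, neg_smul, one_smul, smul_smul, mul_neg,
      TensorProduct.neg_tmul, smul_neg]
  have h2 : ∑ i, ∑ j, a i j = - ∑ i, ∑ j, a i j := by
    conv_lhs => rw [Finset.sum_comm]
    simp_rw [← Finset.sum_neg_distrib]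
    exact Finset.sum_congr rfl fun i _ => Finset.sum_congr rfl fun j _ => h1 j i
  have h3 : (2 : k) • ∑ i, ∑ j, a i j = 0 := by
    rw [two_smul]; nth_rewrite 1 [h2]; simp
  exact (smul_eq_zero.1 h3).resolve_left two_ne_zero

omit [Fintype ι] in
theorem neg_mul_neg_swap (hc : ∀ i j, c i j * c j i = 1) (i j : ι) : (-c) i j * (-c) j i = 1 := by
  simp [hc]

variable [DecidableEq ι]

/-- The homotopy `∑_i ∂_i ⊗ ∂'_i`. -/
def qKoszulH (hc : ∀ i j, c i j * c j i = 1) : Module.End k (QAlg c ⊗[k] QAlg (-c)) :=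
  ∑ i, TensorProduct.map (QAlg.pdR hc i) (QAlg.pdL (neg_mul_neg_swap hc) i)

theorem qKoszulH_tmul (hc : ∀ i j, c i j * c j i = 1) (u : QAlg c) (w : QAlg (-c)) :
    qKoszulH hc (u ⊗ₜ w) =
      ∑ i, QAlg.pdR hc i u ⊗ₜ QAlg.pdL (neg_mul_neg_swap hc) i w := by
  simp [qKoszulH, LinearMap.sum_apply]

/-- The contributions of i ≠ j to hD and Dh cancel. For i = j the terms of the form ∂_i(u)x_i ⊗ ξ^i
∂'_i(w) cancel because c_ii² = 1, which leaves only number operators. -/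
theorem laplacian_tmul (hc : ∀ i j, c i j * c j i = 1) (u : QAlg c) (w : QAlg (-c)) :
    (qKoszulH hc * qKoszulD c + qKoszulD c * qKoszulH hc) (u ⊗ₜ w) =
      ∑ i, (u ⊗ₜ w + c i i • (u ⊗ₜ (QAlg.gen (-c) i * QAlg.pdL (neg_mul_neg_swap hc) i w) -
        (QAlg.pdR hc i u * QAlg.gen c i) ⊗ₜ w)) := by
  rw [LinearMap.add_apply, Module.End.mul_apply, Module.End.mul_apply, qKoszulD_tmul,
    qKoszulH_tmul, map_sum, map_sum]
  simp_rw [qKoszulD_tmul, qKoszulH_tmul]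
  rw [Finset.sum_comm, ← Finset.sum_add_distrib]
  refine Finset.sum_congr rfl fun i _ => ?_
  rw [← Finset.sum_add_distrib, Finset.sum_eq_single i]
  · rw [QAlg.pdR_mul_gen, QAlg.pdL_gen_mul, if_pos rfl, if_pos rfl]
    simp only [Pi.neg_apply, neg_smul, sub_neg_eq_add, TensorProduct.sub_tmul,
      TensorProduct.tmul_add, hc, smul_sub, one_smul, smul_smul,
      TensorProduct.tmul_smul, ← TensorProduct.smul_tmul']
    abel
  · intro j _ hj
    rw [QAlg.pdR_mul_gen, QAlg.pdL_gen_mul, if_neg hj.symm, if_neg hj.symm]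
    simp only [Pi.neg_apply, neg_smul, zero_sub, neg_neg, hc, one_smul, smul_smul,
      TensorProduct.neg_tmul, TensorProduct.tmul_smul, ← TensorProduct.smul_tmul', smul_neg,
      neg_add_cancel]
  · simp

/-- The eigenvalue of the Laplacian on a monomial. -/
def lapWeight (c : ι → ι → k) (l l' : List ι) : k :=
  ∑ i, (1 + c i i * ((l'.count i : k) - l.count i))

theorem laplacian_monomial (hc : ∀ i j, c i j * c j i = 1) (l l' : List ι) :
    (qKoszulH hc * qKoszulD c + qKoszulD c * qKoszulH hc)
      ((l.map (QAlg.gen c)).prod ⊗ₜ (l'.map (QAlg.gen (-c))).prod) =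
      lapWeight c l l' • ((l.map (QAlg.gen c)).prod ⊗ₜ (l'.map (QAlg.gen (-c))).prod) := by
  rw [laplacian_tmul, lapWeight, Finset.sum_smul]
  refine Finset.sum_congr rfl fun i _ => ?_
  rw [QAlg.pdR_list_prod_mul, QAlg.mul_pdL_list_prod, TensorProduct.tmul_smul,
    ← TensorProduct.smul_tmul', ← sub_smul, smul_smul, add_smul, one_smul]

end Complex

/-! ### Harmonic monomials: only ω survives in cohomology -/

section Exactness

variable {k : Type*} [Field k] [CharZero k] {ι : Type*} [Fintype ι] [LinearOrder ι]
  {c : ι → ι → k}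

omit [Fintype ι] in
theorem insertionSort_eq_of_count {l le : List ι} (hle : le.Pairwise (· < ·))
    (h : ∀ i, l.count i = if i ∈ le then 1 else 0) : l.insertionSort (· ≤ ·) = le := by
  refine List.Perm.eq_of_pairwise (le := (· ≤ ·)) (fun a b _ _ => le_antisymm)
    (List.pairwise_insertionSort _ _) (hle.imp le_of_lt) ?_
  refine (List.perm_insertionSort _ _).trans (List.perm_iff_count.2 fun i => ?_)
  have hn : le.Nodup := hle.imp ne_of_lt
  rw [h, List.Nodup.count hn]

/-- A letter with c_ii = 1 occurs at most once on the left of a nonzero monomial, one with c_ii = -1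
at most once on the right. Each summand of the eigenvalue is then a natural number, and all of them
vanish only if every letter of the first kind occurs once on the left and not on the right, and vice
versa for the second kind. That is ω up to order. -/
theorem monomial_mem_span_of_lapWeight (hcc : ∀ i, c i i = 1 ∨ c i i = -1) {le lo : List ι}
    (hle : le.Pairwise (· < ·)) (hlo : lo.Pairwise (· < ·)) (hme : ∀ i, i ∈ le ↔ c i i = 1)
    (hmo : ∀ i, i ∈ lo ↔ c i i = -1) {l l' : List ι} (h : lapWeight c l l' = 0) :
    ∃ r : k, (l.map (QAlg.gen c)).prod ⊗ₜ[k] (l'.map (QAlg.gen (-c))).prod =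
      r • ((le.map (QAlg.gen c)).prod ⊗ₜ[k] (lo.map (QAlg.gen (-c))).prod) := by
  have hne : (1 : k) ≠ -1 := by
    intro h
    have h2 : (2 : k) = 0 := by rw [← one_add_one_eq_two]; nth_rewrite 1 [h]; simp
    exact two_ne_zero h2
  classical
  by_cases h1 : ∃ i, c i i = 1 ∧ 2 ≤ l.count i
  · obtain ⟨i, hi, h2⟩ := h1
    exact ⟨0, by rw [(QAlg.gen_isQComm c).list_prod_eq_zero hi h2, zero_smul,
      TensorProduct.zero_tmul]⟩
  by_cases h1' : ∃ i, c i i = -1 ∧ 2 ≤ l'.count i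
  · obtain ⟨i, hi, h2⟩ := h1'
    exact ⟨0, by rw [(QAlg.gen_isQComm (-c)).list_prod_eq_zero (a := i) (by simp [hi]) h2,
      zero_smul, TensorProduct.tmul_zero]⟩
  push Not at h1 h1'
  -- The natural subtractions do not truncate, by the bounds just obtained. Characteristic zero
  -- turns the vanishing of the eigenvalue into the vanishing of each natural summand.
  have hcount : ∀ i, (if c i i = 1 then (1 - l.count i) + l'.count i
      else (1 - l'.count i) + l.count i) = 0 := by
    have hs : lapWeight c l l' = ((∑ i, if c i i = 1 then (1 - l.count i) + l'.count i
      else (1 - l'.count i) + l.count i : ℕ) : k) := by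
      rw [lapWeight, Nat.cast_sum]
      refine Finset.sum_congr rfl fun i _ => ?_
      rcases hcc i with hi | hi
      · have := h1 i hi
        rw [if_pos hi, hi, Nat.cast_add, Nat.cast_sub (by omega)]
        push_cast; ring
      · have := h1' i hi
        rw [if_neg (by rw [hi]; exact hne.symm), hi, Nat.cast_add, Nat.cast_sub (by omega)]
        push_cast; ring
    rw [hs, Nat.cast_eq_zero, Finset.sum_eq_zero_iff] at h
    exact fun i => h i (Finset.mem_univ i)
  have hl : ∀ i, l.count i = if i ∈ le then 1 else 0 := by
    intro i
    have := hcount i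
    rcases hcc i with hi | hi
    · have := h1 i hi
      rw [if_pos ((hme i).2 hi)]; rw [if_pos hi] at *; omega
    · have h3 : ¬ c i i = 1 := by rw [hi]; exact hne.symm
      rw [if_neg (fun h => h3 ((hme i).1 h))]; rw [if_neg h3] at *; omega
  have hl' : ∀ i, l'.count i = if i ∈ lo then 1 else 0 := by
    intro i
    have := hcount i
    rcases hcc i with hi | hi
    · rw [if_neg (fun h => hne (hi.symm.trans ((hmo i).1 h)))]; rw [if_pos hi] at *; omega
    · have h3 : ¬ c i i = 1 := by rw [hi]; exact hne.symm
      have := h1' i hi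
      rw [if_pos ((hmo i).2 hi)]; rw [if_neg h3] at *; omega
  rw [(QAlg.gen_isQComm c).list_prod_eq_smul_sorted l,
    (QAlg.gen_isQComm (-c)).list_prod_eq_smul_sorted l', insertionSort_eq_of_count hle hl,
    insertionSort_eq_of_count hlo hl', TensorProduct.smul_tmul_smul]
  exact ⟨_, rfl⟩

/-- A cocycle is cohomologous to a multiple of `ω`. -/
theorem exists_sub_mem_range_qKoszulD {K : Type*} [Ring K] [Algebra k K]
    (hc : ∀ i j, c i j * c j i = 1)
    (hcc : ∀ i, c i i = 1 ∨ c i i = -1) {le lo : List ι}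
    (hle : le.Pairwise (· < ·)) (hlo : lo.Pairwise (· < ·)) (hme : ∀ i, i ∈ le ↔ c i i = 1)
    (hmo : ∀ i, i ∈ lo ↔ c i i = -1) {κ : Type*} (s : Finset κ) (l l' : κ → List ι) (a : κ → K)
    (hv : (qKoszulD c).rTensor K (∑ i ∈ s, (((l i).map (QAlg.gen c)).prod ⊗ₜ[k]
      ((l' i).map (QAlg.gen (-c))).prod) ⊗ₜ[k] a i) = 0) :
    ∃ b : K, (∑ i ∈ s, (((l i).map (QAlg.gen c)).prod ⊗ₜ[k]
      ((l' i).map (QAlg.gen (-c))).prod) ⊗ₜ[k] a i) -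
        ((le.map (QAlg.gen c)).prod ⊗ₜ[k] (lo.map (QAlg.gen (-c))).prod) ⊗ₜ[k] b ∈
      LinearMap.range ((qKoszulD c).rTensor K) := by
  classical
  have hr : ∀ i, ∃ r : k, lapWeight c (l i) (l' i) = 0 →
      ((l i).map (QAlg.gen c)).prod ⊗ₜ[k] ((l' i).map (QAlg.gen (-c))).prod =
      r • ((le.map (QAlg.gen c)).prod ⊗ₜ[k] (lo.map (QAlg.gen (-c))).prod) := by
    intro i
    by_cases h : lapWeight c (l i) (l' i) = 0
    · obtain ⟨r, hr⟩ := monomial_mem_span_of_lapWeight hcc hle hlo hme hmo h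
      exact ⟨r, fun _ => hr⟩
    · exact ⟨0, fun h' => absurd h' h⟩
  choose r hr using hr
  refine ⟨∑ i ∈ s, if lapWeight c (l i) (l' i) = 0 then r i • a i else 0, ?_⟩
  have key := sum_eigenvectors_mem_range ((qKoszulD c).rTensor K) ((qKoszulH hc).rTensor K)
    (by rw [Module.End.mul_eq_comp, ← LinearMap.rTensor_comp, ← Module.End.mul_eq_comp,
      qKoszulD_mul_self hc, LinearMap.rTensor_zero]) s _ (fun i => lapWeight c (l i) (l' i))
    (fun i => by
      rw [Module.End.mul_eq_comp, Module.End.mul_eq_comp, ← LinearMap.rTensor_comp,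
        ← LinearMap.rTensor_comp, ← LinearMap.rTensor_add, LinearMap.rTensor_tmul,
        ← Module.End.mul_eq_comp, ← Module.End.mul_eq_comp, laplacian_monomial,
        ← TensorProduct.smul_tmul']) hv
  convert key using 1
  rw [TensorProduct.tmul_sum, ← Finset.sum_sub_distrib]
  refine Finset.sum_congr rfl fun i _ => ?_
  split_ifs with h
  · rw [hr i h, TensorProduct.tmul_smul, ← TensorProduct.smul_tmul', sub_self]
  · simp

end Exactness

/-! ### Quadratic matrix relations -/

section Relations

variable {k : Type*} [Field k] {ι : Type*} {K : Type*} [Ring K] [Algebra k K]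

/-- The relations `R Z₁ Z₂ = Z₁ Z₂ R` for `R^{ab}_{ij} = α_{ij} δ^a_i δ^b_j + β_{ij} δ^a_j δ^b_i`. -/
def RRel (α β : ι → ι → k) (Z : Matrix ι ι K) : Prop :=
  ∀ u v i j, α u v • (Z u i * Z v j) + β v u • (Z v i * Z u j) =
    α i j • (Z u i * Z v j) + β i j • (Z u j * Z v i)

/-- The relations `R W₂ W₁ = W₂ W₁ R`. -/
def RRelOp (α β : ι → ι → k) (W : Matrix ι ι K) : Prop :=
  ∀ u v i j, α u v • (W v j * W u i) + β v u • (W u j * W v i) =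
    α i j • (W v j * W u i) + β i j • (W v i * W u j)

theorem RRelOp.op {α β : ι → ι → k} {W : Matrix ι ι K} (h : RRelOp α β W) :
    RRel α β (W.map (MulOpposite.op : K → Kᵐᵒᵖ)) := by
  intro u v i j
  simpa [← MulOpposite.op_mul, ← MulOpposite.op_smul, ← MulOpposite.op_add] using h u v i j

theorem RRelOp.transpose {α β : ι → ι → k} {W : Matrix ι ι K} (h : RRelOp α β W) :
    RRel (fun i j => α j i) β W.transpose :=
  fun u v i j => (h j i v u).symm

theorem RRel.op_transpose {α β : ι → ι → k} {Z : Matrix ι ι K} (h : RRel α β Z) :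
    RRel (fun i j => α j i) β (Z.transpose.map (MulOpposite.op : K → Kᵐᵒᵖ)) := by
  intro u v i j
  have := (h j i v u).symm
  simpa [← MulOpposite.op_mul, ← MulOpposite.op_smul, ← MulOpposite.op_add] using this

variable [Fintype ι] [DecidableEq ι]

/-- The matrix of `R`. -/
def rMat (K : Type*) [Ring K] [Algebra k K] (α β : ι → ι → k) : Matrix (ι × ι) (ι × ι) K :=
  Matrix.of fun a i => algebraMap k K
    (α i.1 i.2 * (if a = i then 1 else 0) + β i.1 i.2 * (if a = i.swap then 1 else 0))

theorem rMat_mul (α β : ι → ι → k) (M : Matrix (ι × ι) (ι × ι) K) (u v : ι) (i : ι × ι) :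
    (rMat K α β * M) (u, v) i = α u v • M (u, v) i + β v u • M (v, u) i := by
  have h : ∀ a : ι × ι, ((u, v) = a.swap) ↔ (a = (v, u)) := by
    rintro ⟨a, b⟩; simp only [Prod.swap_prod_mk, Prod.mk.injEq]; tauto
  simp only [Matrix.mul_apply, rMat, Matrix.of_apply, h, eq_comm (a := (u, v)), map_add, add_mul,
    Finset.sum_add_distrib, apply_ite (algebraMap k K), map_zero, mul_ite,
    mul_one, mul_zero, ite_mul, zero_mul, Finset.sum_ite_eq', Finset.mem_univ, if_true,
    Algebra.smul_def]

theorem mul_rMat (α β : ι → ι → k) (M : Matrix (ι × ι) (ι × ι) K) (a : ι × ι) (i j : ι) :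
    (M * rMat K α β) a (i, j) = α i j • M a (i, j) + β i j • M a (j, i) := by
  simp only [Matrix.mul_apply, rMat, Matrix.of_apply, Prod.swap_prod_mk, map_add, mul_add,
    Finset.sum_add_distrib, apply_ite (algebraMap k K), map_zero, mul_ite,
    mul_one, mul_zero, Finset.sum_ite_eq', Finset.mem_univ, if_true, Algebra.smul_def,
    Algebra.commutes]

/-- `Z₁ Z₂`. -/
def tensorSq (Z : Matrix ι ι K) : Matrix (ι × ι) (ι × ι) K :=
  Matrix.of fun a i => Z a.1 i.1 * Z a.2 i.2

/-- `W₂ W₁`. -/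
def tensorSqOp (W : Matrix ι ι K) : Matrix (ι × ι) (ι × ι) K :=
  Matrix.of fun a i => W a.2 i.2 * W a.1 i.1

theorem rRel_iff (α β : ι → ι → k) (Z : Matrix ι ι K) :
    RRel α β Z ↔ rMat K α β * tensorSq Z = tensorSq Z * rMat K α β := by
  constructor
  · intro h
    ext ⟨u, v⟩ ⟨i, j⟩
    rw [rMat_mul, mul_rMat]
    exact h u v i j
  · intro h u v i j
    have := congrFun (congrFun h (u, v)) (i, j)
    rwa [rMat_mul, mul_rMat] at this

theorem rRelOp_iff (α β : ι → ι → k) (W : Matrix ι ι K) :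
    RRelOp α β W ↔ rMat K α β * tensorSqOp W = tensorSqOp W * rMat K α β := by
  constructor
  · intro h
    ext ⟨u, v⟩ ⟨i, j⟩
    rw [rMat_mul, mul_rMat]
    exact h u v i j
  · intro h u v i j
    have := congrFun (congrFun h (u, v)) (i, j)
    rwa [rMat_mul, mul_rMat] at this

theorem tensorSq_mul_tensorSqOp {Z W : Matrix ι ι K} (h : Z * W = 1) :
    tensorSq Z * tensorSqOp W = 1 := by
  ext ⟨u, v⟩ ⟨i, j⟩
  have h1 : ∀ a b, ∑ x, Z a x * W x b = (1 : Matrix ι ι K) a b := fun a b => by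
    rw [← h, Matrix.mul_apply]
  rw [Matrix.mul_apply, Fintype.sum_prod_type]
  have : ∀ a, ∑ s, tensorSq Z (u, v) (a, s) * tensorSqOp W (a, s) (i, j) =
      Z u a * ((1 : Matrix ι ι K) v j * W a i) := by
    intro a
    rw [← h1, Finset.sum_mul, Finset.mul_sum]
    simp [tensorSq, tensorSqOp, mul_assoc]
  simp_rw [this, Matrix.one_apply]
  by_cases hv : v = j
  · simp [hv, h1, Matrix.one_apply]
  · simp [hv]

theorem tensorSqOp_mul_tensorSq {Z W : Matrix ι ι K} (h : W * Z = 1) :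
    tensorSqOp W * tensorSq Z = 1 := by
  ext ⟨u, v⟩ ⟨i, j⟩
  have h1 : ∀ a b, ∑ x, W a x * Z x b = (1 : Matrix ι ι K) a b := fun a b => by
    rw [← h, Matrix.mul_apply]
  rw [Matrix.mul_apply, Fintype.sum_prod_type_right]
  have : ∀ s, ∑ a, tensorSqOp W (u, v) (a, s) * tensorSq Z (a, s) (i, j) =
      W v s * ((1 : Matrix ι ι K) u i * Z s j) := by
    intro s
    rw [← h1, Finset.sum_mul, Finset.mul_sum]
    simp [tensorSq, tensorSqOp, mul_assoc]
  simp_rw [this, Matrix.one_apply]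
  by_cases hu : u = i
  · simp [hu, h1, Matrix.one_apply]
  · simp [hu]

/-- The inverse of Z₁Z₂ is W₂W₁, and the inverse of a matrix commuting with R commutes with R. -/
theorem RRel.inv {α β : ι → ι → k} {Z W : Matrix ι ι K} (h : RRel α β Z) (h1 : Z * W = 1)
    (h2 : W * Z = 1) : RRelOp α β W := by
  rw [rRel_iff] at h
  rw [rRelOp_iff]
  have e1 := tensorSq_mul_tensorSqOp h1
  have e2 := tensorSqOp_mul_tensorSq h2
  calc rMat K α β * tensorSqOp W
      = tensorSqOp W * tensorSq Z * rMat K α β * tensorSqOp W := by rw [e2, one_mul]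
    _ = tensorSqOp W * (tensorSq Z * rMat K α β) * tensorSqOp W := by simp only [mul_assoc]
    _ = tensorSqOp W * rMat K α β * (tensorSq Z * tensorSqOp W) := by
      rw [← h]; simp only [mul_assoc]
    _ = _ := by rw [e1, mul_one]

theorem RRelOp.inv {α β : ι → ι → k} {Z W : Matrix ι ι K} (h : RRelOp α β W) (h1 : Z * W = 1)
    (h2 : W * Z = 1) : RRel α β Z := by
  rw [rRelOp_iff] at h
  rw [rRel_iff]
  have e1 := tensorSq_mul_tensorSqOp h1
  have e2 := tensorSqOp_mul_tensorSq h2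
  calc rMat K α β * tensorSq Z
      = tensorSq Z * tensorSqOp W * rMat K α β * tensorSq Z := by rw [e1, one_mul]
    _ = tensorSq Z * (tensorSqOp W * rMat K α β) * tensorSq Z := by simp only [mul_assoc]
    _ = tensorSq Z * rMat K α β * (tensorSqOp W * tensorSq Z) := by
      rw [← h]; simp only [mul_assoc]
    _ = _ := by rw [e2, mul_one]

/-- The relations `R W₁ Z₁ = W₁ Z₁ R` in components. -/
theorem RRel.cross {α β : ι → ι → k} {Z W : Matrix ι ι K} (h : RRel α β Z) (h1 : Z * W = 1)
    (h2 : W * Z = 1) (x j l i : ι) :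
    β l j • (W x j * Z l i) + (if l = j then ∑ a, α a j • (W x a * Z a i) else 0) =
      (if x = i then ∑ b, α i b • (Z l b * W b j) else 0) + β i x • (Z l i * W x j) := by
  have e1 : ∀ a b, ∑ x, Z a x * W x b = (1 : Matrix ι ι K) a b := fun a b => by
    rw [← h1, Matrix.mul_apply]
  have e2 : ∀ a b, ∑ x, W a x * Z x b = (1 : Matrix ι ι K) a b := fun a b => by
    rw [← h2, Matrix.mul_apply]
  -- The relation is contracted with W on the left over an upper index and on the right over a lower
  -- index. In each of the four terms one pair Z, W then collapses.
  have key : ∑ u, ∑ s, W x u * (α u l • (Z u i * Z l s) + β l u • (Z l i * Z u s)) * W s j =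
      ∑ u, ∑ s, W x u * (α i s • (Z u i * Z l s) + β i s • (Z u s * Z l i)) * W s j :=
    Finset.sum_congr rfl fun u _ => Finset.sum_congr rfl fun s _ => by rw [h u l i s]
  have t1 : ∑ u, ∑ s, W x u * (α u l • (Z u i * Z l s)) * W s j =
      if l = j then ∑ a, α a j • (W x a * Z a i) else 0 := by
    have : ∀ u, ∑ s, W x u * (α u l • (Z u i * Z l s)) * W s j =
        α u l • (W x u * Z u i * (1 : Matrix ι ι K) l j) := by
      intro u
      rw [← e1, Finset.mul_sum, Finset.smul_sum]
      simp [mul_assoc]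
    simp_rw [this, Matrix.one_apply]
    split_ifs with hl <;> simp [hl]
  have t2 : ∑ u, ∑ s, W x u * (β l u • (Z l i * Z u s)) * W s j = β l j • (W x j * Z l i) := by
    have : ∀ u, ∑ s, W x u * (β l u • (Z l i * Z u s)) * W s j =
        β l u • (W x u * Z l i * (1 : Matrix ι ι K) u j) := by
      intro u
      rw [← e1, Finset.mul_sum, Finset.smul_sum]
      simp [mul_assoc]
    simp_rw [this, Matrix.one_apply]
    simp
  have t3 : ∑ u, ∑ s, W x u * (α i s • (Z u i * Z l s)) * W s j =
      if x = i then ∑ b, α i b • (Z l b * W b j) else 0 := by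
    rw [Finset.sum_comm]
    have : ∀ s, ∑ u, W x u * (α i s • (Z u i * Z l s)) * W s j =
        α i s • ((1 : Matrix ι ι K) x i * (Z l s * W s j)) := by
      intro s
      rw [← e2, Finset.sum_mul, Finset.smul_sum]
      simp [mul_assoc]
    simp_rw [this, Matrix.one_apply]
    split_ifs with hl <;> simp
  have t4 : ∑ u, ∑ s, W x u * (β i s • (Z u s * Z l i)) * W s j = β i x • (Z l i * W x j) := by
    rw [Finset.sum_comm]
    have : ∀ s, ∑ u, W x u * (β i s • (Z u s * Z l i)) * W s j =
        β i s • ((1 : Matrix ι ι K) x s * (Z l i * W s j)) := by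
      intro s
      rw [← e2, Finset.sum_mul, Finset.smul_sum]
      simp [mul_assoc]
    simp_rw [this, Matrix.one_apply]
    simp
  simp only [mul_add, add_mul, Finset.sum_add_distrib, t1, t2, t3, t4] at key
  rw [add_comm, key]

end Relations

/-! ### The square of the antipode -/

section Twisted

variable {k : Type*} [Field k] {ι : Type*} [Fintype ι] {K : Type*} [Ring K] [Algebra k K]

/-- The part of the Hecke symmetry that controls the square of the antipode. -/
structure TriangularData (q : k) (α β : ι → ι → k) : Prop where
  q_ne_zero : q ≠ 0
  beta_ne_zero : ∀ i j, β i j ≠ 0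
  diag : ∀ i, α i i + β i i = q ∨ α i i + β i i = -1
  order : ∃ o : LinearOrder ι, ∀ i j, (o.lt i j → α i j = q - 1) ∧ (o.lt j i → α i j = 0)

omit [Fintype ι] in
theorem TriangularData.transpose {q : k} {α β : ι → ι → k} (h : TriangularData q α β) :
    TriangularData q (fun i j => α j i) β where
  q_ne_zero := h.q_ne_zero
  beta_ne_zero := h.beta_ne_zero
  diag := h.diag
  order := by
    obtain ⟨o, ho⟩ := h.order
    exact ⟨@OrderDual.instLinearOrder ι o, fun i j =>
      ⟨fun h => (ho j i).1 h, fun h => (ho j i).2 h⟩⟩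

theorem sum_alpha_of_order [LinearOrder ι] {q : k} {α : ι → ι → k}
    (ho : ∀ i j, (i < j → α i j = q - 1) ∧ (j < i → α i j = 0))
    {M : Type*} [AddCommGroup M] [Module k M] (x : ι → M) (j : ι) :
    ∑ a, α a j • x a = α j j • x j + ∑ a with a < j, (q - 1) • x a := by
  classical
  rw [Finset.sum_filter, ← Finset.add_sum_erase _ _ (Finset.mem_univ j),
    ← Finset.add_sum_erase _ (fun a => if a < j then (q - 1) • x a else 0) (Finset.mem_univ j)]
  simp only [lt_irrefl, if_false, zero_add]
  congr 1
  refine Finset.sum_congr rfl fun a ha => ?_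
  rcases lt_trichotomy a j with h | h | h
  · rw [(ho a j).1 h, if_pos h]
  · simp [h] at ha
  · rw [(ho a j).2 h, if_neg h.not_gt, zero_smul]

/-- With γ_j = α_jj + β_jj the conditions form a triangular system γ_j χ_j = 1 - (q-1) ∑_{a<j} χ_a,
solved by a telescoping product. Its factors 1 - (q-1)/γ_a are q⁻¹ or q, so no weight vanishes. -/
theorem exists_weights_of_order [LinearOrder ι] {q : k} (hq : q ≠ 0) {α β : ι → ι → k}
    (hd : ∀ i, α i i + β i i = q ∨ α i i + β i i = -1)
    (ho : ∀ i j, (i < j → α i j = q - 1) ∧ (j < i → α i j = 0)) :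
    ∃ χ : ι → k, (∀ i, χ i ≠ 0) ∧ ∀ j, χ j * β j j + ∑ a, χ a * α a j = 1 := by
  set γ : ι → k := fun i => α i i + β i i with hγ
  have hγ0 : ∀ i, γ i ≠ 0 := by
    intro i
    rcases hd i with h | h <;> simp [hγ, h, hq]
  have hf : ∀ i, 1 - (q - 1) / γ i ≠ 0 := by
    intro i
    rcases hd i with h | h
    · rw [show γ i = q from h]; field_simp; simpa using hq
    · rw [show γ i = -1 from h]; field_simp; ring_nf; simpa using hq
  refine ⟨fun j => (∏ a with a < j, (1 - (q - 1) / γ a)) / γ j, fun j => ?_, fun j => ?_⟩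
  · exact div_ne_zero (Finset.prod_ne_zero_iff.2 fun a _ => hf a) (hγ0 j)
  · have h1 := sum_alpha_of_order ho (fun a => (∏ b with b < a, (1 - (q - 1) / γ b)) / γ a) j
    have h2 := Finset.prod_one_sub_ordered (Finset.univ.filter (· < j))
      (fun a => (q - 1) / γ a)
    have h3 : ∑ a with a < j, (q - 1) • ((∏ b with b < a, (1 - (q - 1) / γ b)) / γ a) =
        1 - ∏ a with a < j, (1 - (q - 1) / γ a) := by
      rw [h2, sub_sub_cancel]
      refine Finset.sum_congr rfl fun a ha => ?_
      have : Finset.filter (· < a) (Finset.univ.filter (· < j)) =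
          Finset.univ.filter (· < a) := by
        ext b
        simp only [Finset.mem_filter, Finset.mem_univ, true_and] at ha ⊢
        exact ⟨fun h => h.2, fun h => ⟨h.trans ha, h⟩⟩
      rw [this, smul_eq_mul]
      ring
    have h4 : ∑ a, (∏ b with b < a, (1 - (q - 1) / γ b)) / γ a * α a j =
        ∑ a, α a j • ((∏ b with b < a, (1 - (q - 1) / γ b)) / γ a) :=
      Finset.sum_congr rfl fun a _ => by rw [smul_eq_mul, mul_comm]
    rw [h4, h1, h3, smul_eq_mul]
    have := hγ0 j
    have h5 : β j j = γ j - α j j := by simp [hγ]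
    rw [h5]
    field_simp
    ring

/-- The system is triangular for the order, with diagonal entries q or -1. -/
theorem eq_zero_of_order [LinearOrder ι] {q : k} (hq : q ≠ 0) {α β : ι → ι → k}
    (hd : ∀ i, α i i + β i i = q ∨ α i i + β i i = -1)
    (ho : ∀ i j, (i < j → α i j = q - 1) ∧ (j < i → α i j = 0)) (e : ι → K)
    (he : ∀ j, β j j • e j + ∑ a, α a j • e a = 0) (j : ι) : e j = 0 := by
  induction j using WellFoundedLT.induction with
  | ind j ih =>
    have h := he j
    rw [sum_alpha_of_order ho, Finset.sum_eq_zero, add_zero, ← add_smul] at h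
    · refine (smul_eq_zero.1 h).resolve_left ?_
      rw [add_comm]
      rcases hd j with h | h <;> simp [h, hq]
    · intro a ha
      rw [ih a (Finset.mem_filter.1 ha).2, smul_zero]

/-- This is the diagonality of the square of the antipode. Weighting `RRel.cross` with χ and summing
over x = i makes the right-hand side collapse to ZW = 1, by the choice of χ. For X_jl = ∑_i χ_i W_ij
Z_li this leaves β_lj X_jl = 0 off the diagonal. On the diagonal it leaves a triangular system that
χ also solves, and the solution is unique. -/
theorem RRel.exists_twisted {q : k} {α β : ι → ι → k} (ht : TriangularData q α β)
    {Z W : Matrix ι ι K} [DecidableEq ι] (h : RRel α β Z) (h1 : Z * W = 1)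
    (h2 : W * Z = 1) :
    ∃ χ : ι → k, (∀ i, χ i ≠ 0) ∧
      ∀ j l, ∑ i, χ i • (W i j * Z l i) = if l = j then algebraMap k K (χ j) else 0 := by
  obtain ⟨o, ho⟩ := ht.order
  obtain ⟨χ, hχ0, hχ⟩ := @exists_weights_of_order k _ ι _ o q ht.q_ne_zero α β ht.diag ho
  refine ⟨χ, hχ0, ?_⟩
  have hX : ∀ j l, β l j • (∑ i, χ i • (W i j * Z l i)) +
      (if l = j then ∑ a, α a j • ∑ i, χ i • (W i a * Z a i) else 0) =
      if l = j then 1 else 0 := by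
    intro j l
    have hsum : ∑ i, χ i • (β l j • (W i j * Z l i) +
        (if l = j then ∑ a, α a j • (W i a * Z a i) else 0)) =
        ∑ i, χ i • ((∑ b, α i b • (Z l b * W b j)) + β i i • (Z l i * W i j)) :=
      Finset.sum_congr rfl fun i _ => by rw [h.cross h1 h2, if_pos rfl]
    have hR : ∑ i, χ i • ((∑ b, α i b • (Z l b * W b j)) + β i i • (Z l i * W i j)) =
        if l = j then 1 else 0 := by
      have : ∑ b, (χ b * β b b + ∑ i, χ i * α i b) • (Z l b * W b j) =
          if l = j then 1 else 0 := by
        simp_rw [hχ, one_smul]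
        rw [← Matrix.mul_apply, h1, Matrix.one_apply]
      rw [← this]
      simp_rw [add_smul, Finset.sum_smul, smul_add, Finset.smul_sum, smul_smul]
      rw [Finset.sum_add_distrib, Finset.sum_add_distrib, Finset.sum_comm, add_comm]
    rw [← hR, ← hsum]
    simp_rw [smul_add, Finset.sum_add_distrib, Finset.smul_sum]
    congr 1
    · exact Finset.sum_congr rfl fun i _ => smul_comm _ _ _
    · split_ifs with hl
      · rw [Finset.sum_comm]
        refine Finset.sum_congr rfl fun i _ => ?_
        rw [Finset.smul_sum]
        exact Finset.sum_congr rfl fun a _ => smul_comm _ _ _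
      · simp
  have hd : ∀ j, ∑ i, χ i • (W i j * Z j i) - algebraMap k K (χ j) = 0 := by
    refine @eq_zero_of_order k _ ι _ K _ _ o q ht.q_ne_zero α β ht.diag ho _ fun j => ?_
    have e1 := hX j j
    rw [if_pos rfl, if_pos rfl] at e1
    have e2 : β j j • algebraMap k K (χ j) + ∑ a, α a j • algebraMap k K (χ a) = 1 := by
      rw [← map_one (algebraMap k K), ← hχ j]
      simp [Algebra.smul_def, mul_comm, map_sum]
    simp_rw [smul_sub, Finset.sum_sub_distrib]
    rw [sub_add_sub_comm, e1, e2, sub_self]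
  intro j l
  split_ifs with hl
  · subst hl
    exact sub_eq_zero.1 (hd l)
  · have := hX j l
    rw [if_neg hl, if_neg hl, add_zero] at this
    exact (smul_eq_zero.1 this).resolve_left (ht.beta_ne_zero l j)

/-- The transpose of the inverse of `Z` is invertible, with inverse a rescaled transpose of `Z`. -/
theorem RRel.exists_transpose_inverse {q : k} {α β : ι → ι → k} (ht : TriangularData q α β)
    {Z W : Matrix ι ι K} [DecidableEq ι] (h : RRel α β Z) (h1 : Z * W = 1)
    (h2 : W * Z = 1) :
    ∃ χ : ι → k, (∀ i, χ i ≠ 0) ∧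
      W.transpose * (Matrix.of fun i l => (χ i * (χ l)⁻¹) • Z l i) = 1 ∧
      (Matrix.of fun i l => (χ i * (χ l)⁻¹) • Z l i) * W.transpose = 1 := by
  obtain ⟨χ, hχ0, hχ⟩ := h.exists_twisted ht h1 h2
  have t1 : Z.transpose.map (MulOpposite.op : K → Kᵐᵒᵖ) *
      W.transpose.map (MulOpposite.op : K → Kᵐᵒᵖ) = 1 := by
    ext i j
    have := congrArg MulOpposite.op (congrFun (congrFun h2 j) i)
    simpa [Matrix.mul_apply, Finset.op_sum, Matrix.one_apply, eq_comm,
      apply_ite MulOpposite.op] using this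
  have t2 : W.transpose.map (MulOpposite.op : K → Kᵐᵒᵖ) *
      Z.transpose.map (MulOpposite.op : K → Kᵐᵒᵖ) = 1 := by
    ext i j
    have := congrArg MulOpposite.op (congrFun (congrFun h1 j) i)
    simpa [Matrix.mul_apply, Finset.op_sum, Matrix.one_apply, eq_comm,
      apply_ite MulOpposite.op] using this
  -- The same argument for the transposes over the opposite ring gives a left inverse of Wᵀ. Its
  -- weights ψ may differ from χ, but a left and a right inverse coincide.
  obtain ⟨ψ, hψ0, hψ⟩ := h.op_transpose.exists_twisted ht.transpose t1 t2
  have r1 : W.transpose * (Matrix.of fun i l => (χ i * (χ l)⁻¹) • Z l i) = 1 := by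
    ext j l
    have := congrArg ((χ l)⁻¹ • ·) (hχ j l)
    simp only [Finset.smul_sum, smul_smul] at this
    simp only [Matrix.mul_apply, Matrix.transpose_apply, Matrix.of_apply, mul_smul_comm,
      Matrix.one_apply]
    simp_rw [mul_comm (χ _)]
    rw [this]
    by_cases hl : j = l
    · subst hl; simp [Algebra.smul_def, ← map_mul, hχ0]
    · simp [hl, Ne.symm hl]
  have r2 : (Matrix.of fun l i => (ψ i * (ψ l)⁻¹) • Z i l) * W.transpose = 1 := by
    ext l j
    have := congrArg (fun x => (ψ l)⁻¹ • MulOpposite.unop x) (hψ j l)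
    simp only [Finset.unop_sum, Finset.smul_sum, MulOpposite.unop_smul, smul_smul,
      MulOpposite.unop_mul, Matrix.map_apply, Matrix.transpose_apply, MulOpposite.unop_op] at this
    simp only [Matrix.mul_apply, Matrix.transpose_apply, Matrix.of_apply, smul_mul_assoc,
      Matrix.one_apply]
    simp_rw [mul_comm (ψ _)]
    rw [this]
    by_cases hl : l = j
    · subst hl
      simp [MulOpposite.algebraMap_apply, Algebra.smul_def, ← map_mul, hψ0]
    · simp [hl]
  refine ⟨χ, hχ0, r1, ?_⟩
  rw [← left_inv_eq_right_inv r2 r1]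
  exact r2

end Twisted

/-! ### Coactions -/

section Coaction

variable {k : Type*} [Field k] {ι : Type*}

/-- The relations `a_{ij} y_i y_j + b_{ij} y_j y_i = t y_i y_j` amount to
`y_i y_j = -e_{ij} y_j y_i`. -/
structure IsQType (a b : ι → ι → k) (t : k) (e : ι → ι → k) : Prop where
  off_diag : ∀ i j, i ≠ j → t - a i j ≠ 0 ∧ b i j = -(e i j) * (t - a i j)
  diag : ∀ i, (a i i + b i i = t ∧ e i i = -1) ∨ (a i i + b i i ≠ t ∧ e i i = 1)

/-- Off the diagonal one divides by t - a_ij. On the diagonal the relation is either empty or, since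
2 is invertible, says that the square of y_i is zero. -/
theorem IsQType.isQComm_iff [CharZero k] {a b : ι → ι → k} {t : k} {e : ι → ι → k}
    (h : IsQType a b t e) {B : Type*} [Ring B] [Algebra k B] (y : ι → B) :
    IsQComm e y ↔ ∀ i j, a i j • (y i * y j) + b i j • (y j * y i) = t • (y i * y j) := by
  refine forall_congr' fun i => forall_congr' fun j => ?_
  by_cases hij : i = j
  · subst hij
    rcases h.diag i with ⟨h1, h2⟩ | ⟨h1, h2⟩
    · simp [h2, ← add_smul, h1]
    · rw [h2, ← add_smul, ← sub_eq_zero (b := t • _), ← sub_smul, smul_eq_zero,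
        or_iff_right (sub_ne_zero.2 h1), neg_smul, one_smul, eq_neg_iff_add_eq_zero, ← two_smul k,
        smul_eq_zero, or_iff_right two_ne_zero]
  · obtain ⟨h1, h2⟩ := h.off_diag i j hij
    rw [h2, mul_comm, mul_smul, ← eq_sub_iff_add_eq', ← sub_smul]
    exact ⟨fun h => by rw [h], fun h => (smul_right_injective B h1 h).symm⟩

variable [Fintype ι] {K : Type*} [Ring K] [Algebra k K] {A : Type*} [Ring A] [Algebra k A]

/-- The relation for Y moves the coefficients of R from the lower indices of Y to the upper ones.
There they act on the x_u x_v, for which R has eigenvalue t. -/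
theorem IsQType.isQComm_coaction [CharZero k] {a b : ι → ι → k} {t : k} {e : ι → ι → k}
    (h : IsQType a b t e) {Y : Matrix ι ι K} (hY : RRel a b Y) {x : ι → A} (hx : IsQComm e x) :
    IsQComm e fun i => ∑ j, x j ⊗ₜ[k] Y j i := by
  rw [h.isQComm_iff] at hx ⊢
  intro i j
  have e1 : ∀ i j, (∑ u, x u ⊗ₜ[k] Y u i) * (∑ v, x v ⊗ₜ[k] Y v j) =
      ∑ u, ∑ v, (x u * x v) ⊗ₜ[k] (Y u i * Y v j) := by
    intro i j
    simp [Finset.sum_mul_sum]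
  have e2 : ∑ u, ∑ v, (x u * x v) ⊗ₜ[k] (b v u • (Y v i * Y u j)) =
      ∑ u, ∑ v, (b u v • (x v * x u)) ⊗ₜ[k] (Y u i * Y v j) := by
    rw [Finset.sum_comm]
    simp only [TensorProduct.tmul_smul, TensorProduct.smul_tmul']
  calc _ = ∑ u, ∑ v, (x u * x v) ⊗ₜ[k]
        (a i j • (Y u i * Y v j) + b i j • (Y u j * Y v i)) := by
        simp only [e1, Finset.smul_sum, TensorProduct.tmul_add, Finset.sum_add_distrib,
          TensorProduct.tmul_smul]
    _ = ∑ u, ∑ v, (x u * x v) ⊗ₜ[k] (a u v • (Y u i * Y v j) + b v u • (Y v i * Y u j)) := by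
        refine Finset.sum_congr rfl fun u _ => Finset.sum_congr rfl fun v _ => ?_
        rw [hY]
    _ = ∑ u, ∑ v, (a u v • (x u * x v) + b u v • (x v * x u)) ⊗ₜ[k] (Y u i * Y v j) := by
        simp only [TensorProduct.tmul_add, Finset.sum_add_distrib, e2, TensorProduct.add_tmul]
        simp only [TensorProduct.tmul_smul, TensorProduct.smul_tmul']
    _ = _ := by
        simp only [hx, e1, Finset.smul_sum, TensorProduct.smul_tmul']

/-- The coefficient `∏ Y (J s) (I s)` of the coaction on words. -/
def wordMat {N : ℕ} (Y : Matrix ι ι K) (J I : Fin N → ι) : K :=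
  (List.ofFn fun s => Y (J s) (I s)).prod

/-- The same product in the opposite order. -/
def wordRev {N : ℕ} (Y : Matrix ι ι K) (J I : Fin N → ι) : K :=
  (List.ofFn fun s => Y (J s) (I s)).reverse.prod

omit [Fintype ι] in
theorem wordMat_op {N : ℕ} (Y : Matrix ι ι K) (J I : Fin N → ι) :
    wordMat (Y.map (MulOpposite.op : K → Kᵐᵒᵖ)) J I = MulOpposite.op (wordRev Y J I) := by
  rw [wordRev, MulOpposite.op_list_prod, ← List.map_reverse, List.reverse_reverse, List.map_ofFn]
  rfl

theorem sum_fin_succ_fun {M : Type*} [AddCommMonoid M] {N : ℕ} (F : (Fin (N + 1) → ι) → M) :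
    ∑ J, F J = ∑ a, ∑ J, F (Fin.cons a J) := by
  rw [← (Fin.consEquiv fun _ => ι).sum_comp, Fintype.sum_prod_type]
  rfl

theorem prod_ofFn_coaction (x : ι → A) (Y : Matrix ι ι K) {N : ℕ} (I : Fin N → ι) :
    (List.ofFn fun s => ∑ j, x j ⊗ₜ[k] Y j (I s)).prod =
      ∑ J : Fin N → ι, (List.ofFn fun s => x (J s)).prod ⊗ₜ[k] wordMat Y J I := by
  induction N with
  | zero => simp [wordMat, Algebra.TensorProduct.one_def]
  | succ N ih =>
    rw [List.ofFn_succ, List.prod_cons, ih fun s => I s.succ, sum_fin_succ_fun,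
      Finset.sum_mul_sum]
    simp [wordMat, List.ofFn_succ]

-- Reversing the first product puts the factors for the first letter next to each other, so the
-- product collapses from the inside.
omit [Algebra k K] in
theorem sum_wordRev_mul_wordMat [DecidableEq ι] {Z W : Matrix ι ι K} (h : W * Z = 1) {N : ℕ}
    (B J : Fin N → ι) :
    ∑ A, wordRev W B A * wordMat Z A J = if B = J then 1 else 0 := by
  induction N with
  | zero => simp [wordMat, wordRev, Subsingleton.elim B J]
  | succ N ih =>
    have e : ∀ a b, ∑ x, W a x * Z x b = if a = b then 1 else 0 := fun a b => by
      rw [← Matrix.mul_apply, h, Matrix.one_apply]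
    rw [sum_fin_succ_fun, Finset.sum_comm]
    have : ∀ A : Fin N → ι, ∑ a, wordRev W B (Fin.cons a A) * wordMat Z (Fin.cons a A) J =
        if B 0 = J 0 then wordRev W (Fin.tail B) A * wordMat Z A (Fin.tail J) else 0 := by
      intro A
      have : ∀ a, wordRev W B (Fin.cons a A) * wordMat Z (Fin.cons a A) J =
          wordRev W (Fin.tail B) A * (W (B 0) a * Z a (J 0)) * wordMat Z A (Fin.tail J) := by
        intro a
        simp [wordRev, wordMat, List.ofFn_succ, Fin.tail, mul_assoc]
      simp_rw [this, ← Finset.sum_mul, ← Finset.mul_sum, e]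
      split_ifs <;> simp
    simp_rw [this]
    have hBJ : B = J ↔ B 0 = J 0 ∧ Fin.tail B = Fin.tail J := by
      constructor
      · rintro rfl; simp
      · rintro ⟨h1, h2⟩
        rw [← Fin.cons_self_tail B, ← Fin.cons_self_tail J, h1, h2]
    by_cases h0 : B 0 = J 0
    · simp [h0, ih, hBJ]
    · simp [h0, hBJ]

omit [Algebra k K] in
theorem sum_wordMat_mul_wordRev [DecidableEq ι] {Z W : Matrix ι ι K} (h : Z * W = 1) {N : ℕ}
    (B J : Fin N → ι) :
    ∑ A, wordMat Z B A * wordRev W A J = if B = J then 1 else 0 := by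
  induction N with
  | zero => simp [wordMat, wordRev, Subsingleton.elim B J]
  | succ N ih =>
    have e : ∀ a b, ∑ x, Z a x * W x b = if a = b then 1 else 0 := fun a b => by
      rw [← Matrix.mul_apply, h, Matrix.one_apply]
    rw [sum_fin_succ_fun]
    have : ∀ a, ∑ A : Fin N → ι, wordMat Z B (Fin.cons a A) * wordRev W (Fin.cons a A) J =
        if Fin.tail B = Fin.tail J then Z (B 0) a * W a (J 0) else 0 := by
      intro a
      have : ∀ A : Fin N → ι, wordMat Z B (Fin.cons a A) * wordRev W (Fin.cons a A) J =
          Z (B 0) a * (wordMat Z (Fin.tail B) A * wordRev W A (Fin.tail J)) * W a (J 0) := by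
        intro A
        simp [wordRev, wordMat, List.ofFn_succ, Fin.tail, mul_assoc]
      simp_rw [this, ← Finset.sum_mul, ← Finset.mul_sum, ih]
      split_ifs <;> simp
    simp_rw [this]
    have hBJ : B = J ↔ B 0 = J 0 ∧ Fin.tail B = Fin.tail J := by
      constructor
      · rintro rfl; simp
      · rintro ⟨h1, h2⟩
        rw [← Fin.cons_self_tail B, ← Fin.cons_self_tail J, h1, h2]
    by_cases h0 : Fin.tail B = Fin.tail J
    · simp [h0, e, hBJ]
    · simp [h0, hBJ]

/-- The expansion of the quantum determinant along an arbitrary sequence of columns. -/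
theorem IsQType.sum_topCoeff_wordMat [CharZero k] {n : ℕ} {a b : Fin n → Fin n → k} {t : k}
    {e : Fin n → Fin n → k} (h : IsQType a b t e) (he : ∀ i j, e i j * e j i = 1)
    (he1 : ∀ i, e i i = 1) {Y : Matrix (Fin n) (Fin n) K} (hY : RRel a b Y) (I : Fin n → Fin n) :
    ∑ J, topCoeff e J • wordMat Y J I = topCoeff e I • qDet e Y := by
  obtain ⟨φ, hφ⟩ := QAlg.exists_top he he1
  have hq := h.isQComm_coaction hY (QAlg.gen_isQComm e)
  -- The images of the generators satisfy the defining relations, so the product along `I` is a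
  -- multiple of the image of the top monomial. Comparing top coefficients gives the claim.
  have key := hq.list_prod_ofFn he1 I
  rw [prod_ofFn_coaction, prod_ofFn_coaction (I := fun s => s)] at key
  have := congrArg ((TensorProduct.lid k K).toLinearMap ∘ₗ φ.rTensor K) key
  simp only [LinearMap.coe_comp, LinearEquiv.coe_coe, Function.comp_apply, map_sum, map_smul,
    LinearMap.rTensor_tmul, hφ, TensorProduct.lid_tmul] at this
  rw [this, qDet_eq_sum_topCoeff]
  rfl

end Coaction

/-! ### The coaction on the Koszul complex -/

section Extension

variable {k V K : Type*} [Field k] [AddCommGroup V] [Module k V] [Ring K] [Algebra k K]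

/-- The `K`-linear extension of a map `V → V ⊗ K`. -/
def extendRight (f : V →ₗ[k] V ⊗[k] K) : V ⊗[k] K →ₗ[k] V ⊗[k] K :=
  (LinearMap.mul' k K).lTensor V ∘ₗ (TensorProduct.assoc k V K K).toLinearMap ∘ₗ f.rTensor K

/-- Right multiplication by an element of `K`. -/
def mulR (V : Type*) [AddCommGroup V] [Module k V] (a : K) : V ⊗[k] K →ₗ[k] V ⊗[k] K :=
  (LinearMap.mulRight k a).lTensor V

theorem extendRight_tmul (f : V →ₗ[k] V ⊗[k] K) (v : V) (a : K) :
    extendRight f (v ⊗ₜ a) = mulR V a (f v) := by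
  simp only [extendRight, LinearMap.comp_apply, LinearMap.rTensor_tmul, LinearEquiv.coe_coe, mulR]
  induction f v using TensorProduct.induction_on with
  | zero => simp
  | tmul x y => simp
  | add x y hx hy => simp only [TensorProduct.add_tmul, map_add, hx, hy]

theorem rTensor_mulR (D : Module.End k V) (a : K) (x : V ⊗[k] K) :
    D.rTensor K (mulR V a x) = mulR V a (D.rTensor K x) := by
  induction x using TensorProduct.induction_on with
  | zero => simp
  | tmul x y => simp [mulR]
  | add x y hx hy => simp only [map_add, hx, hy]

theorem rTensor_extendRight {D : Module.End k V} {f : V →ₗ[k] V ⊗[k] K}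
    (h : ∀ v, D.rTensor K (f v) = f (D v)) (x : V ⊗[k] K) :
    D.rTensor K (extendRight f x) = extendRight f (D.rTensor K x) := by
  induction x using TensorProduct.induction_on with
  | zero => simp
  | tmul v a => rw [extendRight_tmul, rTensor_mulR, h, LinearMap.rTensor_tmul, extendRight_tmul]
  | add x y hx hy => simp only [map_add, hx, hy]

theorem extendRight_mem_range {D : Module.End k V} {f : V →ₗ[k] V ⊗[k] K}
    (h : ∀ v, D.rTensor K (f v) = f (D v)) {x : V ⊗[k] K}
    (hx : x ∈ LinearMap.range (D.rTensor K)) :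
    extendRight f x ∈ LinearMap.range (D.rTensor K) := by
  obtain ⟨g, rfl⟩ := hx
  exact ⟨extendRight f g, rTensor_extendRight h g⟩

/-- The coefficients by which two mutually inverse endomorphisms act on the class of `w`
multiply to one. -/
theorem mul_eq_one_of_extendRight {D : Module.End k V} {f g : V →ₗ[k] V ⊗[k] K}
    (hg : ∀ v, D.rTensor K (g v) = g (D v)) {w : V} {b b' : K}
    (hb : f w - w ⊗ₜ b ∈ LinearMap.range (D.rTensor K))
    (hb' : g w - w ⊗ₜ b' ∈ LinearMap.range (D.rTensor K))
    (hgf : extendRight g (f w) = w ⊗ₜ 1) {φ : V →ₗ[k] k} (hφ : φ ∘ₗ D = 0) (hφw : φ w = 1) :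
    b' * b = 1 := by
  have h1 := extendRight_mem_range hg hb
  rw [map_sub, hgf, extendRight_tmul] at h1
  have h2 : mulR V b (g w - w ⊗ₜ b') ∈ LinearMap.range (D.rTensor K) := by
    obtain ⟨x, hx⟩ := hb'
    exact ⟨mulR V b x, by rw [rTensor_mulR, hx]⟩
  have h3 := add_mem h1 h2
  have h4 : mulR V b (w ⊗ₜ[k] b') = w ⊗ₜ (b' * b) := by simp [mulR]
  rw [map_sub, sub_add_sub_cancel, h4] at h3
  obtain ⟨x, hx⟩ := h3
  have h5 := congrArg ((TensorProduct.lid k K).toLinearMap ∘ₗ φ.rTensor K) hx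
  rw [LinearMap.comp_apply, ← LinearMap.comp_apply (φ.rTensor K), ← LinearMap.rTensor_comp, hφ] at h5
  simp only [LinearMap.rTensor_zero, LinearMap.zero_apply, map_zero, LinearMap.comp_apply, map_sub,
    LinearMap.rTensor_tmul, hφw, LinearEquiv.coe_coe, TensorProduct.lid_tmul, one_smul] at h5
  exact (sub_eq_zero.1 h5.symm).symm

end Extension

section Coaction

variable {k : Type*} [Field k] {ι : Type*} [Fintype ι] {c : ι → ι → k}
  {K : Type*} [Ring K] [Algebra k K]

/-- The algebra map `Λ ⊗ K → (Λ ⊗ S) ⊗ K`. -/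
def inclLeft (c : ι → ι → k) (K : Type*) [Ring K] [Algebra k K] :
    QAlg c ⊗[k] K →ₐ[k] (QAlg c ⊗[k] QAlg (-c)) ⊗[k] K :=
  Algebra.TensorProduct.map Algebra.TensorProduct.includeLeft (AlgHom.id k K)

/-- The algebra map `S ⊗ K → (Λ ⊗ S) ⊗ K`. -/
def inclRight (c : ι → ι → k) (K : Type*) [Ring K] [Algebra k K] :
    QAlg (-c) ⊗[k] K →ₐ[k] (QAlg c ⊗[k] QAlg (-c)) ⊗[k] K :=
  Algebra.TensorProduct.map Algebra.TensorProduct.includeRight (AlgHom.id k K)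

variable {Z Y : Matrix ι ι K}

/-- The coaction on `Λ ⊗ S` with matrix `Z` on the generators of `Λ` and `Y` on those of `S`. -/
def qCoact (hZ : IsQComm c fun i => ∑ j, QAlg.gen c j ⊗ₜ[k] Z j i)
    (hY : IsQComm (-c) fun i => ∑ j, QAlg.gen (-c) j ⊗ₜ[k] Y j i) :
    QAlg c ⊗[k] QAlg (-c) →ₗ[k] (QAlg c ⊗[k] QAlg (-c)) ⊗[k] K :=
  TensorProduct.lift ((LinearMap.mul k _).compl₁₂
    ((inclLeft c K).comp (QAlg.lift c _ hZ)).toLinearMap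
    ((inclRight c K).comp (QAlg.lift (-c) _ hY)).toLinearMap)

variable (hZ : IsQComm c fun i => ∑ j, QAlg.gen c j ⊗ₜ[k] Z j i)
    (hY : IsQComm (-c) fun i => ∑ j, QAlg.gen (-c) j ⊗ₜ[k] Y j i)

theorem qCoact_tmul (u : QAlg c) (w : QAlg (-c)) :
    qCoact hZ hY (u ⊗ₜ w) = inclLeft c K (QAlg.lift c _ hZ u) *
      inclRight c K (QAlg.lift (-c) _ hY w) := by
  simp [qCoact]

/-- The differential inserts ∑ x_j ⊗ ξ^j between the two factors; this reduces its equivariance to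
the invariance of that single element. -/
theorem rTensor_inclLeft_mul_inclRight (F : QAlg c ⊗[k] K) (G : QAlg (-c) ⊗[k] K) :
    (qKoszulD c).rTensor K (inclLeft c K F * inclRight c K G) =
      inclLeft c K F * (∑ j, (QAlg.gen c j ⊗ₜ QAlg.gen (-c) j) ⊗ₜ 1) * inclRight c K G := by
  induction F using TensorProduct.induction_on with
  | zero => simp
  | add x y hx hy => simp only [map_add, add_mul, hx, hy]
  | tmul u a =>
    induction G using TensorProduct.induction_on with
    | zero => simp
    | add x y hx hy => simp only [map_add, mul_add, hx, hy]
    | tmul w b =>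
      simp [inclLeft, inclRight, qKoszulD_tmul, TensorProduct.sum_tmul, Finset.mul_sum,
        Finset.sum_mul]

/-- The inserted element ∑ x_j ⊗ ξ^j is invariant exactly because the matrices on Λ and S^∨ satisfy
Z Yᵀ = 1. -/
theorem rTensor_qCoact [DecidableEq ι] (h : Z * Y.transpose = 1) (v : QAlg c ⊗[k] QAlg (-c)) :
    (qKoszulD c).rTensor K (qCoact hZ hY v) = qCoact hZ hY (qKoszulD c v) := by
  induction v using TensorProduct.induction_on with
  | zero => simp
  | add x y hx hy => simp only [map_add, hx, hy]
  | tmul u w =>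
    rw [qCoact_tmul, rTensor_inclLeft_mul_inclRight, qKoszulD_tmul, map_sum]
    simp_rw [qCoact_tmul, map_mul, QAlg.lift_gen, mul_assoc]
    rw [← Finset.mul_sum]
    simp_rw [← mul_assoc (inclLeft c K (∑ j, _)), ← Finset.sum_mul]
    congr 2
    have h1 : ∀ j l, ∑ i, Z j i * Y l i = if j = l then 1 else 0 := fun j l => by
      rw [← Matrix.one_apply, ← h, Matrix.mul_apply]; rfl
    have h2 : ∀ i, inclLeft c K (∑ j, QAlg.gen c j ⊗ₜ[k] Z j i) *
        inclRight c K (∑ j, QAlg.gen (-c) j ⊗ₜ[k] Y j i) =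
        ∑ j, ∑ l, (QAlg.gen c j ⊗ₜ QAlg.gen (-c) l) ⊗ₜ (Z j i * Y l i) := by
      intro i
      simp [inclLeft, inclRight, Finset.sum_mul_sum]
    simp_rw [h2]
    rw [Finset.sum_comm]
    refine Finset.sum_congr rfl fun j _ => ?_
    rw [Finset.sum_comm]
    simp_rw [← TensorProduct.tmul_sum, h1]
    simp [TensorProduct.tmul_ite]

/-- A monomial in `Λ ⊗ S`. -/
def qMon (c : ι → ι → k) {M N : ℕ} (I : Fin M → ι) (I' : Fin N → ι) :
    QAlg c ⊗[k] QAlg (-c) :=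
  (List.ofFn fun s => QAlg.gen c (I s)).prod ⊗ₜ (List.ofFn fun s => QAlg.gen (-c) (I' s)).prod

theorem qCoact_qMon {M N : ℕ} (I : Fin M → ι) (I' : Fin N → ι) :
    qCoact hZ hY (qMon c I I') =
      ∑ J : Fin M → ι, ∑ J' : Fin N → ι, qMon c J J' ⊗ₜ (wordMat Z J I * wordMat Y J' I') := by
  rw [qMon, qCoact_tmul]
  have h1 : QAlg.lift c _ hZ (List.ofFn fun s => QAlg.gen c (I s)).prod =
      ∑ J : Fin M → ι, (List.ofFn fun s => QAlg.gen c (J s)).prod ⊗ₜ[k] wordMat Z J I := by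
    rw [← prod_ofFn_coaction, map_list_prod, List.map_ofFn]
    congr 2
    funext s
    simp
  have h2 : QAlg.lift (-c) _ hY (List.ofFn fun s => QAlg.gen (-c) (I' s)).prod =
      ∑ J : Fin N → ι, (List.ofFn fun s => QAlg.gen (-c) (J s)).prod ⊗ₜ[k] wordMat Y J I' := by
    rw [← prod_ofFn_coaction, map_list_prod, List.map_ofFn]
    congr 2
    funext s
    simp
  rw [h1, h2]
  simp [inclLeft, inclRight, Finset.sum_mul_sum, qMon]

end Coaction

/-! ### Coactions over the opposite ring -/

section OpCoaction

variable {k : Type*} [Field k] {ι : Type*} [Fintype ι] {c : ι → ι → k}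
  {K : Type*} [Ring K] [Algebra k K]

/-- `V ⊗ Kᵐᵒᵖ → V ⊗ K`. -/
def unopTensor (V K : Type*) [AddCommGroup V] [Module k V] [Ring K] [Algebra k K] :
    V ⊗[k] Kᵐᵒᵖ →ₗ[k] V ⊗[k] K :=
  (MulOpposite.opLinearEquiv k (M := K)).symm.toLinearMap.lTensor V

theorem rTensor_unopTensor {V : Type*} [AddCommGroup V] [Module k V] (D : Module.End k V)
    (x : V ⊗[k] Kᵐᵒᵖ) : D.rTensor K (unopTensor V K x) = unopTensor V K (D.rTensor Kᵐᵒᵖ x) := by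
  rw [unopTensor, ← LinearMap.comp_apply, ← LinearMap.comp_apply, LinearMap.rTensor_comp_lTensor,
    LinearMap.lTensor_comp_rTensor]

end OpCoaction

/-! ### The class of ω under a coaction and its inverse -/

section Berezinian

variable {k : Type*} [Field k] [CharZero k] {ι : Type*} [Fintype ι] [LinearOrder ι]
  {c : ι → ι → k} {K : Type*} [Ring K] [Algebra k K] {m n : ℕ} {e : Fin m → ι} {o : Fin n → ι}

omit [Fintype ι] [CharZero k] [LinearOrder ι] in
theorem qMon_eq {M N : ℕ} (I : Fin M → ι) (I' : Fin N → ι) :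
    qMon c I I' = ((List.ofFn I).map (QAlg.gen c)).prod ⊗ₜ[k]
      ((List.ofFn I').map (QAlg.gen (-c))).prod := by
  rw [qMon, List.map_ofFn, List.map_ofFn]
  rfl

/-- Every term of Dω repeats a square-zero letter: x_i on the left if c_ii = 1, ξ^i on the right if
c_ii = -1. -/
theorem qKoszulD_qMon (hcc : ∀ i, c i i = 1 ∨ c i i = -1)
    (he : ∀ i, i ∈ Set.range e ↔ c i i = 1) (ho : ∀ i, i ∈ Set.range o ↔ c i i = -1) :
    qKoszulD c (qMon c e o) = 0 := by
  rw [qMon_eq, qKoszulD_tmul]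
  refine Finset.sum_eq_zero fun i _ => ?_
  rcases hcc i with hi | hi
  · have h : ((List.ofFn e).map (QAlg.gen c)).prod * QAlg.gen c i =
        ((List.ofFn e ++ [i]).map (QAlg.gen c)).prod := by simp
    have h1 : 0 < (List.ofFn e).count i :=
      List.count_pos_iff.2 (List.mem_ofFn.2 ((he i).2 hi))
    rw [h, (QAlg.gen_isQComm c).list_prod_eq_zero hi, TensorProduct.zero_tmul]
    rw [List.count_append, List.count_singleton_self]
    omega
  · have h : QAlg.gen (-c) i * ((List.ofFn o).map (QAlg.gen (-c))).prod =
        ((i :: List.ofFn o).map (QAlg.gen (-c))).prod := by simp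
    have h1 : 0 < (List.ofFn o).count i :=
      List.count_pos_iff.2 (List.mem_ofFn.2 ((ho i).2 hi))
    rw [h, (QAlg.gen_isQComm (-c)).list_prod_eq_zero (a := i) (by simp [hi]),
      TensorProduct.tmul_zero]
    rw [List.count_cons_self]
    omega

theorem exists_class (hc : ∀ i j, c i j * c j i = 1) (hcc : ∀ i, c i i = 1 ∨ c i i = -1)
    (hem : StrictMono e) (hom : StrictMono o)
    (he : ∀ i, i ∈ Set.range e ↔ c i i = 1) (ho : ∀ i, i ∈ Set.range o ↔ c i i = -1)
    {M N : ℕ} (a : (Fin M → ι) → (Fin N → ι) → K)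
    (hv : (qKoszulD c).rTensor K (∑ J, ∑ J', qMon c J J' ⊗ₜ[k] a J J') = 0) :
    ∃ b : K, (∑ J, ∑ J', qMon c J J' ⊗ₜ[k] a J J') - qMon c e o ⊗ₜ[k] b ∈
      LinearMap.range ((qKoszulD c).rTensor K) := by
  simp_rw [qMon_eq, ← Fintype.sum_prod_type'] at hv ⊢
  exact exists_sub_mem_range_qKoszulD hc hcc (List.pairwise_ofFn.2 fun _ _ h => hem h)
    (List.pairwise_ofFn.2 fun _ _ h => hom h) (fun i => by rw [List.mem_ofFn, ← he]; rfl)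
    (fun i => by rw [List.mem_ofFn, ← ho]; rfl) Finset.univ
    (fun p : (Fin M → ι) × (Fin N → ι) => List.ofFn p.1) (fun p => List.ofFn p.2)
    (fun p => a p.1 p.2) hv

omit [CharZero k] [Fintype ι] [LinearOrder ι] in
theorem wordRev_rescale (χ : ι → k) (Z : Matrix ι ι K) {N : ℕ} (J I : Fin N → ι) :
    wordRev (Matrix.of fun i l => (χ i * (χ l)⁻¹) • Z l i) J I =
      (∏ s, χ (J s) * (χ (I s))⁻¹) • wordRev Z.transpose J I := by
  induction N with
  | zero => simp [wordRev]
  | succ N ih =>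
    have := ih (fun s => J s.succ) fun s => I s.succ
    simp only [wordRev, Matrix.of_apply, Matrix.transpose_apply] at this
    simp only [wordRev, List.ofFn_succ, List.reverse_cons, List.prod_append,
      Fin.prod_univ_succ, List.prod_singleton, Matrix.of_apply, Matrix.transpose_apply]
    rw [this, smul_mul_smul_comm, mul_comm]

/-- The functional that reads off the coefficient of `ω`. -/
theorem exists_functional (K : Type*) [Ring K] [Algebra k K]
    (hc : ∀ i j, c i j * c j i = 1) (hcc : ∀ i, c i i = 1 ∨ c i i = -1)
    (hem : StrictMono e) (hom : StrictMono o)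
    (he : ∀ i, i ∈ Set.range e ↔ c i i = 1) (ho : ∀ i, i ∈ Set.range o ↔ c i i = -1) :
    ∃ f : QAlg c ⊗[k] QAlg (-c) →ₗ[k] k, f ∘ₗ qKoszulD c = 0 ∧ f (qMon c e o) = 1 ∧
      ∀ (F : (Fin m → ι) → K) (G : (Fin n → ι) → K),
        ∑ J, ∑ J', f (qMon c J J') • (G J' * F J) =
          (∑ J', topCoeff (fun i j => -c (o i) (o j)) J' • G (fun s => o (J' s))) *
            ∑ J, topCoeff (fun i j => c (e i) (e j)) J • F (fun s => e (J s)) := by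
  obtain ⟨φ, hφ1, hφ2⟩ := QAlg.exists_coeff hc e hem.injective fun i => (he _).1 ⟨i, rfl⟩
  obtain ⟨ψ, hψ1, hψ2⟩ := QAlg.exists_coeff (neg_mul_neg_swap hc) o hom.injective
    fun i => by simp [(ho _).1 ⟨i, rfl⟩]
  have hne : (1 : k) ≠ -1 := by
    intro h
    have h2 : (2 : k) = 0 := by rw [← one_add_one_eq_two]; nth_rewrite 1 [h]; simp
    exact two_ne_zero h2
  refine ⟨LinearMap.mul' k k ∘ₗ TensorProduct.map φ ψ, ?_, ?_, ?_⟩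
  · refine TensorProduct.ext' fun u w => ?_
    simp only [LinearMap.comp_apply, qKoszulD_tmul, map_sum, TensorProduct.map_tmul,
      LinearMap.mul'_apply, LinearMap.zero_apply]
    -- If c_ii = 1, the letter ξ^i does not occur in ω and is killed by ψ. If c_ii = -1, the letter
    -- x_i does not occur in ω and is killed by φ.
    refine Finset.sum_eq_zero fun i _ => ?_
    rcases hcc i with hi | hi
    · have := hψ2 i (fun h => hne (hi.symm.trans ((ho i).1 h))) 1 w
      rw [one_mul] at this
      rw [this, mul_zero]
    · have := hφ2 i (fun h => hne (((he i).1 h).symm.trans hi)) u 1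
      rw [mul_one] at this
      rw [this, zero_mul]
  · have h1 := hφ1 id
    have h2 := hψ1 id
    have ht : ∀ {r : ℕ} (d : Fin r → Fin r → k), topCoeff d id = 1 := by
      intro r d
      rw [topCoeff, if_pos Function.bijective_id]
      refine Finset.prod_eq_one fun i _ => Finset.prod_eq_one fun j _ => if_neg ?_
      exact fun h => (h.1.trans h.2).false
    simp only [ht, id] at h1 h2
    rw [LinearMap.comp_apply, qMon, TensorProduct.map_tmul, LinearMap.mul'_apply, h1, h2, mul_one]
  · intro F G
    have h1 := QAlg.sum_coeff hem.injective hφ1 hφ2 F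
    have h2 := QAlg.sum_coeff hom.injective hψ1 hψ2 G
    rw [← h1]
    simp only [Pi.neg_apply] at h2
    rw [← h2, Finset.sum_mul_sum, Finset.sum_comm]
    simp [qMon, mul_smul, smul_comm (φ _)]

/-- The coaction with matrices (Z, Wᵀ) is undone by the one over the opposite ring with matrices (W,
Y'), where Y' is the rescaled transpose of Z inverse to Wᵀ. Both commute with D and therefore act on
the class of ω by elements b and b', which are mutually inverse. The formula for b' is what the
functional reads off from the second coaction. -/
theorem exists_berezinian {q : k} {α β : ι → ι → k} (hc : ∀ i j, c i j * c j i = 1)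
    (hcc : ∀ i, c i i = 1 ∨ c i i = -1)
    (hα : IsQType α β (-1) c) (hα' : IsQType (fun i j => α j i) β q (-c))
    (ht : TriangularData q α β) (hem : StrictMono e) (hom : StrictMono o)
    (he : ∀ i, i ∈ Set.range e ↔ c i i = 1) (ho : ∀ i, i ∈ Set.range o ↔ c i i = -1)
    {Z W : Matrix ι ι K} (hZ : RRel α β Z) (hZW : Z * W = 1) (hWZ : W * Z = 1) :
    ∃ b b' : K, b * b' = 1 ∧ b' * b = 1 ∧
      (∑ J, ∑ J', qMon c J J' ⊗ₜ[k] (wordMat Z J e * wordMat W.transpose J' o)) -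
        qMon c e o ⊗ₜ[k] b ∈ LinearMap.range ((qKoszulD c).rTensor K) ∧
      b' = (∑ J' : Fin n → Fin n, topCoeff (fun i j => -c (o i) (o j)) J' •
          wordRev Z.transpose (fun s => o (J' s)) o) *
        ∑ J : Fin m → Fin m, topCoeff (fun i j => c (e i) (e j)) J •
          wordRev W (fun s => e (J s)) e := by
  obtain ⟨χ, hχ0, hY1, hY2⟩ := hZ.exists_transpose_inverse ht hZW hWZ
  set Y' : Matrix ι ι K := Matrix.of fun i l => (χ i * (χ l)⁻¹) • Z l i with hY'
  have hW := hZ.inv hZW hWZ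
  -- the coaction
  have q1 := hα.isQComm_coaction hZ (QAlg.gen_isQComm c)
  have q2 := hα'.isQComm_coaction hW.transpose (QAlg.gen_isQComm (-c))
  set f := qCoact q1 q2 with hf
  have hfD : ∀ v, (qKoszulD c).rTensor K (f v) = f (qKoszulD c v) :=
    rTensor_qCoact q1 q2 (by rw [Matrix.transpose_transpose, hZW])
  -- the inverse coaction
  have hQ : RRel (fun i j => α j i) β (Y'.map (MulOpposite.op : K → Kᵐᵒᵖ)) := by
    intro u v i j
    -- All monomials in one relation have the same row and column indices up to order, so the
    -- rescaling multiplies the relation by one common factor.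
    have h1 := congrArg ((χ u * χ v * (χ i)⁻¹ * (χ j)⁻¹) • ·)
      (hZ.op_transpose u v i j)
    simp only [smul_add, smul_comm (χ u * χ v * (χ i)⁻¹ * (χ j)⁻¹)] at h1
    simp only [Matrix.map_apply, Matrix.transpose_apply, hY', Matrix.of_apply,
      MulOpposite.op_smul, smul_mul_smul_comm] at h1 ⊢
    convert h1 using 3 <;> congr 1 <;> ring
  have q3 := hα.isQComm_coaction hW.op (QAlg.gen_isQComm c)
  have q4 := hα'.isQComm_coaction hQ (QAlg.gen_isQComm (-c))
  set g := unopTensor (QAlg c ⊗[k] QAlg (-c)) K ∘ₗ qCoact q3 q4 with hg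
  have hgD : ∀ v, (qKoszulD c).rTensor K (g v) = g (qKoszulD c v) := by
    intro v
    rw [hg, LinearMap.comp_apply, rTensor_unopTensor, rTensor_qCoact]
    · rfl
    · ext i j
      have := congrArg MulOpposite.op (congrFun (congrFun hY2 j) i)
      simpa [Matrix.mul_apply, Finset.op_sum, Matrix.one_apply, eq_comm,
        apply_ite MulOpposite.op] using this
  have hfm : ∀ (I : Fin m → ι) (I' : Fin n → ι), f (qMon c I I') =
      ∑ J : Fin m → ι, ∑ J' : Fin n → ι,
        qMon c J J' ⊗ₜ (wordMat Z J I * wordMat W.transpose J' I') :=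
    fun I I' => qCoact_qMon q1 q2 I I'
  have hgm : ∀ (I : Fin m → ι) (I' : Fin n → ι), g (qMon c I I') =
      ∑ J : Fin m → ι, ∑ J' : Fin n → ι,
        qMon c J J' ⊗ₜ (wordRev Y' J' I' * wordRev W J I) := by
    intro I I'
    rw [hg, LinearMap.comp_apply, qCoact_qMon]
    simp [unopTensor, wordMat_op, ← MulOpposite.op_mul]
  -- Summation over the words J on Λ contracts W with Z in the middle; then the words J' on S^∨
  -- contract Y' with Wᵀ.
  have hgf : extendRight g (f (qMon c e o)) = qMon c e o ⊗ₜ 1 := by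
    have : ∀ (J : Fin m → ι) (J' : Fin n → ι),
        extendRight g (qMon c J J' ⊗ₜ (wordMat Z J e * wordMat W.transpose J' o)) =
        ∑ B : Fin m → ι, ∑ B' : Fin n → ι, qMon c B B' ⊗ₜ (wordRev Y' B' J' *
          (wordRev W B J * wordMat Z J e) * wordMat W.transpose J' o) := by
      intro J J'
      rw [extendRight_tmul, hgm]
      simp [mulR, mul_assoc]
    rw [hfm]
    simp_rw [map_sum, this]
    simp_rw [fun J : Fin m → ι => Finset.sum_comm (s := Finset.univ (α := Fin n → ι))
      (t := Finset.univ (α := Fin m → ι)) (f := fun J' B => ∑ B' : Fin n → ι,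
        qMon c B B' ⊗ₜ[k] (wordRev Y' B' J' *
          (wordRev W B J * wordMat Z J e) * wordMat W.transpose J' o))]
    rw [Finset.sum_comm]
    have h2 : ∀ B : Fin m → ι, ∑ J : Fin m → ι, ∑ J' : Fin n → ι, ∑ B' : Fin n → ι,
        qMon c B B' ⊗ₜ[k] (wordRev Y' B' J' *
          (wordRev W B J * wordMat Z J e) * wordMat W.transpose J' o) =
        if B = e then qMon c e o ⊗ₜ 1 else 0 := by
      intro B
      have h3 : ∀ B' : Fin n → ι, ∑ J' : Fin n → ι, ∑ J : Fin m → ι,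
          qMon c B B' ⊗ₜ[k] (wordRev Y' B' J' *
          (wordRev W B J * wordMat Z J e) * wordMat W.transpose J' o) =
          if B = e then if B' = o then qMon c B B' ⊗ₜ 1 else 0 else 0 := by
        intro B'
        simp_rw [← TensorProduct.tmul_sum, ← Finset.sum_mul, ← Finset.mul_sum,
          sum_wordRev_mul_wordMat hWZ]
        split_ifs with h4 h5
        · simp [sum_wordRev_mul_wordMat hY2, h5]
        · simp [sum_wordRev_mul_wordMat hY2, h5]
        · simp
      rw [Finset.sum_comm]
      simp_rw [fun J' : Fin n → ι => Finset.sum_comm (s := Finset.univ (α := Fin m → ι))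
        (t := Finset.univ (α := Fin n → ι)) (f := fun J B' =>
        qMon c B B' ⊗ₜ[k] (wordRev Y' B' J' *
          (wordRev W B J * wordMat Z J e) * wordMat W.transpose J' o))]
      rw [Finset.sum_comm]
      simp_rw [h3]
      split_ifs with h4
      · simp [h4]
      · simp
    simp_rw [h2]
    simp
  have hfg : extendRight f (g (qMon c e o)) = qMon c e o ⊗ₜ 1 := by
    have : ∀ (J : Fin m → ι) (J' : Fin n → ι),
        extendRight f (qMon c J J' ⊗ₜ (wordRev Y' J' o * wordRev W J e)) =
        ∑ B : Fin m → ι, ∑ B' : Fin n → ι, qMon c B B' ⊗ₜ (wordMat Z B J *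
          (wordMat W.transpose B' J' * wordRev Y' J' o) * wordRev W J e) := by
      intro J J'
      rw [extendRight_tmul, hfm]
      simp [mulR, mul_assoc]
    rw [hgm]
    simp_rw [map_sum, this]
    have h2 : ∀ J : Fin m → ι, ∑ J' : Fin n → ι, ∑ B : Fin m → ι, ∑ B' : Fin n → ι,
        qMon c B B' ⊗ₜ[k] (wordMat Z B J *
          (wordMat W.transpose B' J' * wordRev Y' J' o) * wordRev W J e) =
        ∑ B : Fin m → ι, qMon c B o ⊗ₜ[k] (wordMat Z B J * wordRev W J e) := by
      intro J
      rw [Finset.sum_comm]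
      refine Finset.sum_congr rfl fun B _ => ?_
      rw [Finset.sum_comm]
      simp_rw [← TensorProduct.tmul_sum, ← Finset.sum_mul, ← Finset.mul_sum,
        sum_wordMat_mul_wordRev hY1]
      simp [TensorProduct.tmul_ite]
    simp_rw [h2]
    rw [Finset.sum_comm]
    simp_rw [← TensorProduct.tmul_sum, sum_wordMat_mul_wordRev hZW]
    simp [TensorProduct.tmul_ite]
  have hD0 := qKoszulD_qMon hcc he ho
  have hb := exists_class (K := K) hc hcc hem hom he ho
    (fun J J' => wordMat Z J e * wordMat W.transpose J' o) (by rw [← hfm, hfD, hD0, map_zero])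
  have hb' := exists_class (K := K) hc hcc hem hom he ho
    (fun J J' => wordRev Y' J' o * wordRev W J e) (by rw [← hgm, hgD, hD0, map_zero])
  obtain ⟨b, hb⟩ := hb
  obtain ⟨b', hb'⟩ := hb'
  obtain ⟨F, hF1, hF2, hF3⟩ := exists_functional K hc hcc hem hom he ho
  refine ⟨b, b', ?_, ?_, hb, ?_⟩
  · rw [← hgm] at hb'
    rw [← hfm] at hb
    exact mul_eq_one_of_extendRight hfD hb' hb hfg hF1 hF2
  · rw [← hgm] at hb'
    rw [← hfm] at hb
    exact mul_eq_one_of_extendRight hgD hb hb' hgf hF1 hF2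
  · obtain ⟨x, hx⟩ := hb'
    have h5 := congrArg ((TensorProduct.lid k K).toLinearMap ∘ₗ F.rTensor K) hx
    rw [LinearMap.comp_apply, ← LinearMap.comp_apply (F.rTensor K), ← LinearMap.rTensor_comp,
      hF1] at h5
    simp only [LinearMap.rTensor_zero, LinearMap.zero_apply, map_zero, LinearMap.comp_apply,
      map_sub, LinearMap.rTensor_tmul, hF2, LinearEquiv.coe_coe, TensorProduct.lid_tmul, one_smul,
      map_sum, hF3 (fun J => wordRev W J e) (fun J' => wordRev Y' J' o)] at h5
    rw [← sub_eq_zero.1 h5.symm]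
    congr 1
    refine Finset.sum_congr rfl fun J' _ => ?_
    -- For a permutation, the χ over the row indices cancel those over the column indices, so the
    -- rescaling disappears from the determinant.
    by_cases hJ : Function.Bijective J'
    · rw [hY', wordRev_rescale, Finset.prod_mul_distrib, Finset.prod_inv_distrib,
        hJ.prod_comp fun s => χ (o s), mul_inv_cancel₀, one_smul]
      exact Finset.prod_ne_zero_iff.2 fun s _ => hχ0 _
    · rw [topCoeff, if_neg hJ, zero_smul, zero_smul]

end Berezinian

/-! ### Quantum factorials -/

section Factorial

variable {k : Type*} [Field k]

theorem geom_sum_ne_zero_of_not_root [CharZero k] {q : k}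
    (hq : ∀ N : ℕ, 0 < N → q ^ N = 1 → q = 1) (N : ℕ) :
    ∑ t ∈ Finset.range (N + 1), q ^ t ≠ 0 := by
  by_cases h1 : q = 1
  · subst h1
    simpa using Nat.cast_add_one_ne_zero (R := k) N
  · intro h
    have := geom_sum_mul q (N + 1)
    rw [h, zero_mul] at this
    exact h1 (hq (N + 1) N.succ_pos (sub_eq_zero.1 this.symm))

section Order

variable {ι : Type*} [LinearOrder ι]

/-- The summand of a is q to the number of elements of s above a, and each exponent below the
cardinality occurs once. -/
theorem sum_prod_ite_lt (q : k) (s : Finset ι) :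
    ∑ a ∈ s, ∏ b ∈ s, (if a < b then q else 1) = ∑ t ∈ Finset.range s.card, q ^ t := by
  induction s using Finset.induction_on_min with
  | empty => simp
  | insert a s ha ih =>
    have has : a ∉ s := fun h => (ha a h).false
    rw [Finset.sum_insert has, Finset.card_insert_of_notMem has, Finset.sum_range_succ, ← ih,
      Finset.prod_insert has, if_neg (lt_irrefl a), one_mul, add_comm,
      Finset.prod_congr rfl fun b hb => if_pos (ha b hb), Finset.prod_const]
    congr 1
    refine Finset.sum_congr rfl fun x hx => ?_
    rw [Finset.prod_insert has, if_neg (ha x hx).not_gt, one_mul]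

/-- The product of a symmetric function over the unordered pairs in `s`. -/
def pairProd (κ : ι → ι → k) (s : Finset ι) : k :=
  ∏ a ∈ s, ∏ b ∈ s, if a < b then κ a b else 1

theorem pairProd_erase {κ : ι → ι → k} (hκ : ∀ a b, κ a b = κ b a) {s : Finset ι} {a : ι}
    (ha : a ∈ s) : pairProd κ s = (∏ b ∈ s.erase a, κ a b) * pairProd κ (s.erase a) := by
  obtain ⟨s, has, rfl⟩ : ∃ s', a ∉ s' ∧ s = insert a s' :=
    ⟨s.erase a, Finset.notMem_erase a s, (Finset.insert_erase ha).symm⟩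
  rw [Finset.erase_insert has, pairProd, Finset.prod_insert has, Finset.prod_insert has,
    if_neg (lt_irrefl a), one_mul,
    Finset.prod_congr rfl fun x _ => Finset.prod_insert has, Finset.prod_mul_distrib, ← mul_assoc,
    ← Finset.prod_mul_distrib]
  congr 1
  refine Finset.prod_congr rfl fun b hb => ?_
  rcases lt_trichotomy a b with h | h | h
  · rw [if_pos h, if_neg h.not_gt, mul_one]
  · exact absurd (h ▸ hb) has
  · rw [if_neg h.not_gt, if_pos h, one_mul, hκ]

variable [Fintype ι]

-- Peeling off the first letter a of an enumeration leaves an enumeration of s without a. The pairs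
-- with a contribute symmetric factors κ times q to the number of larger elements. Summing over a
-- produces a quantum integer, so induction yields a quantum factorial.
open Classical in
theorem sum_prod_pairs_eq {q : k} {γ κ : ι → ι → k} (hκ : ∀ a b, κ a b = κ b a)
    (hγ : ∀ a b, a ≠ b → γ a b = κ a b * if a < b then q else 1) (N : ℕ) (s : Finset ι)
    (hs : s.card = N) :
    (∑ J : Fin N → ι, if Function.Injective J ∧ ∀ i, J i ∈ s then
      ∏ i, ∏ j, if i < j then γ (J i) (J j) else 1 else 0) =
    pairProd κ s * ∏ N' ∈ Finset.range N, ∑ t ∈ Finset.range (N' + 1), q ^ t := by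
  induction N generalizing s with
  | zero =>
    rw [Finset.card_eq_zero] at hs
    simp [hs, pairProd, Function.injective_of_subsingleton]
  | succ N ih =>
    rw [sum_fin_succ_fun]
    have h1 : ∀ a, (∑ J : Fin N → ι, if Function.Injective (Fin.cons a J : Fin (N + 1) → ι) ∧
        ∀ i, (Fin.cons a J : Fin (N + 1) → ι) i ∈ s then
        ∏ i, ∏ j, if i < j then γ ((Fin.cons a J : Fin (N + 1) → ι) i)
          ((Fin.cons a J : Fin (N + 1) → ι) j) else 1 else 0) =
        if a ∈ s then pairProd κ s * (∏ b ∈ s, if a < b then q else 1) *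
          ∏ N' ∈ Finset.range N, ∑ t ∈ Finset.range (N' + 1), q ^ t else 0 := by
      intro a
      by_cases ha : a ∈ s
      · have hc : (s.erase a).card = N := by rw [Finset.card_erase_of_mem ha, hs]; rfl
        have h2 := ih (s.erase a) hc
        have h3 : (∏ b ∈ s, if a < b then q else 1) = ∏ b ∈ s.erase a, if a < b then q else 1 := by
          rw [← Finset.mul_prod_erase s _ ha, if_neg (lt_irrefl a), one_mul]
        have h4 : (∏ b ∈ s.erase a, κ a b) * (∏ b ∈ s.erase a, if a < b then q else 1) =
            ∏ b ∈ s.erase a, γ a b := by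
          rw [← Finset.prod_mul_distrib]
          exact Finset.prod_congr rfl fun b hb => (hγ a b (Finset.ne_of_mem_erase hb).symm).symm
        rw [if_pos ha, pairProd_erase hκ ha, h3, mul_right_comm _ (pairProd κ _), h4, mul_assoc,
          ← h2, Finset.mul_sum]
        refine Finset.sum_congr rfl fun J _ => ?_
        have hiff : (Function.Injective (Fin.cons a J : Fin (N + 1) → ι) ∧
            ∀ i, (Fin.cons a J : Fin (N + 1) → ι) i ∈ s) ↔
            Function.Injective J ∧ ∀ i, J i ∈ s.erase a := by
          rw [Fin.cons_injective_iff, Fin.forall_fin_succ]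
          simp only [Fin.cons_zero, Fin.cons_succ, Finset.mem_erase, Set.mem_range, not_exists]
          constructor
          · rintro ⟨⟨h5, h6⟩, -, h7⟩
            exact ⟨h6, fun i => ⟨h5 i, h7 i⟩⟩
          · rintro ⟨h5, h6⟩
            exact ⟨⟨fun i => (h6 i).1, h5⟩, ha, fun i => (h6 i).2⟩
        simp only [hiff]
        split_ifs with hJ
        · have him : Finset.univ.image J = s.erase a := by
            refine Finset.eq_of_subset_of_card_le ?_ ?_
            · intro x hx
              obtain ⟨i, -, rfl⟩ := Finset.mem_image.1 hx
              exact hJ.2 i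
            · rw [Finset.card_image_of_injective _ hJ.1, hc]; simp
          rw [← him, Finset.prod_image fun x _ y _ h => hJ.1 h, Fin.prod_univ_succ]
          congr 1
          · rw [Fin.prod_univ_succ]; simp
          · refine Finset.prod_congr rfl fun i _ => ?_
            rw [Fin.prod_univ_succ]; simp
        · simp
      · rw [if_neg ha]
        refine Finset.sum_eq_zero fun J _ => if_neg fun h => ha ?_
        simpa using h.2 0
    simp_rw [h1]
    rw [← Finset.sum_filter, Finset.filter_mem_eq_inter, Finset.univ_inter, ← Finset.sum_mul,
      ← Finset.mul_sum, sum_prod_ite_lt, hs, Finset.prod_range_succ]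
    ring

end Order

-- The order on the letters is arbitrary and unrelated to that of `Fin n`, which only orders
-- positions. This freedom is needed because the order defined by the signs ε need not be the
-- standard one.
open Classical in
theorem sum_prod_pairs_ne_zero [CharZero k] {n : ℕ} {q : k}
    (hq : ∀ N : ℕ, 0 < N → q ^ N = 1 → q = 1) {γ κ : Fin n → Fin n → k}
    (hκ : ∀ a b, κ a b = κ b a) (hκ0 : ∀ a b, a ≠ b → κ a b ≠ 0)
    (ho : ∃ o : LinearOrder (Fin n), ∀ a b, (o.lt a b → γ a b = κ a b * q) ∧
      (o.lt b a → γ a b = κ a b)) :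
    (∑ J : Fin n → Fin n, if Function.Bijective J then
      ∏ i, ∏ j, if i < j then γ (J i) (J j) else 1 else 0) ≠ 0 := by
  obtain ⟨o, ho⟩ := ho
  have hγ : ∀ a b, a ≠ b → γ a b = κ a b * if o.lt a b then q else 1 := by
    intro a b hab
    rcases @lt_trichotomy _ o a b with h | h | h
    · rw [if_pos h, (ho a b).1 h]
    · exact absurd h hab
    · rw [if_neg (@lt_asymm _ o.toPreorder _ _ h), (ho a b).2 h, mul_one]
  have key := @sum_prod_pairs_eq k _ (Fin n) o _ q γ κ hκ (fun a b h => by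
    rw [hγ a b h]) n Finset.univ (by simp)
  have h1 : (∑ J : Fin n → Fin n, if Function.Bijective J then
      ∏ i, ∏ j, if i < j then γ (J i) (J j) else 1 else 0) =
      ∑ J : Fin n → Fin n, if Function.Injective J ∧ ∀ i, J i ∈ Finset.univ then
      ∏ i, ∏ j, if i < j then γ (J i) (J j) else 1 else 0 := by
    refine Finset.sum_congr rfl fun J _ => ?_
    simp only [Finset.mem_univ, implies_true, and_true, Finite.injective_iff_bijective]
  rw [h1]
  refine ne_of_eq_of_ne (Eq.trans (by congr!) key) ?_
  refine mul_ne_zero (Finset.prod_ne_zero_iff.2 fun a _ => Finset.prod_ne_zero_iff.2 fun b _ => ?_)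
    (Finset.prod_ne_zero_iff.2 fun N _ => geom_sum_ne_zero_of_not_root hq N)
  split_ifs with h
  · exact hκ0 a b (@ne_of_lt _ o.toPreorder _ _ h)
  · exact one_ne_zero

end Factorial

/-! ### Quantum determinants -/

section Determinant

variable {k : Type*} [Field k] {K : Type*} [Ring K] [Algebra k K] {n : ℕ}

theorem topCoeff_id (c : Fin n → Fin n → k) : topCoeff c (fun s => s) = 1 := by
  rw [topCoeff, if_pos (show Function.Bijective fun s : Fin n => s from Function.bijective_id)]
  exact Finset.prod_eq_one fun i _ => Finset.prod_eq_one fun j _ =>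
    if_neg fun h => (h.1.trans h.2).false

theorem topCoeff_ne_zero {c : Fin n → Fin n → k} (hc : ∀ i j, c i j * c j i = 1)
    {J : Fin n → Fin n} (hJ : Function.Injective J) : topCoeff c J ≠ 0 := by
  rw [topCoeff, if_pos (Finite.injective_iff_bijective.1 hJ)]
  refine Finset.prod_ne_zero_iff.2 fun i _ => Finset.prod_ne_zero_iff.2 fun j _ => ?_
  split_ifs
  · exact neg_ne_zero.2 (left_ne_zero_of_mul_eq_one (hc _ _))
  · exact one_ne_zero

theorem topCoeff_eq_zero (c : Fin n → Fin n → k) {J : Fin n → Fin n}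
    (hJ : ¬ Function.Injective J) : topCoeff c J = 0 := by
  rw [topCoeff, if_neg fun h => hJ h.1]

/-- The quantum determinant of a matrix over the opposite ring. -/
def qDetRev (c : Fin n → Fin n → k) (X : Matrix (Fin n) (Fin n) K) : K :=
  ∑ J, topCoeff c J • wordRev X J fun s => s

theorem qDet_op (c : Fin n → Fin n → k) (X : Matrix (Fin n) (Fin n) K) :
    qDet c (X.map (MulOpposite.op : K → Kᵐᵒᵖ)) = MulOpposite.op (qDetRev c X) := by
  rw [qDet_eq_sum_topCoeff, qDetRev, Finset.op_sum]
  refine Finset.sum_congr rfl fun J _ => ?_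
  rw [MulOpposite.op_smul, ← wordMat_op]
  rfl

theorem IsQType.sum_topCoeff_wordRev [CharZero k] {a b : Fin n → Fin n → k} {t : k}
    {e : Fin n → Fin n → k} (h : IsQType a b t e) (he : ∀ i j, e i j * e j i = 1)
    (he1 : ∀ i, e i i = 1) {X : Matrix (Fin n) (Fin n) K}
    (hX : RRel a b (X.map (MulOpposite.op : K → Kᵐᵒᵖ))) (I : Fin n → Fin n) :
    ∑ J, topCoeff e J • wordRev X J I = topCoeff e I • qDetRev e X := by
  apply MulOpposite.op_injective
  rw [MulOpposite.op_smul, ← qDet_op, ← h.sum_topCoeff_wordMat he he1 hX I, Finset.op_sum]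
  exact Finset.sum_congr rfl fun J _ => by rw [MulOpposite.op_smul, ← wordMat_op]

omit [Algebra k K] in
theorem wordRev_transpose {ι : Type*} {N : ℕ} (D : Matrix ι ι K) (I J : Fin N → ι) :
    wordRev D.transpose I J = wordMat D (J ∘ Fin.rev) (I ∘ Fin.rev) := by
  rw [wordRev, wordMat]
  congr 1
  refine List.ext_getElem (by simp) fun i h1 h2 => ?_
  have h3 : i < N := by simpa using h2
  have h4 : (⟨N - 1 - i, by omega⟩ : Fin N) = Fin.rev ⟨i, h3⟩ := by ext; simp; omega
  simp [List.getElem_reverse, h4]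

/-- Column and row expansions give the same determinant. -/
theorem qDetRev_transpose_eq_qDet [CharZero k] {q : k} (hq0 : q ≠ 0)
    (hq : ∀ N : ℕ, 0 < N → q ^ N = 1 → q = 1) {a b e e' : Fin n → Fin n → k}
    (h : IsQType a b q e) (h' : IsQType (fun i j => a j i) b q e')
    (he : ∀ i j, e i j * e j i = 1) (he1 : ∀ i, e i i = 1)
    (he' : ∀ i j, e' i j * e' j i = 1) (he1' : ∀ i, e' i i = 1) (hb : ∀ i j, b i j ≠ 0)
    (ho : ∃ o : LinearOrder (Fin n), ∀ i j, (o.lt i j → a i j = q - 1) ∧ (o.lt j i → a i j = 0))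
    {D : Matrix (Fin n) (Fin n) K} (hD : RRel a b D) :
    qDetRev e' D.transpose = qDet e D := by
  have hrev : Function.Bijective fun J : Fin n → Fin n => J ∘ Fin.rev :=
    (Equiv.arrowCongr Fin.revPerm (Equiv.refl _)).bijective
  -- After reversal of the second word, each pair of positions contributes exactly one factor, from
  -- `e` or from `e'`. It equals b/(q - a), which up to the symmetric part κ is q or 1 according to
  -- the order.
  have hS : ∑ J, topCoeff e J * topCoeff e' (J ∘ Fin.rev) ≠ 0 := by
    have h1 : ∀ J : Fin n → Fin n, topCoeff e J * topCoeff e' (J ∘ Fin.rev) =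
        if Function.Bijective J then ∏ i, ∏ j, if i < j then
          (if J j < J i then -e (J i) (J j) else -e' (J j) (J i)) else 1 else 0 := by
      intro J
      by_cases hJ : Function.Bijective J
      · rw [topCoeff, topCoeff, if_pos hJ, if_pos hJ, if_pos (hJ.comp Fin.rev_bijective)]
        have h2 : (∏ i, ∏ j, if i < j ∧ (J ∘ Fin.rev) j < (J ∘ Fin.rev) i then
            -e' ((J ∘ Fin.rev) i) ((J ∘ Fin.rev) j) else 1) =
            ∏ i, ∏ j, if i < j ∧ J i < J j then -e' (J j) (J i) else 1 := by
          rw [Finset.prod_comm, ← Equiv.prod_comp Fin.revPerm]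
          refine Finset.prod_congr rfl fun i _ => ?_
          rw [← Equiv.prod_comp Fin.revPerm]
          refine Finset.prod_congr rfl fun j _ => ?_
          simp
        rw [h2, ← Finset.prod_mul_distrib]
        refine Finset.prod_congr rfl fun i _ => ?_
        rw [← Finset.prod_mul_distrib]
        refine Finset.prod_congr rfl fun j _ => ?_
        by_cases hij : i < j
        · rcases lt_trichotomy (J i) (J j) with h3 | h3 | h3
          · simp [hij, h3, h3.not_gt]
          · exact absurd (hJ.1 h3) hij.ne
          · simp [hij, h3, h3.not_gt]
        · simp [hij]
      · rw [if_neg hJ, topCoeff, if_neg hJ, zero_mul]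
    simp_rw [h1]
    have key := sum_prod_pairs_ne_zero hq
      (γ := fun x y => if y < x then -e x y else -e' y x)
      (κ := fun x y => (if y < x then b x y else b y x) / q) ?_ ?_ ?_
    · convert key
    · intro x y
      rcases lt_trichotomy x y with h2 | h2 | h2
      · simp [h2, h2.not_gt]
      · rw [h2]
      · simp [h2, h2.not_gt]
    · intro x y _
      split_ifs <;> exact div_ne_zero (hb _ _) hq0
    · obtain ⟨o, ho⟩ := ho
      refine ⟨o, fun x y => ?_⟩
      have h2 : x ≠ y → (if y < x then -e x y else -e' y x) =
          (if y < x then b x y else b y x) / (q - a x y) := by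
        intro hxy
        obtain ⟨h3, h4⟩ := h.off_diag x y hxy
        obtain ⟨h5, h6⟩ := h'.off_diag y x hxy.symm
        split_ifs
        · rw [h4]; field_simp
        · rw [h6]; field_simp
      constructor
      · intro hlt
        rw [h2 (@ne_of_lt _ o.toPreorder _ _ hlt), (ho x y).1 hlt]
        field_simp
        simp
      · intro hlt
        rw [h2 (@ne_of_gt _ o.toPreorder _ _ hlt), (ho x y).2 hlt, sub_zero]
  -- One double sum over row words and column words: summing over rows first yields `qDet`, summing
  -- over columns first yields `qDetRev` of the transpose, with the same coefficient.
  have hT1 : ∑ I, ∑ J, (topCoeff e J * topCoeff e' I) • wordMat D J (I ∘ Fin.rev) =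
      (∑ J, topCoeff e J * topCoeff e' (J ∘ Fin.rev)) • qDet e D := by
    have : ∀ I : Fin n → Fin n,
        ∑ J, (topCoeff e J * topCoeff e' I) • wordMat D J (I ∘ Fin.rev) =
        (topCoeff e (I ∘ Fin.rev) * topCoeff e' ((I ∘ Fin.rev) ∘ Fin.rev)) • qDet e D := by
      intro I
      have hI : (I ∘ Fin.rev) ∘ Fin.rev = I := by ext; simp
      rw [hI, mul_comm, mul_smul, ← h.sum_topCoeff_wordMat he he1 hD, Finset.smul_sum]
      exact Finset.sum_congr rfl fun J _ => by rw [mul_comm, mul_smul]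
    simp_rw [this]
    rw [← Finset.sum_smul]
    congr 1
    exact hrev.sum_comp fun J => topCoeff e J * topCoeff e' (J ∘ Fin.rev)
  have hT2 : ∑ I, ∑ J, (topCoeff e J * topCoeff e' I) • wordMat D J (I ∘ Fin.rev) =
      (∑ J, topCoeff e J * topCoeff e' (J ∘ Fin.rev)) • qDetRev e' D.transpose := by
    rw [Finset.sum_comm, Finset.sum_smul]
    refine Finset.sum_congr rfl fun J _ => ?_
    rw [mul_smul, ← h'.sum_topCoeff_wordRev he' he1' hD.op_transpose, Finset.smul_sum]
    refine Finset.sum_congr rfl fun I _ => ?_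
    rw [mul_smul, wordRev_transpose]
    have hJ : (J ∘ Fin.rev) ∘ Fin.rev = J := by ext; simp
    rw [hJ]
  exact smul_right_injective K hS (hT2.symm.trans hT1)

/-- Cramer's rule by expansion along the last column. The columns other than i, followed by column
l, give zero if l ≠ i because a column repeats, and a nonzero multiple of the determinant if l = i.
Cofactors stand to the left of the entries, so a left inverse of the determinant suffices. -/
theorem IsQType.exists_left_inverse [CharZero k] {a b : Fin n → Fin n → k} {t : k}
    {e : Fin n → Fin n → k} (h : IsQType a b t e) (he : ∀ i j, e i j * e j i = 1)
    (he1 : ∀ i, e i i = 1) {Y : Matrix (Fin n) (Fin n) K} (hY : RRel a b Y) {L : K}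
    (hL : L * qDet e Y = 1) : ∃ X : Matrix (Fin n) (Fin n) K, X * Y = 1 := by
  obtain _ | N := n
  · exact ⟨0, Subsingleton.elim _ _⟩
  let T : Fin (N + 1) → Fin (N + 1) → k := fun i l => topCoeff e (Fin.snoc i.succAbove l)
  have hT : ∀ i l, i ≠ l → T i l = 0 := by
    intro i l hil
    refine topCoeff_eq_zero e fun hinj => ?_
    rw [Fin.snoc_injective_iff] at hinj
    exact hinj.2 (by rw [Fin.range_succAbove]; exact hil.symm)
  have hT0 : ∀ i, T i i ≠ 0 := by
    intro i
    refine topCoeff_ne_zero he ?_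
    rw [Fin.snoc_injective_iff]
    exact ⟨Fin.succAbove_right_injective, by simp⟩
  refine ⟨Matrix.of fun i j => (T i i)⁻¹ • (L * ∑ J : Fin N → Fin (N + 1),
    topCoeff e (Fin.snoc J j) • wordMat Y J i.succAbove), ?_⟩
  ext i l
  have key := h.sum_topCoeff_wordMat he he1 hY (Fin.snoc i.succAbove l)
  rw [← (Fin.snocEquiv fun _ => Fin (N + 1)).sum_comp, Fintype.sum_prod_type] at key
  have h1 : ∀ (j : Fin (N + 1)) (J : Fin N → Fin (N + 1)),
      wordMat Y (Fin.snoc J j) (Fin.snoc i.succAbove l) = wordMat Y J i.succAbove * Y j l := by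
    intro j J
    simp [wordMat, List.ofFn_succ_last, -List.ofFn_succ]
  have h2 : ∑ j, (∑ J : Fin N → Fin (N + 1), topCoeff e (Fin.snoc J j) •
      wordMat Y J i.succAbove) * Y j l = T i l • qDet e Y := by
    rw [← key]
    refine Finset.sum_congr rfl fun j _ => ?_
    rw [Finset.sum_mul]
    refine Finset.sum_congr rfl fun J _ => ?_
    have : (Fin.snocEquiv fun _ => Fin (N + 1)) (j, J) = Fin.snoc J j := rfl
    rw [this, h1, smul_mul_assoc]
  rw [Matrix.mul_apply]
  simp only [Matrix.of_apply, smul_mul_assoc, mul_assoc]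
  rw [← Finset.smul_sum, ← Finset.mul_sum, h2, Matrix.one_apply]
  split_ifs with hil
  · rw [← hil, mul_smul_comm, hL, smul_smul, inv_mul_cancel₀ (hT0 i), one_smul]
  · rw [hT i l hil, zero_smul, mul_zero, smul_zero]

/-- Here the expansion is along the first column, so cofactors stand to the right and a right
inverse of the determinant suffices. The conclusion is a matrix inverse only after multiplication is
reversed, which is how it is used over the opposite ring. -/
theorem IsQType.exists_sum_mul_eq_one [CharZero k] {a b : Fin n → Fin n → k} {t : k}
    {e : Fin n → Fin n → k} (h : IsQType a b t e) (he : ∀ i j, e i j * e j i = 1)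
    (he1 : ∀ i, e i i = 1) {Y : Matrix (Fin n) (Fin n) K} (hY : RRel a b Y) {L : K}
    (hL : qDet e Y * L = 1) :
    ∃ X : Matrix (Fin n) (Fin n) K, ∀ i l, ∑ j, Y j l * X i j = if i = l then 1 else 0 := by
  obtain _ | N := n
  · exact ⟨0, fun i => i.elim0⟩
  let T : Fin (N + 1) → Fin (N + 1) → k := fun i l => topCoeff e (Fin.cons l i.succAbove)
  have hT : ∀ i l, i ≠ l → T i l = 0 := by
    intro i l hil
    refine topCoeff_eq_zero e fun hinj => ?_
    rw [Fin.cons_injective_iff] at hinj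
    exact hinj.1 (by rw [Fin.range_succAbove]; exact hil.symm)
  have hT0 : ∀ i, T i i ≠ 0 := by
    intro i
    refine topCoeff_ne_zero he ?_
    rw [Fin.cons_injective_iff]
    exact ⟨by simp, Fin.succAbove_right_injective⟩
  refine ⟨Matrix.of fun i j => (T i i)⁻¹ • ((∑ J : Fin N → Fin (N + 1),
    topCoeff e (Fin.cons j J) • wordMat Y J i.succAbove) * L), fun i l => ?_⟩
  have key := h.sum_topCoeff_wordMat he he1 hY (Fin.cons l i.succAbove)
  rw [sum_fin_succ_fun] at key
  have h1 : ∀ (j : Fin (N + 1)) (J : Fin N → Fin (N + 1)),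
      wordMat Y (Fin.cons j J) (Fin.cons l i.succAbove) = Y j l * wordMat Y J i.succAbove := by
    intro j J
    simp [wordMat, List.ofFn_succ]
  have h2 : ∑ j, Y j l * (∑ J : Fin N → Fin (N + 1), topCoeff e (Fin.cons j J) •
      wordMat Y J i.succAbove) = T i l • qDet e Y := by
    rw [← key]
    refine Finset.sum_congr rfl fun j _ => ?_
    rw [Finset.mul_sum]
    exact Finset.sum_congr rfl fun J _ => by rw [h1, mul_smul_comm]
  simp only [Matrix.of_apply, mul_smul_comm, ← mul_assoc]
  rw [← Finset.smul_sum, ← Finset.sum_mul, h2]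
  split_ifs with hil
  · rw [← hil, smul_mul_assoc, hL, smul_smul, inv_mul_cancel₀ (hT0 i), one_smul]
  · rw [hT i l hil, zero_smul, zero_mul, smul_zero]

/-- The factor `topCoeff e I` times the determinant is the expansion along the columns `I`. After
summation over `I` the words in S and W cancel, so no multiplicativity of determinants is needed. -/
theorem IsQType.qDet_mul_qDetRev [CharZero k] {a b : Fin n → Fin n → k} {t : k}
    {e : Fin n → Fin n → k} (h : IsQType a b t e) (he : ∀ i j, e i j * e j i = 1)
    (he1 : ∀ i, e i i = 1) {S W : Matrix (Fin n) (Fin n) K} (hS : RRel a b S) (h1 : S * W = 1) :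
    qDet e S * qDetRev e W = 1 := by
  have : ∀ I : Fin n → Fin n, qDet e S * (topCoeff e I • wordRev W I fun s => s) =
      ∑ J, topCoeff e J • (wordMat S J I * wordRev W I fun s => s) := by
    intro I
    rw [mul_smul_comm, ← smul_mul_assoc, ← h.sum_topCoeff_wordMat he he1 hS, Finset.sum_mul]
    simp_rw [smul_mul_assoc]
  rw [qDetRev, Finset.mul_sum]
  simp_rw [this]
  rw [Finset.sum_comm]
  simp_rw [← Finset.smul_sum, sum_wordMat_mul_wordRev h1]
  simp [topCoeff_id]

theorem IsQType.qDetRev_mul_qDet [CharZero k] {a b : Fin n → Fin n → k} {t : k}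
    {e : Fin n → Fin n → k} (h : IsQType a b t e) (he : ∀ i j, e i j * e j i = 1)
    (he1 : ∀ i, e i i = 1) {S W : Matrix (Fin n) (Fin n) K} (hW : RRelOp a b W) (h1 : W * S = 1) :
    qDetRev e W * qDet e S = 1 := by
  have : ∀ I : Fin n → Fin n, qDetRev e W * (topCoeff e I • wordMat S I fun s => s) =
      ∑ J, topCoeff e J • (wordRev W J I * wordMat S I fun s => s) := by
    intro I
    rw [mul_smul_comm, ← smul_mul_assoc, ← h.sum_topCoeff_wordRev he he1 hW.op, Finset.sum_mul]
    simp_rw [smul_mul_assoc]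
  rw [qDet_eq_sum_topCoeff, Finset.mul_sum]
  change ∑ I, qDetRev e W * (topCoeff e I • wordMat S I fun s => s) = 1
  simp_rw [this]
  rw [Finset.sum_comm]
  simp_rw [← Finset.smul_sum, sum_wordRev_mul_wordMat h1]
  simp [topCoeff_id]

/-- The block decomposition of a matrix with the inverse `(W₁ W₂; * *)`. -/
theorem isUnit_block_and_qDet_eq [CharZero k] {m : ℕ} {q : k} (hq0 : q ≠ 0)
    (hq : ∀ N : ℕ, 0 < N → q ^ N = 1 → q = 1)
    {a₁ b₁ e₁ : Fin m → Fin m → k} {t : k} (h₁ : IsQType a₁ b₁ t e₁)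
    (he₁ : ∀ i j, e₁ i j * e₁ j i = 1) (he₁' : ∀ i, e₁ i i = 1)
    {a b e e' : Fin n → Fin n → k}
    (h : IsQType a b q e) (h' : IsQType (fun i j => a j i) b q e')
    (he : ∀ i j, e i j * e j i = 1) (he1 : ∀ i, e i i = 1)
    (he' : ∀ i j, e' i j * e' j i = 1) (he1' : ∀ i, e' i i = 1) (hb : ∀ i j, b i j ≠ 0)
    (ho : ∃ o : LinearOrder (Fin n), ∀ i j, (o.lt i j → a i j = q - 1) ∧ (o.lt j i → a i j = 0))
    {A W₁ : Matrix (Fin m) (Fin m) K} {B W₂ : Matrix (Fin m) (Fin n) K}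
    {C : Matrix (Fin n) (Fin m) K} {D : Matrix (Fin n) (Fin n) K}
    (hD : RRel a b D) (hW : RRelOp a₁ b₁ W₁)
    (hA : W₁ * A + W₂ * C = 1) (hB : W₁ * B + W₂ * D = 0)
    (hu : IsUnit (qDetRev e' D.transpose * qDetRev e₁ W₁)) :
    IsUnit D ∧ RRel a₁ b₁ (A - B * Ring.inverse D * C) ∧
      IsUnit (qDet e₁ (A - B * Ring.inverse D * C)) ∧
      qDetRev e' D.transpose * qDetRev e₁ W₁ =
        qDet e D * Ring.inverse (qDet e₁ (A - B * Ring.inverse D * C)) := by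
  obtain ⟨u, hu⟩ := hu
  have hu1 : qDetRev e' D.transpose * (qDetRev e₁ W₁ * (↑u⁻¹ : K)) = 1 := by
    rw [← mul_assoc, ← hu, Units.mul_inv]
  have hu2 : ((↑u⁻¹ : K) * qDetRev e' D.transpose) * qDetRev e₁ W₁ = 1 := by
    rw [mul_assoc, ← hu, Units.inv_mul]
  -- The unit hypothesis on the product yields only one-sided inverses of the two factors: a right
  -- inverse of D from the row determinant, and a left inverse of W₁.
  obtain ⟨X, hX⟩ : ∃ X : Matrix (Fin n) (Fin n) K, D * X = 1 := by
    obtain ⟨X, hX⟩ := h'.exists_left_inverse he' he1' hD.op_transpose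
      (L := MulOpposite.op (qDetRev e₁ W₁ * (↑u⁻¹ : K)))
      (by rw [qDet_op, ← MulOpposite.op_mul, hu1, MulOpposite.op_one])
    refine ⟨(X.map MulOpposite.unop).transpose, ?_⟩
    ext i j
    have := congrArg MulOpposite.unop (congrFun (congrFun hX j) i)
    simpa [Matrix.mul_apply, Finset.unop_sum, Matrix.one_apply, eq_comm,
      apply_ite MulOpposite.unop] using this
  obtain ⟨Y, hY⟩ : ∃ Y : Matrix (Fin m) (Fin m) K, Y * W₁ = 1 := by
    obtain ⟨X, hX⟩ := h₁.exists_sum_mul_eq_one he₁ he₁' hW.op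
      (L := MulOpposite.op ((↑u⁻¹ : K) * qDetRev e' D.transpose))
      (by rw [qDet_op, ← MulOpposite.op_mul, hu2, MulOpposite.op_one])
    refine ⟨X.map MulOpposite.unop, ?_⟩
    ext i j
    have := congrArg MulOpposite.unop (hX i j)
    simpa [Matrix.mul_apply, Finset.unop_sum, Matrix.one_apply, eq_comm,
      apply_ite MulOpposite.unop] using this
  -- The Schur complement formed with the right inverse X of D is a right inverse of W₁. Together
  -- with the left inverse Y this makes it two-sided.
  have hWS : W₁ * (A - B * X * C) = 1 := by
    have h2 : W₁ * B = -(W₂ * D) := eq_neg_of_add_eq_zero_left hB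
    rw [Matrix.mul_sub, ← Matrix.mul_assoc, ← Matrix.mul_assoc, h2, Matrix.neg_mul,
      Matrix.mul_assoc W₂, hX, Matrix.mul_one, Matrix.neg_mul, sub_neg_eq_add, hA]
  have hSW : (A - B * X * C) * W₁ = 1 := by
    have : Y = A - B * X * C := left_inv_eq_right_inv hY hWS
    rw [← this, hY]
  have hS := hW.inv hSW hWS
  have hd1 := h₁.qDet_mul_qDetRev he₁ he₁' hS hSW
  have hd2 := h₁.qDetRev_mul_qDet he₁ he₁' hW hWS
  have hrd : qDetRev e' D.transpose = u * qDet e₁ (A - B * X * C) := by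
    rw [hu, mul_assoc, hd2, mul_one]
  have hcd := qDetRev_transpose_eq_qDet hq0 hq h h' he he1 he' he1' hb ho hD
  -- The row determinant of D is u times the determinant of the Schur complement, hence a unit. As
  -- it is also the column determinant, Cramer's rule now gives the missing left inverse of D.
  obtain ⟨X', hX'⟩ := h.exists_left_inverse he he1 hD (L := qDetRev e₁ W₁ * (↑u⁻¹ : K)) (by
    rw [← hcd, hrd, mul_assoc, Units.inv_mul_cancel_left, hd2])
  have hXX : X' = X := left_inv_eq_right_inv hX' hX
  rw [hXX] at hX'
  have hinv : Ring.inverse D = X := Ring.inverse_unit (⟨D, X, hX, hX'⟩ : (Matrix _ _ K)ˣ)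
  rw [hinv]
  refine ⟨⟨⟨D, X, hX, hX'⟩, rfl⟩, hS, ⟨⟨_, _, hd1, hd2⟩, rfl⟩, ?_⟩
  rw [hcd]
  congr 1
  exact (Ring.inverse_unit (⟨_, _, hd1, hd2⟩ : Kˣ)).symm

end Determinant

/-! ### Multiparameters -/

section Parameters

variable {k : Type*} [Field k] {d : ℕ}

/-- The parameters `(-1)^{îĵ} p_{ij}` of the quantum exterior algebra. -/
def cPar (par : Fin d → ℕ) (p : Fin d → Fin d → k) (i j : Fin d) : k :=
  (-1) ^ (par i * par j) * p i j

/-- The diagonal coefficients `R^{ij}_{ij}`. -/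
def aPar (q : k) (p r : Fin d → Fin d → k) (i j : Fin d) : k :=
  (q - p i j * r i j) / (1 + p i j * r i j)

/-- The coefficients `R^{ji}_{ij}`. -/
def bPar (par : Fin d → ℕ) (q : k) (p r : Fin d → Fin d → k) (i j : Fin d) : k :=
  (-1) ^ (par i * par j) * (p i j * (q + 1) / (1 + p i j * r i j))

theorem sum_sum_ite_eq {M : Type*} [AddCommMonoid M] (u v : Fin d) (F : Fin d → Fin d → M) :
    ∑ a, ∑ b, (if a = u ∧ b = v then F a b else 0) = F u v := by
  simp [ite_and]

theorem sum_rCoeff_smul {M : Type*} [AddCommGroup M] [Module k M] (par : Fin d → ℕ) (q : k)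
    (p r : Fin d → Fin d → k) (i j : Fin d) (G : Fin d → Fin d → k) (F : Fin d → Fin d → M) :
    ∑ a, ∑ b, (G a b * rCoeff par q p r a b i j) • F a b =
      (G i j * aPar q p r i j) • F i j + (G j i * bPar par q p r i j) • F j i := by
  rw [← sum_sum_ite_eq i j fun a b => (G a b * aPar q p r i j) • F a b,
    ← sum_sum_ite_eq j i fun a b => (G a b * bPar par q p r i j) • F a b, ← Finset.sum_add_distrib]
  refine Finset.sum_congr rfl fun a _ => ?_
  rw [← Finset.sum_add_distrib]
  refine Finset.sum_congr rfl fun b _ => ?_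
  rw [rCoeff, aPar, bPar]
  split_ifs <;> simp [add_smul, mul_add]

theorem sum_smul_rCoeff {M : Type*} [AddCommGroup M] [Module k M] (par : Fin d → ℕ) (q : k)
    (p r : Fin d → Fin d → k) (u v : Fin d) (G : Fin d → Fin d → k) (F : Fin d → Fin d → M) :
    ∑ a, ∑ b, (G a b * rCoeff par q p r u v a b) • F a b =
      (G u v * aPar q p r u v) • F u v + (G v u * bPar par q p r v u) • F v u := by
  rw [← sum_sum_ite_eq u v fun a b => (G a b * aPar q p r a b) • F a b,
    ← sum_sum_ite_eq v u fun a b => (G a b * bPar par q p r a b) • F a b,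
    ← Finset.sum_add_distrib]
  refine Finset.sum_congr rfl fun a _ => ?_
  rw [← Finset.sum_add_distrib]
  refine Finset.sum_congr rfl fun b _ => ?_
  rw [rCoeff, aPar, bPar]
  have h1 : (u = a ∧ v = b) ↔ (a = u ∧ b = v) := by tauto
  have h2 : (u = b ∧ v = a) ↔ (a = v ∧ b = u) := by tauto
  simp only [h1, h2]
  split_ifs <;> simp [add_smul, mul_add]

section Entries

variable {K : Type*} [Ring K] [Algebra k K]

theorem zRelLeft_eq (par : Fin d → ℕ) (q : k) (p r : Fin d → Fin d → k)
    (Z : Matrix (Fin d) (Fin d) K) (u v i j : Fin d) :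
    zRelLeft par q p r Z u v i j =
      ((-1 : k) ^ (par v * (par i + par u)) * aPar q p r u v) • (Z u i * Z v j) +
      ((-1 : k) ^ (par u * (par i + par v)) * bPar par q p r v u) • (Z v i * Z u j) :=
  sum_smul_rCoeff par q p r u v (fun a s => (-1 : k) ^ (par s * (par i + par a)))
    fun a s => Z a i * Z s j

theorem zRelRight_eq (par : Fin d → ℕ) (q : k) (p r : Fin d → Fin d → k)
    (Z : Matrix (Fin d) (Fin d) K) (u v i j : Fin d) :
    zRelRight par q p r Z u v i j =
      ((-1 : k) ^ (par v * (par i + par u)) * aPar q p r i j) • (Z u i * Z v j) +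
      ((-1 : k) ^ (par v * (par j + par u)) * bPar par q p r i j) • (Z u j * Z v i) :=
  sum_rCoeff_smul par q p r i j (fun a _ => (-1 : k) ^ (par v * (par a + par u)))
    fun a s => Z u a * Z v s

theorem isQuantumMatrix_const_iff (c : ℕ) (q : k) (p r : Fin d → Fin d → k)
    (Z : Matrix (Fin d) (Fin d) K) :
    IsQuantumMatrix (fun _ => c) q p r Z ↔ RRel (aPar q p r) (bPar (fun _ => c) q p r) Z := by
  have h : (-1 : k) ^ (c * (c + c)) = 1 := Even.neg_one_pow (by simp [parity_simps])
  simp only [IsQuantumMatrix, zRelLeft_eq, zRelRight_eq, h, one_mul, RRel]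

end Entries

namespace IsMultiparameter

variable {q : k} {p r : Fin d → Fin d → k} (h : IsMultiparameter q p r)
include h

theorem comp {d' : ℕ} {f : Fin d' → Fin d} (hf : StrictMono f) :
    IsMultiparameter q (fun i j => p (f i) (f j)) (fun i j => r (f i) (f j)) where
  q_ne_zero := h.q_ne_zero
  eq_one_of_pow_eq_one := h.eq_one_of_pow_eq_one
  p_ne_zero _ _ := h.p_ne_zero _ _
  r_ne_zero _ _ := h.r_ne_zero _ _
  p_swap _ _ := h.p_swap _ _
  r_swap _ _ := h.r_swap _ _
  p_self _ := h.p_self _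
  r_self _ := h.r_self _
  exists_sign := by
    obtain ⟨ε, h1, h2⟩ := h.exists_sign
    exact ⟨fun i j => ε (f i) (f j), fun i j hij => h1 _ _ (hf.injective.ne hij),
      fun i j l hij hjl => h2 _ _ _ (hf hij) (hf hjl)⟩

theorem p_mul_swap (i j : Fin d) : p i j * p j i = 1 := by
  rw [h.p_swap i j, mul_inv_cancel₀ (h.p_ne_zero i j)]

theorem r_mul_swap (i j : Fin d) : r i j * r j i = 1 := by
  rw [h.r_swap i j, mul_inv_cancel₀ (h.r_ne_zero i j)]

theorem cPar_mul_swap (par : Fin d → ℕ) (i j : Fin d) :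
    cPar par p i j * cPar par p j i = 1 := by
  rw [cPar, cPar, mul_mul_mul_comm, h.p_mul_swap, mul_one, mul_comm (par j), ← mul_pow]
  simp

theorem cPar_self (par : Fin d → ℕ) (i : Fin d) : cPar par p i i = (-1) ^ par i := by
  rw [cPar, h.p_self, mul_one, pow_mul, ← pow_mul]
  rcases Nat.even_or_odd (par i) with hi | hi
  · rw [hi.neg_one_pow, (hi.mul_left _).neg_one_pow]
  · rw [hi.neg_one_pow, (hi.mul hi).neg_one_pow]

variable [CharZero k]

omit h in
theorem one_ne_neg_one : (1 : k) ≠ -1 := by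
  intro h
  have h2 : (2 : k) = 0 := by rw [← one_add_one_eq_two]; nth_rewrite 1 [h]; simp
  exact two_ne_zero h2

theorem one_add_q_ne_zero : 1 + q ≠ 0 := by
  intro h1
  have h2 : q = -1 := (eq_neg_of_add_eq_zero_right h1)
  have h3 := h.eq_one_of_pow_eq_one 2 two_pos (by rw [h2]; simp)
  exact one_ne_neg_one (h3.symm.trans h2)

/-- The cases are ε = 1 and ε = -1. In both, exactly one of the two diagonal coefficients for the
pair is q - 1 and the other is 0, which is the source of triangularity. -/
theorem off_diag {i j : Fin d} (hij : i ≠ j) :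
    (p i j * r i j = q ∧ aPar q p r i j = 0 ∧ aPar q p r j i = q - 1 ∧
      ∀ par, bPar par q p r i j = cPar par p i j) ∨
    (p i j * r i j = q⁻¹ ∧ aPar q p r i j = q - 1 ∧ aPar q p r j i = 0 ∧
      ∀ par, bPar par q p r i j = cPar par p i j * q) := by
  have hq := h.q_ne_zero
  have h1 := h.one_add_q_ne_zero
  have h1' : q + 1 ≠ 0 := by rwa [add_comm]
  obtain ⟨ε, hε, -⟩ := h.exists_sign
  have hs : p j i * r j i = (p i j * r i j)⁻¹ := by rw [h.p_swap i j, h.r_swap i j, mul_inv]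
  obtain ⟨h2 | h2, h3⟩ := hε i j hij
  · left
    rw [h2, zpow_one] at h3
    refine ⟨h3, ?_, ?_, fun par => ?_⟩
    · rw [aPar, h3, sub_self, zero_div]
    · rw [aPar, hs, h3]; field_simp; ring
    · rw [bPar, cPar, h3]; field_simp; rw [add_comm q]
  · right
    rw [h2, zpow_neg_one] at h3
    refine ⟨h3, ?_, ?_, fun par => ?_⟩
    · rw [aPar, h3]; field_simp; ring
    · rw [aPar, hs, h3, inv_inv, sub_self, zero_div]
    · rw [bPar, cPar, h3]; field_simp

theorem diag (par : Fin d → ℕ) (i : Fin d) :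
    (cPar par p i i = 1 ∧ aPar q p r i i + bPar par q p r i i = q) ∨
    (cPar par p i i = -1 ∧ aPar q p r i i + bPar par q p r i i = -1) := by
  have h1 : (-1 : k) ^ (par i * par i) = (-1) ^ par i := by
    have := h.cPar_self par i
    rwa [cPar, h.p_self, mul_one] at this
  rw [h.cPar_self, aPar, bPar, h.p_self, h.r_self, h1]
  rcases neg_one_pow_eq_or k (par i) with h2 | h2
  · left; refine ⟨h2, ?_⟩; rw [h2]; norm_num; ring
  · right; refine ⟨h2, ?_⟩; rw [h2]; norm_num; ring

theorem q_ne_neg_one : q ≠ -1 := fun h1 => h.one_add_q_ne_zero (by rw [h1]; ring)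

theorem isQType_ext (par : Fin d → ℕ) :
    IsQType (aPar q p r) (bPar par q p r) (-1) (cPar par p) where
  off_diag i j hij := by
    have := h.q_ne_zero
    rcases h.off_diag hij with ⟨-, h1, -, h2⟩ | ⟨-, h1, -, h2⟩
    · rw [h1, h2]; exact ⟨by simp, by ring⟩
    · rw [h1, h2]; exact ⟨by ring_nf; simpa using this, by ring⟩
  diag i := by
    rcases h.diag par i with ⟨h1, h2⟩ | ⟨h1, h2⟩
    · exact Or.inr ⟨by rw [h2]; exact h.q_ne_neg_one, h1⟩
    · exact Or.inl ⟨h2, h1⟩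

theorem isQType_sym (par : Fin d → ℕ) :
    IsQType (fun i j => aPar q p r j i) (bPar par q p r) q (-cPar par p) where
  off_diag i j hij := by
    have := h.q_ne_zero
    rcases h.off_diag hij with ⟨-, -, h1, h2⟩ | ⟨-, -, h1, h2⟩
    · rw [h1, h2]; exact ⟨by simp, by simp⟩
    · rw [h1, h2]; exact ⟨by simpa using this, by simp⟩
  diag i := by
    rcases h.diag par i with ⟨h1, h2⟩ | ⟨h1, h2⟩
    · exact Or.inl ⟨h2, by simp [h1]⟩
    · exact Or.inr ⟨by rw [h2]; exact h.q_ne_neg_one.symm, by simp [h1]⟩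

/-- On odd indices the untransposed coefficients at eigenvalue q lead to r⁻¹, whereas the transposed
ones in `isQType_sym` lead to p. These are the parameters of the column and the row determinant of
D. -/
theorem isQType_odd {par : Fin d → ℕ} (hpar : ∀ i, par i = 1) :
    IsQType (aPar q p r) (bPar par q p r) q (fun i j => (r i j)⁻¹) where
  off_diag i j hij := by
    have h0 := h.q_ne_zero
    have hr := h.r_ne_zero i j
    rcases h.off_diag hij with ⟨h3, h1, -, h2⟩ | ⟨h3, h1, -, h2⟩
    · rw [h1, h2, cPar, hpar, hpar, ← h3]
      refine ⟨by simpa [h3] using h0, ?_⟩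
      field_simp; simp
    · have h4 : p i j * q = (r i j)⁻¹ := by
        field_simp
        rw [mul_right_comm, h3, inv_mul_cancel₀ h0]
      rw [h1, h2, cPar, hpar, hpar, mul_assoc, h4]
      exact ⟨by simp, by simp⟩
  diag i := by
    refine Or.inr ⟨?_, by simp [h.r_self]⟩
    rcases h.diag par i with ⟨h1, h2⟩ | ⟨h1, h2⟩
    · rw [h.cPar_self, hpar, pow_one] at h1
      exact absurd h1.symm one_ne_neg_one
    · rw [h2]; exact h.q_ne_neg_one.symm

theorem triangularData (par : Fin d → ℕ) : TriangularData q (aPar q p r) (bPar par q p r) where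
  q_ne_zero := h.q_ne_zero
  beta_ne_zero i j := by
    have hc : ∀ i j, cPar par p i j ≠ 0 := fun i j =>
      left_ne_zero_of_mul_eq_one (h.cPar_mul_swap par i j)
    by_cases hij : i = j
    · subst hij
      rw [bPar, h.p_self, h.r_self]
      have := h.one_add_q_ne_zero
      rw [add_comm] at this
      norm_num
      exact this
    · rcases h.off_diag hij with ⟨-, -, -, h2⟩ | ⟨-, -, -, h2⟩
      · rw [h2]; exact hc i j
      · rw [h2]; exact mul_ne_zero (hc i j) h.q_ne_zero
  diag i := (h.diag par i).imp And.right And.right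
  order := by
    classical
    -- For q = 1 the parameters do not determine the signs ε, but all off-diagonal coefficients
    -- vanish and any order works.
    by_cases hq : q = 1
    · refine ⟨inferInstance, fun i j => ?_⟩
      have : ∀ i j, i ≠ j → aPar q p r i j = 0 := by
        intro i j hij
        rcases h.off_diag hij with ⟨-, h1, -, -⟩ | ⟨-, h1, -, -⟩
        · exact h1
        · rw [h1, hq, sub_self]
      exact ⟨fun hlt => by rw [this i j hlt.ne, hq, sub_self], fun hlt => this i j hlt.ne'⟩
    · have hq0 := h.q_ne_zero
      have hqq : q ≠ q⁻¹ := by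
        intro h1
        refine hq (h.eq_one_of_pow_eq_one 2 two_pos ?_)
        rw [pow_two]; nth_rewrite 2 [h1]; exact mul_inv_cancel₀ hq0
      obtain ⟨ε, hε, hcyc⟩ := h.exists_sign
      have hneg : ∀ i j, i ≠ j → ε j i = -ε i j := by
        intro i j hij
        have hs : p j i * r j i = (p i j * r i j)⁻¹ := by
          rw [h.p_swap i j, h.r_swap i j, mul_inv]
        obtain ⟨h1 | h1, h2⟩ := hε i j hij <;> obtain ⟨h3 | h3, h4⟩ := hε j i hij.symm <;>
          rw [h1, h3] <;> rw [h1] at h2 <;> rw [h3, hs, h2] at h4 <;> simp at h4 ⊢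
        · exact hqq h4.symm
        · exact hqq h4
      -- Since q ≠ q⁻¹, the signs are antisymmetric. Excluding cyclic triples then makes ε = -1 a
      -- strict total order.
      let R : Fin d → Fin d → Prop := fun i j => i ≠ j ∧ ε i j = -1
      have htr : ∀ i j l, R i j → R j l → R i l := by
        rintro i j l ⟨hij, h1⟩ ⟨hjl, h2⟩
        have h1' := hneg i j hij
        have h2' := hneg j l hjl
        have hil : i ≠ l := by
          rintro rfl
          rw [h1, h2] at h1'
          norm_num at h1'
        refine ⟨hil, ?_⟩
        by_contra h3
        have h3 := (hε i l hil).1.resolve_right h3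
        have h3' := hneg i l hil
        rw [h1] at h1'
        rw [h2] at h2'
        rw [h3] at h3'
        rcases lt_or_gt_of_ne hij with a1 | a1 <;> rcases lt_or_gt_of_ne hjl with a2 | a2 <;>
          rcases lt_or_gt_of_ne hil with a3 | a3
        · have := hcyc _ _ _ a1 a2; rw [h1, h2, h3] at this; norm_num at this
        · exact absurd (a1.trans a2) a3.not_gt
        · have := hcyc _ _ _ a3 a2; rw [h1, h3, h2'] at this; norm_num at this
        · have := hcyc _ _ _ a3 a1; rw [h1, h3', h2'] at this; norm_num at this
        · have := hcyc _ _ _ a1 a3; rw [h1', h3, h2] at this; norm_num at this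
        · have := hcyc _ _ _ a2 a3; rw [h1', h3', h2] at this; norm_num at this
        · exact absurd (a3.trans a2) a1.not_gt
        · have := hcyc _ _ _ a2 a1; rw [h1', h3', h2'] at this; norm_num at this
      have hsto : IsStrictTotalOrder (Fin d) R :=
        { trichotomous := by
            intro i j h1 h2
            by_contra hij
            have h3 := (hε i j hij).1.resolve_right fun h4 => h1 ⟨hij, h4⟩
            exact h2 ⟨Ne.symm hij, by rw [hneg i j hij, h3]⟩
          irrefl := fun i h1 => h1.1 rfl
          trans := htr }
      have hR : ∀ i j, R i j → aPar q p r i j = q - 1 ∧ aPar q p r j i = 0 := by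
        rintro i j ⟨hij, h1⟩
        have h2 := (hε i j hij).2
        rw [h1, zpow_neg_one] at h2
        rcases h.off_diag hij with ⟨h3, -⟩ | ⟨-, h3, h4, -⟩
        · exact absurd (h3.symm.trans h2) hqq
        · exact ⟨h3, h4⟩
      exact ⟨linearOrderOfSTO R, fun i j => ⟨fun hlt => (hR i j hlt).1, fun hlt => (hR j i hlt).2⟩⟩

end IsMultiparameter

end Parameters

/-! ### Removing the signs -/

section Clifford

variable (k : Type*) [Field k]

/-- The monomials `g^a θ^b` in two anticommuting involutions. -/
def clifford (a b : ℕ) : Matrix (Fin 2) (Fin 2) k :=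
  !![1, 0; 0, -1] ^ a * !![0, 1; 1, 0] ^ b

theorem clifford_mul (a b c d : ℕ) :
    clifford k a b * clifford k c d = (-1 : k) ^ (b * c) • clifford k (a + c) (b + d) := by
  have h1 : (!![0, 1; 1, 0] : Matrix (Fin 2) (Fin 2) k) * !![1, 0; 0, -1] =
      (-1 : k) • (!![1, 0; 0, -1] * !![0, 1; 1, 0]) := by
    ext i j; fin_cases i <;> fin_cases j <;> simp
  have h2 : ∀ c : ℕ, (!![0, 1; 1, 0] : Matrix (Fin 2) (Fin 2) k) * !![1, 0; 0, -1] ^ c =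
      (-1 : k) ^ c • (!![1, 0; 0, -1] ^ c * !![0, 1; 1, 0]) := by
    intro c
    induction c with
    | zero => simp
    | succ c ih =>
      rw [pow_succ, ← mul_assoc, ih, smul_mul_assoc, mul_assoc, h1, mul_smul_comm, smul_smul,
        ← pow_succ, mul_assoc]
  have h3 : (!![0, 1; 1, 0] : Matrix (Fin 2) (Fin 2) k) ^ b * !![1, 0; 0, -1] ^ c =
      (-1 : k) ^ (b * c) • (!![1, 0; 0, -1] ^ c * !![0, 1; 1, 0] ^ b) := by
    induction b with
    | zero => simp
    | succ b ih =>
      rw [pow_succ, mul_assoc, h2, mul_smul_comm, ← mul_assoc, ih, smul_mul_assoc, smul_smul,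
        mul_assoc, ← pow_add, add_mul, one_mul, add_comm c]
  rw [clifford, clifford, clifford, mul_assoc, ← mul_assoc (_ ^ b), h3, smul_mul_assoc,
    mul_smul_comm, pow_add, pow_add]
  simp only [mul_assoc]

theorem clifford_add_two_mul (a b x y : ℕ) :
    clifford k (a + 2 * x) (b + 2 * y) = clifford k a b := by
  have h1 : (!![1, 0; 0, -1] : Matrix (Fin 2) (Fin 2) k) ^ 2 = 1 := by
    rw [pow_two]; ext i j; fin_cases i <;> fin_cases j <;> simp
  have h2 : (!![0, 1; 1, 0] : Matrix (Fin 2) (Fin 2) k) ^ 2 = 1 := by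
    rw [pow_two]; ext i j; fin_cases i <;> fin_cases j <;> simp
  rw [clifford, clifford, pow_add, pow_add, pow_mul, pow_mul, h1, h2, one_pow, one_pow, mul_one,
    mul_one]

theorem clifford_zero : clifford k 0 0 = 1 := by simp [clifford]

theorem clifford_left (n : ℕ) : clifford k n 0 = !![1, 0; 0, (-1) ^ n] := by
  rw [clifford, pow_zero, mul_one]
  induction n with
  | zero => ext i j; fin_cases i <;> fin_cases j <;> simp
  | succ n ih => rw [pow_succ, ih]; ext i j; fin_cases i <;> fin_cases j <;> simp [pow_succ]

/-- The first row of g^a is (1, 0) and θ^b only permutes entries. Hence the row sum strips g and θ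
off an element x g^a θ^b without a sign. -/
theorem clifford_row (a b : ℕ) : clifford k a b 0 0 + clifford k a b 0 1 = 1 := by
  have h1 : clifford k a b = clifford k a 0 * clifford k 0 b := by simp [clifford_mul]
  have h2 : clifford k 0 b 0 0 + clifford k 0 b 0 1 = 1 := by
    clear h1
    rw [clifford, pow_zero, one_mul]
    induction b with
    | zero => simp
    | succ b ih => rw [pow_succ]; simp [Matrix.mul_apply]; rw [add_comm]; exact ih
  rw [h1, clifford_left]
  simpa [Matrix.mul_apply] using h2

variable {k} {K : Type*} [Ring K] [Algebra k K]

variable (k) in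
/-- The element `x g^a θ^b`. -/
def bosonize (x : K) (a b : ℕ) : Matrix (Fin 2) (Fin 2) K :=
  (clifford k a b).map fun c => c • x

theorem bosonize_mul (x y : K) (a b c d : ℕ) :
    bosonize k x a b * bosonize k y c d =
      (-1 : k) ^ (b * c) • bosonize k (x * y) (a + c) (b + d) := by
  ext i j
  have := congrFun (congrFun (clifford_mul k a b c d) i) j
  rw [Matrix.mul_apply, Matrix.smul_apply] at this
  simp only [Matrix.mul_apply, bosonize, Matrix.map_apply, smul_mul_smul_comm, ← Finset.sum_smul,
    this, Matrix.smul_apply, smul_assoc]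

theorem bosonize_add (x y : K) (a b : ℕ) :
    bosonize k (x + y) a b = bosonize k x a b + bosonize k y a b := by
  ext i j; simp [bosonize]

theorem bosonize_smul (t : k) (x : K) (a b : ℕ) :
    bosonize k (t • x) a b = t • bosonize k x a b := by
  ext i j; simp [bosonize, smul_comm t]

theorem bosonize_sum {κ : Type*} (s : Finset κ) (x : κ → K) (a b : ℕ) :
    bosonize k (∑ i ∈ s, x i) a b = ∑ i ∈ s, bosonize k (x i) a b := by
  ext i j; simp [bosonize, Matrix.sum_apply, Finset.smul_sum]

theorem bosonize_add_two_mul (z : K) (a b x y : ℕ) :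
    bosonize k z (a + 2 * x) (b + 2 * y) = bosonize k z a b := by
  rw [bosonize, clifford_add_two_mul]; rfl

theorem bosonize_one : bosonize k (1 : K) 0 0 = 1 := by
  ext i j
  simp [bosonize, clifford_zero, Matrix.one_apply]

variable (k K) in
/-- The sum of the entries of the first row. -/
def rowSum : Matrix (Fin 2) (Fin 2) K →ₗ[k] K where
  toFun x := x 0 0 + x 0 1
  map_add' x y := by simp only [Matrix.add_apply]; abel
  map_smul' t x := by simp

@[simp] theorem rowSum_bosonize (x : K) (a b : ℕ) : rowSum k K (bosonize k x a b) = x := by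
  change clifford k a b 0 0 • x + clifford k a b 0 1 • x = x
  rw [← add_smul, clifford_row, one_smul]

theorem koszulSign_succ {N : ℕ} (v c : Fin (N + 1) → ℕ) :
    koszulSign v c = c 0 * ∑ t, v (Fin.succ t) +
      koszulSign (fun s => v (Fin.succ s)) fun s => c (Fin.succ s) := by
  rw [koszulSign, Fin.sum_univ_succ, Fin.sum_univ_succ]
  simp [Fin.sum_univ_succ, koszulSign, Finset.mul_sum]

/-- Collecting the powers of g to the left moves each θ^{b_s} past g^{a_t} for s < t, which is
precisely the rule of signs. The super coaction thereby becomes an ordinary multiplicative one. -/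
theorem prod_ofFn_bosonize {N : ℕ} (x : Fin N → K) (a b : Fin N → ℕ) :
    (List.ofFn fun s => bosonize k (x s) (a s) (b s)).prod =
      (-1 : k) ^ koszulSign a b • bosonize k (List.ofFn x).prod (∑ s, a s) (∑ s, b s) := by
  induction N with
  | zero => simp [koszulSign, bosonize_one]
  | succ N ih =>
    rw [List.ofFn_succ, List.prod_cons, ih, mul_smul_comm, bosonize_mul, smul_smul, koszulSign_succ,
      List.ofFn_succ, List.prod_cons, Fin.sum_univ_succ a, Fin.sum_univ_succ b, ← pow_add, add_comm]

theorem prod_ofFn_mul_prod_ofFn_bosonize {N M : ℕ} (x : Fin N → K) (a b : Fin N → ℕ)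
    (y : Fin M → K) (a' b' : Fin M → ℕ) :
    rowSum k K ((List.ofFn fun s => bosonize k (x s) (a s) (b s)).prod *
      (List.ofFn fun s => bosonize k (y s) (a' s) (b' s)).prod) =
      (-1 : k) ^ koszulSign (Fin.append a a') (Fin.append b b') •
        ((List.ofFn x).prod * (List.ofFn y).prod) := by
  have h1 : (List.ofFn fun s => bosonize k (Fin.append x y s) (Fin.append a a' s)
      (Fin.append b b' s)) = (List.ofFn fun s => bosonize k (x s) (a s) (b s)) ++
      List.ofFn fun s => bosonize k (y s) (a' s) (b' s) := by
    rw [← List.ofFn_fin_append]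
    congr 1
    ext s
    refine Fin.addCases (fun s => ?_) (fun s => ?_) s <;> simp
  rw [← List.prod_append, ← h1, prod_ofFn_bosonize, map_smul, rowSum_bosonize,
    List.ofFn_fin_append, List.prod_append]

end Clifford

/-! ### Super matrices as sign-free quantum matrices -/

section Bosonization

variable {k : Type*} [Field k] {K : Type*} [Ring K] [Algebra k K] {d : ℕ}

/-- The matrix `z^a_i g^â θ^{â+î}`. -/
def boseZ (k : Type*) [Field k] [Algebra k K] (par : Fin d → ℕ) (Z : Matrix (Fin d) (Fin d) K) :
    Matrix (Fin d) (Fin d) (Matrix (Fin 2) (Fin 2) K) :=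
  Matrix.of fun a i => bosonize k (Z a i) (par a) (par a + par i)

/-- The matrix `t^a_i g^î θ^{â+î}`. -/
def boseT (k : Type*) [Field k] [Algebra k K] (par : Fin d → ℕ) (T : Matrix (Fin d) (Fin d) K) :
    Matrix (Fin d) (Fin d) (Matrix (Fin 2) (Fin 2) K) :=
  Matrix.of fun a i => bosonize k (T a i) (par i) (par a + par i)

theorem neg_one_pow_congr {a b : ℕ} (h : Even a ↔ Even b) : (-1 : k) ^ a = (-1) ^ b := by
  by_cases ha : Even a
  · rw [ha.neg_one_pow, (h.1 ha).neg_one_pow]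
  · rw [(Nat.not_even_iff_odd.1 ha).neg_one_pow,
      (Nat.not_even_iff_odd.1 fun hb => ha (h.2 hb)).neg_one_pow]

/-- Moving θ^{â+î} past g^ŝ produces the sign (-1)^{ŝ(î+â)} of the super relations, and all four
monomials carry the same total powers of g and θ. -/
theorem rRel_boseZ {par : Fin d → ℕ} {q : k} {p r : Fin d → Fin d → k}
    {Z : Matrix (Fin d) (Fin d) K} (hZ : IsQuantumMatrix par q p r Z) :
    RRel (aPar q p r) (bPar par q p r) (boseZ k par Z) := by
  intro u v i j
  have h := congrArg (fun x => bosonize k x (par u + par v) (par u + par i + (par v + par j)))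
    (hZ u v i j)
  simp only [zRelLeft_eq, zRelRight_eq, bosonize_add, bosonize_smul] at h
  simp only [boseZ, Matrix.of_apply, bosonize_mul, smul_smul]
  rw [show par v + par u = par u + par v by ring,
    show par v + par i + (par u + par j) = par u + par i + (par v + par j) by ring,
    show par u + par j + (par v + par i) = par u + par i + (par v + par j) by ring]
  convert h using 3 <;> ring_nf

theorem boseZ_mul_boseT {par : Fin d → ℕ} {Z T : Matrix (Fin d) (Fin d) K}
    (h : ∀ j i, ∑ l, (-1 : k) ^ (par i * (par l + 1)) • (Z j l * T l i) = if i = j then 1 else 0) :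
    boseZ k par Z * boseT k par T = 1 := by
  ext1 j i
  have h1 : ∀ l, bosonize k (Z j l) (par j) (par j + par l) *
      bosonize k (T l i) (par i) (par l + par i) = (-1 : k) ^ (par i * (par j + 1)) •
      bosonize k ((-1 : k) ^ (par i * (par l + 1)) • (Z j l * T l i)) (par j + par i)
        (par j + par i) := by
    intro l
    rw [bosonize_mul, bosonize_smul, smul_smul, ← pow_add]
    have h2 := bosonize_add_two_mul (k := k) (Z j l * T l i) (par j + par i) (par j + par i) 0
      (par l)
    rw [mul_zero, add_zero] at h2
    rw [show par j + par l + (par l + par i) = par j + par i + 2 * par l by ring, h2]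
    congr 1
    apply neg_one_pow_congr
    simp only [parity_simps]
    tauto
  rw [Matrix.mul_apply]
  simp only [boseZ, boseT, Matrix.of_apply, h1]
  rw [← Finset.smul_sum, ← bosonize_sum, h, Matrix.one_apply]
  by_cases hij : j = i
  · subst hij
    have h3 := bosonize_add_two_mul (k := k) (1 : K) 0 0 (par j) (par j)
    rw [if_pos rfl, if_pos rfl, ← two_mul, ← zero_add (2 * par j), h3, bosonize_one,
      Even.neg_one_pow (Nat.even_mul_succ_self _), one_smul]
  · rw [if_neg hij, if_neg (Ne.symm hij)]
    ext; simp [bosonize]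

theorem boseT_mul_boseZ {par : Fin d → ℕ} {Z T : Matrix (Fin d) (Fin d) K}
    (h : ∀ j i, ∑ l, (-1 : k) ^ (par l * (par j + 1)) • (T j l * Z l i) = if i = j then 1 else 0) :
    boseT k par T * boseZ k par Z = 1 := by
  ext1 j i
  have h1 : ∀ l, bosonize k (T j l) (par l) (par j + par l) *
      bosonize k (Z l i) (par l) (par l + par i) =
      bosonize k ((-1 : k) ^ (par l * (par j + 1)) • (T j l * Z l i)) 0 (par j + par i) := by
    intro l
    have h2 := bosonize_add_two_mul (k := k) (T j l * Z l i) 0 (par j + par i) (par l) (par l)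
    rw [bosonize_mul, bosonize_smul, ← h2, zero_add, two_mul,
      show par j + par l + (par l + par i) = par j + par i + (par l + par l) by ring]
    congr 1
    apply neg_one_pow_congr
    simp only [parity_simps]
    tauto
  rw [Matrix.mul_apply]
  simp only [boseZ, boseT, Matrix.of_apply, h1]
  rw [← bosonize_sum, h, Matrix.one_apply]
  by_cases hij : j = i
  · subst hij
    have h3 := bosonize_add_two_mul (k := k) (1 : K) 0 0 0 (par j)
    rw [if_pos rfl, if_pos rfl, ← two_mul, ← zero_add (2 * par j), ← bosonize_one (k := k), ← h3]
  · rw [if_neg hij, if_neg (Ne.symm hij)]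
    ext; simp [bosonize]

end Bosonization

/-! ### The Berezinian of a quantum super matrix -/

section SuperBerezinian

variable {k : Type*} [Field k] {K : Type*} [Ring K] [Algebra k K] {m n : ℕ}

@[simp] theorem parity_castAdd (i : Fin m) : parity m n (Fin.castAdd n i) = 0 := by
  simp [parity]

@[simp] theorem parity_natAdd (i : Fin n) : parity m n (Fin.natAdd m i) = 1 := by
  simp [parity]

theorem aPar_castAdd (q : k) (p r : Fin (m + n) → Fin (m + n) → k) (i j : Fin m) :
    aPar q p r (Fin.castAdd n i) (Fin.castAdd n j) = aPar q (evenPart p) (evenPart r) i j :=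
  rfl

theorem bPar_castAdd (q : k) (p r : Fin (m + n) → Fin (m + n) → k) (i j : Fin m) :
    bPar (parity m n) q p r (Fin.castAdd n i) (Fin.castAdd n j) =
      bPar (fun _ => 0) q (evenPart p) (evenPart r) i j := by
  simp [bPar, evenPart]

theorem bPar_natAdd (q : k) (p r : Fin (m + n) → Fin (m + n) → k) (i j : Fin n) :
    bPar (parity m n) q p r (Fin.natAdd m i) (Fin.natAdd m j) =
      bPar (fun _ => 1) q (oddPart p) (oddPart r) i j := by
  simp [bPar, oddPart]

theorem isQuantumMatrix_odd {q : k} {p r : Fin (m + n) → Fin (m + n) → k}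
    {Z : Matrix (Fin (m + n)) (Fin (m + n)) K} (hZ : IsQuantumMatrix (parity m n) q p r Z) :
    IsQuantumMatrix (fun _ => 1) q (oddPart p) (oddPart r)
      (Z.submatrix (Fin.natAdd m) (Fin.natAdd m)) := by
  intro u v i j
  have := hZ (Fin.natAdd m u) (Fin.natAdd m v) (Fin.natAdd m i) (Fin.natAdd m j)
  simp only [zRelLeft_eq, zRelRight_eq, parity_natAdd, bPar_natAdd] at this ⊢
  exact this

theorem rRelOp_even {q : k} {p r : Fin (m + n) → Fin (m + n) → k}
    {T : Matrix (Fin (m + n)) (Fin (m + n)) K}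
    (hT : RRelOp (aPar q p r) (bPar (parity m n) q p r) (boseT k (parity m n) T)) :
    RRelOp (aPar q (evenPart p) (evenPart r)) (bPar (fun _ => 0) q (evenPart p) (evenPart r))
      (T.submatrix (Fin.castAdd n) (Fin.castAdd n)) := by
  intro u v i j
  have := congrArg (rowSum k K)
    (hT (Fin.castAdd n u) (Fin.castAdd n v) (Fin.castAdd n i) (Fin.castAdd n j))
  simpa [boseT, bosonize_mul, bPar_castAdd, aPar_castAdd] using this

theorem wordRev_bosonize {N : ℕ} (X : Matrix (Fin N) (Fin N) K) (a : ℕ) (J I : Fin N → Fin N) :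
    wordRev (X.map fun x => bosonize k x a 0) J I = bosonize k (wordRev X J I) (N * a) 0 := by
  have key : ∀ l : List K, (l.map fun x => bosonize k x a 0).prod =
      bosonize k l.prod (l.length * a) 0 := by
    intro l
    induction l with
    | nil => simp [bosonize_one]
    | cons x l ih => simp [ih, bosonize_mul, add_mul, add_comm]
  have := key (List.ofFn fun s => X (J s) (I s)).reverse
  rw [List.length_reverse, List.length_ofFn, List.map_reverse, List.map_ofFn] at this
  exact this

theorem qDetRev_bosonize {N : ℕ} (c : Fin N → Fin N → k) (X : Matrix (Fin N) (Fin N) K) (a : ℕ) :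
    qDetRev c (X.map fun x => bosonize k x a 0) = bosonize k (qDetRev c X) (N * a) 0 := by
  rw [qDetRev, qDetRev, bosonize_sum]
  refine Finset.sum_congr rfl fun J _ => ?_
  rw [bosonize_smul]
  rw [wordRev_bosonize]

section Range

variable [CharZero k] {q : k} {p r : Fin (m + n) → Fin (m + n) → k}
  (h : IsMultiparameter q p r)
include h

omit [CharZero k] in
theorem IsMultiparameter.cPar_self_eq_or (i : Fin (m + n)) :
    cPar (parity m n) p i i = 1 ∨ cPar (parity m n) p i i = -1 := by
  rw [h.cPar_self]
  exact neg_one_pow_eq_or k _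

theorem IsMultiparameter.mem_range_castAdd_iff (i : Fin (m + n)) :
    i ∈ Set.range (Fin.castAdd n : Fin m → Fin (m + n)) ↔ cPar (parity m n) p i i = 1 := by
  rw [h.cPar_self]
  refine Fin.addCases (fun i => ?_) (fun i => ?_) i
  · simp
  · simp only [parity_natAdd, pow_one, IsMultiparameter.one_ne_neg_one.symm, iff_false]
    rintro ⟨j, hj⟩
    have := congrArg (parity m n) hj
    simp at this

theorem IsMultiparameter.mem_range_natAdd_iff (i : Fin (m + n)) :
    i ∈ Set.range (Fin.natAdd m : Fin n → Fin (m + n)) ↔ cPar (parity m n) p i i = -1 := by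
  rw [h.cPar_self]
  refine Fin.addCases (fun i => ?_) (fun i => ?_) i
  · simp only [parity_castAdd, pow_zero, IsMultiparameter.one_ne_neg_one, iff_false]
    rintro ⟨j, hj⟩
    have := congrArg (parity m n) hj
    simp at this
  · simp

end Range

/-- `exists_berezinian` applies over 2×2 matrices to the bosonized Z and T. In the formula for b'
only odd-odd entries of Z, each carrying g, and even-even entries of T, carrying nothing, appear. So
b' is an element of K times g^n. -/
theorem exists_super_berezinian [CharZero k] {q : k} {p r : Fin (m + n) → Fin (m + n) → k}
    (h : IsMultiparameter q p r) {Z T : Matrix (Fin (m + n)) (Fin (m + n)) K}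
    (hZ : IsQuantumMatrix (parity m n) q p r Z)
    (hZT : ∀ j i, ∑ l, (-1 : k) ^ (parity m n i * (parity m n l + 1)) • (Z j l * T l i) =
      if i = j then 1 else 0)
    (hTZ : ∀ j i, ∑ l, (-1 : k) ^ (parity m n l * (parity m n j + 1)) • (T j l * Z l i) =
      if i = j then 1 else 0) :
    ∃ b b' : K, b * b' = 1 ∧ b' * b = 1 ∧
      (∑ J : Fin m → Fin (m + n), ∑ J' : Fin n → Fin (m + n),
        ((-1 : k) ^ koszulSign
        (Fin.append (fun s => parity m n (J s)) (fun s => parity m n (J' s)))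
        (Fin.append (fun s => parity m n (J s) + parity m n (Fin.castAdd n s))
          (fun s => parity m n (J' s) + parity m n (Fin.natAdd m s)))) •
        (qMon (cPar (parity m n) p) J J' ⊗ₜ[k]
          (wordMat Z J (Fin.castAdd n) * wordMat T.transpose J' (Fin.natAdd m)))) -
        qMon (cPar (parity m n) p) (Fin.castAdd n) (Fin.natAdd m) ⊗ₜ[k] b ∈
          LinearMap.range ((qKoszulD (cPar (parity m n) p)).rTensor K) ∧
      b' = qDetRev (oddPart p) (Z.submatrix (Fin.natAdd m) (Fin.natAdd m)).transpose *
        qDetRev (evenPart p) (T.submatrix (Fin.castAdd n) (Fin.castAdd n)) := by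
  have h1 := boseZ_mul_boseT hZT
  have h2 := boseT_mul_boseZ hTZ
  obtain ⟨b, b', hb1, hb2, ⟨x, hx⟩, hb'⟩ := exists_berezinian (h.cPar_mul_swap (parity m n))
    h.cPar_self_eq_or (h.isQType_ext _) (h.isQType_sym _) (h.triangularData _)
    (Fin.strictMono_castAdd n) (Fin.strictMono_natAdd m) h.mem_range_castAdd_iff
    h.mem_range_natAdd_iff (rRel_boseZ hZ) h1 h2
  set β := qDetRev (oddPart p) (Z.submatrix (Fin.natAdd m) (Fin.natAdd m)).transpose *
        qDetRev (evenPart p) (T.submatrix (Fin.castAdd n) (Fin.castAdd n)) with hβ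
  have hb'' : b' = bosonize k β n 0 := by
    have e1 : (fun i j => -cPar (parity m n) p (Fin.natAdd m i) (Fin.natAdd m j)) = oddPart p := by
      ext i j; simp [cPar, oddPart]
    have e2 : (fun i j => cPar (parity m n) p (Fin.castAdd n i) (Fin.castAdd n j)) =
        evenPart p := by
      ext i j; simp [cPar, evenPart]
    have e3 := qDetRev_bosonize (oddPart p)
      (Z.submatrix (Fin.natAdd m) (Fin.natAdd m)).transpose 1
    have e4 := qDetRev_bosonize (evenPart p) (T.submatrix (Fin.castAdd n) (Fin.castAdd n)) 0
    have e5 : bosonize k β n 0 = bosonize k (qDetRev (oddPart p)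
        (Z.submatrix (Fin.natAdd m) (Fin.natAdd m)).transpose) (n * 1) 0 *
        bosonize k (qDetRev (evenPart p) (T.submatrix (Fin.castAdd n) (Fin.castAdd n))) (m * 0) 0 := by
      rw [bosonize_mul, hβ]; simp
    rw [hb', e1, e2, e5, ← e3, ← e4]
    congr 1
    · refine Finset.sum_congr rfl fun J _ => ?_
      congr 1
      rw [wordRev, wordRev]
      congr 3
      ext1 s
      have := bosonize_add_two_mul (k := k) (Z (Fin.natAdd m s) (Fin.natAdd m (J s))) 1 0 0 1
      simpa [boseZ] using this
    · refine Finset.sum_congr rfl fun J _ => ?_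
      congr 1
      rw [wordRev, wordRev]
      congr 3
      ext1 s
      simp [boseT]
  -- As g^n is diagonal with corner 1, the (0,0) entry of b is inverse to β in K and the (0,1) entry
  -- of b vanishes. The row sum of b is therefore its corner.
  have hg : ∀ y : K, bosonize k y n 0 0 0 = y ∧ bosonize k y n 0 0 1 = 0 ∧
      bosonize k y n 0 1 0 = 0 := by
    intro y
    simp [bosonize, clifford_left]
  rw [hb''] at hb1 hb2
  have f1 : b 0 0 * β = 1 := by
    have := congrFun (congrFun hb1 0) 0
    simpa [Matrix.mul_apply, hg] using this
  have f2 : β * b 0 0 = 1 := by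
    have := congrFun (congrFun hb2 0) 0
    simpa [Matrix.mul_apply, hg] using this
  have f3 : β * b 0 1 = 0 := by
    have := congrFun (congrFun hb2 0) 1
    simpa [Matrix.mul_apply, hg] using this
  have f4 : b 0 1 = 0 := by
    rw [← one_mul (b 0 1), ← f1, mul_assoc, f3, mul_zero]
  refine ⟨b 0 0, β, f1, f2, ⟨(rowSum k K).lTensor _ x, ?_⟩, rfl⟩
  have h3 := congrArg ((rowSum k K).lTensor _) hx
  rw [← LinearMap.comp_apply, LinearMap.rTensor_comp_lTensor, ← LinearMap.lTensor_comp_rTensor,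
    LinearMap.comp_apply, h3, map_sub, LinearMap.lTensor_tmul]
  have f5 : rowSum k K b = b 0 0 := by
    change b 0 0 + b 0 1 = b 0 0
    rw [f4, add_zero]
  rw [f5, map_sum]
  congr 1
  refine Finset.sum_congr rfl fun J _ => ?_
  rw [map_sum]
  refine Finset.sum_congr rfl fun J' _ => ?_
  rw [LinearMap.lTensor_tmul, ← TensorProduct.tmul_smul]
  congr 1
  have := prod_ofFn_mul_prod_ofFn_bosonize (k := k) (fun s => Z (J s) (Fin.castAdd n s))
    (fun s => parity m n (J s)) (fun s => parity m n (J s) + parity m n (Fin.castAdd n s))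
    (fun s => T (Fin.natAdd m s) (J' s)) (fun s => parity m n (J' s))
    (fun s => parity m n (J' s) + parity m n (Fin.natAdd m s))
  refine Eq.trans ?_ this
  congr 2
  rw [wordMat]
  congr 2
  ext1 s
  simp only [boseT, Matrix.transpose_apply, Matrix.of_apply, add_comm]

end SuperBerezinian

/-! ### Comparison of the Koszul complexes -/

section Transport

variable {k : Type*} [Field k] {m n : ℕ} {q : k} {p r : Fin (m + n) → Fin (m + n) → k}

theorem Ext.algHom_ext {B : Type*} [Ring B] [Algebra k B] {f g : Ext m n q p r →ₐ[k] B}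
    (h : ∀ i, f (extX q p r i) = g (extX q p r i)) : f = g := by
  refine RingQuot.ringQuot_ext' (S := k) (s := ExtRel m n q p r) f g (FreeAlgebra.hom_ext ?_)
  ext i
  exact h i

theorem SymDual.algHom_ext {B : Type*} [Ring B] [Algebra k B] {f g : SymDual m n q p r →ₐ[k] B}
    (h : ∀ i, f (symXi q p r i) = g (symXi q p r i)) : f = g := by
  refine RingQuot.ringQuot_ext' (S := k) (s := SymDualRel m n q p r) f g (FreeAlgebra.hom_ext ?_)
  ext i
  exact h i

variable [CharZero k] (h : IsMultiparameter q p r)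
include h

theorem IsMultiparameter.isQComm_iff_ext {B : Type*} [Ring B] [Algebra k B] (y : Fin (m + n) → B) :
    IsQComm (cPar (parity m n) p) y ↔
      ∀ i j, ∑ a, ∑ b, rCoeff (parity m n) q p r a b i j • (y a * y b) = -(y i * y j) := by
  rw [(h.isQType_ext _).isQComm_iff]
  refine forall_congr' fun i => forall_congr' fun j => ?_
  have := sum_rCoeff_smul (parity m n) q p r i j (fun _ _ => 1) fun a b => y a * y b
  simp only [one_mul] at this
  rw [this, neg_one_smul]

theorem IsMultiparameter.isQComm_iff_symDual {B : Type*} [Ring B] [Algebra k B]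
    (y : Fin (m + n) → B) :
    IsQComm (-cPar (parity m n) p) y ↔
      ∀ i j, ∑ a, ∑ b, rCoeff (parity m n) q p r j i b a • (y a * y b) = q • (y i * y j) := by
  rw [(h.isQType_sym _).isQComm_iff]
  refine forall_congr' fun i => forall_congr' fun j => ?_
  have := sum_smul_rCoeff (parity m n) q p r j i (fun _ _ => 1) fun b a => y a * y b
  simp only [one_mul] at this
  rw [Finset.sum_comm, this]

theorem IsMultiparameter.exists_extEquiv :
    ∃ φ : QAlg (cPar (parity m n) p) ≃ₐ[k] Ext m n q p r,
      ∀ i, φ (QAlg.gen _ i) = extX q p r i := by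
  have h1 : IsQComm (cPar (parity m n) p) (extX q p r) := by
    rw [h.isQComm_iff_ext]
    intro i j
    have : Ext.mk q p r _ = Ext.mk q p r _ :=
      RingQuot.mkAlgHom_rel k (ExtRel.rel (q := q) (p := p) (r := r) i j)
    simpa only [extX, map_sum, map_smul, map_neg, map_mul] using this
  let ψ : Ext m n q p r →ₐ[k] QAlg (cPar (parity m n) p) :=
    RingQuot.liftAlgHom k ⟨FreeAlgebra.lift k (QAlg.gen _), by
      rintro _ _ ⟨i, j⟩
      have := (h.isQComm_iff_ext _).1 (QAlg.gen_isQComm (cPar (parity m n) p)) i j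
      simpa only [map_sum, map_smul, map_neg, map_mul, FreeAlgebra.lift_ι_apply] using this⟩
  have hψ : ∀ i, ψ (extX q p r i) = QAlg.gen _ i := by
    intro i
    refine (RingQuot.liftAlgHom_mkAlgHom_apply k _ _ _).trans ?_
    simp
  refine ⟨AlgEquiv.ofAlgHom (QAlg.lift _ _ h1) ψ ?_ ?_, fun i => ?_⟩
  · exact Ext.algHom_ext fun i => by simp [hψ]
  · exact QAlg.algHom_ext fun i => by simp [hψ]
  · simp

theorem IsMultiparameter.exists_symDualEquiv :
    ∃ φ : QAlg (-cPar (parity m n) p) ≃ₐ[k] SymDual m n q p r,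
      ∀ i, φ (QAlg.gen _ i) = symXi q p r i := by
  have h1 : IsQComm (-cPar (parity m n) p) (symXi q p r) := by
    rw [h.isQComm_iff_symDual]
    intro i j
    have : SymDual.mk q p r _ = SymDual.mk q p r _ :=
      RingQuot.mkAlgHom_rel k (SymDualRel.rel (q := q) (p := p) (r := r) i j)
    simpa only [symXi, map_sum, map_smul, map_neg, map_mul] using this
  let ψ : SymDual m n q p r →ₐ[k] QAlg (-cPar (parity m n) p) :=
    RingQuot.liftAlgHom k ⟨FreeAlgebra.lift k (QAlg.gen _), by
      rintro _ _ ⟨i, j⟩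
      have := (h.isQComm_iff_symDual _).1 (QAlg.gen_isQComm (-cPar (parity m n) p)) i j
      simpa only [map_sum, map_smul, map_neg, map_mul, FreeAlgebra.lift_ι_apply] using this⟩
  have hψ : ∀ i, ψ (symXi q p r i) = QAlg.gen _ i := by
    intro i
    refine (RingQuot.liftAlgHom_mkAlgHom_apply k _ _ _).trans ?_
    simp
  refine ⟨AlgEquiv.ofAlgHom (QAlg.lift _ _ h1) ψ ?_ ?_, fun i => ?_⟩
  · exact SymDual.algHom_ext fun i => by simp [hψ]
  · exact QAlg.algHom_ext fun i => by simp [hψ]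
  · simp

theorem IsMultiparameter.exists_koszulEquiv :
    ∃ Φ : QAlg (cPar (parity m n) p) ⊗[k] QAlg (-cPar (parity m n) p) ≃ₗ[k] Koszul m n q p r,
      Φ.toLinearMap ∘ₗ qKoszulD (cPar (parity m n) p) = koszulD q p r ∘ₗ Φ.toLinearMap ∧
      ∀ {a b : ℕ} (I : Fin a → Fin (m + n)) (I' : Fin b → Fin (m + n)),
        Φ (qMon (cPar (parity m n) p) I I') = koszulMonomial q p r I I' := by
  obtain ⟨φ, hφ⟩ := h.exists_extEquiv
  obtain ⟨ψ, hψ⟩ := h.exists_symDualEquiv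
  refine ⟨TensorProduct.congr φ.toLinearEquiv ψ.toLinearEquiv, ?_, fun I I' => ?_⟩
  · refine TensorProduct.ext' fun u w => ?_
    simp [qKoszulD_tmul, koszulD, hφ, hψ]
  · simp [qMon, koszulMonomial, map_list_prod, List.map_ofFn, Function.comp_def, hφ, hψ]

end Transport

/-! ### The generic quantum super matrix over the function algebra -/

section Main

variable {k : Type*} [Field k] {m n : ℕ}

theorem isQuantumMatrix_matZ (q : k) (p r : Fin (m + n) → Fin (m + n) → k) :
    IsQuantumMatrix (parity m n) q p r (matZ q p r) := by
  intro u v i j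
  have : QGL.mk q p r _ = QGL.mk q p r _ :=
    RingQuot.mkAlgHom_rel k (GLRel.zz (q := q) (p := p) (r := r) u v i j)
  simpa only [zRelLeft, zRelRight, matZ, Matrix.map_apply, map_sum, map_smul, map_mul] using this

theorem sum_matZ_mul_matT (q : k) (p r : Fin (m + n) → Fin (m + n) → k) (j i : Fin (m + n)) :
    ∑ l, (-1 : k) ^ (parity m n i * (parity m n l + 1)) • (matZ q p r j l * matT q p r l i) =
      if i = j then 1 else 0 := by
  have : QGL.mk q p r _ = QGL.mk q p r _ :=
    RingQuot.mkAlgHom_rel k (GLRel.zt (q := q) (p := p) (r := r) j i)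
  simpa only [matZ, matT, Matrix.map_apply, map_sum, map_smul, map_mul, apply_ite (QGL.mk q p r),
    map_one, map_zero] using this

theorem sum_matT_mul_matZ (q : k) (p r : Fin (m + n) → Fin (m + n) → k) (j i : Fin (m + n)) :
    ∑ l, (-1 : k) ^ (parity m n l * (parity m n j + 1)) • (matT q p r j l * matZ q p r l i) =
      if i = j then 1 else 0 := by
  have : QGL.mk q p r _ = QGL.mk q p r _ :=
    RingQuot.mkAlgHom_rel k (GLRel.tz (q := q) (p := p) (r := r) j i)
  simpa only [matZ, matT, Matrix.map_apply, map_sum, map_smul, map_mul, apply_ite (QGL.mk q p r),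
    map_one, map_zero] using this

variable [CharZero k] {q : k} {p r : Fin (m + n) → Fin (m + n) → k}

/-- The functional that kills Im D and is 1 on ω, applied to ω ⊗ (b' - b) in Im D ⊗ H, returns b' -
b = 0. -/
theorem IsMultiparameter.isBerezinian_unique (h : IsMultiparameter q p r) {b b' : QGL m n q p r}
    (hb : IsBerezinian q p r b) (hb' : IsBerezinian q p r b') : b = b' := by
  obtain ⟨Φ, hΦ, hΦm⟩ := h.exists_koszulEquiv
  obtain ⟨f, hf1, hf2, -⟩ := exists_functional (QGL m n q p r)
    (h.cPar_mul_swap (parity m n)) h.cPar_self_eq_or (Fin.strictMono_castAdd n)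
    (Fin.strictMono_natAdd m) h.mem_range_castAdd_iff h.mem_range_natAdd_iff
  set F := f ∘ₗ Φ.symm.toLinearMap with hF
  have hF1 : F ∘ₗ koszulD q p r = 0 := by
    have h1 : Φ.symm.toLinearMap ∘ₗ koszulD q p r = qKoszulD _ ∘ₗ Φ.symm.toLinearMap := by
      refine LinearMap.ext fun x => ?_
      obtain ⟨y, rfl⟩ := Φ.surjective x
      have := LinearMap.congr_fun hΦ y
      simp only [LinearMap.comp_apply, LinearEquiv.coe_coe] at this ⊢
      rw [← this]
      simp
    rw [hF, LinearMap.comp_assoc, h1, ← LinearMap.comp_assoc, hf1, LinearMap.zero_comp]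
  have hF2 : F (koszulMonomial q p r (Fin.castAdd n) (Fin.natAdd m)) = 1 := by
    rw [← hΦm, hF, LinearMap.comp_apply, LinearEquiv.coe_coe, LinearEquiv.symm_apply_apply, hf2]
  have h1 := Submodule.sub_mem _ hb hb'
  rw [sub_sub_sub_cancel_left, ← TensorProduct.tmul_sub] at h1
  obtain ⟨x, hx⟩ := h1
  have h2 := congrArg ((TensorProduct.lid k _).toLinearMap ∘ₗ F.rTensor (QGL m n q p r)) hx
  rw [LinearMap.comp_apply, ← LinearMap.comp_apply (F.rTensor _), ← LinearMap.rTensor_comp, hF1,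
    LinearMap.comp_apply, LinearMap.rTensor_tmul, hF2] at h2
  simp only [LinearMap.rTensor_zero, LinearMap.zero_apply, map_zero, LinearEquiv.coe_coe,
    TensorProduct.lid_tmul, one_smul] at h2
  exact (sub_eq_zero.1 h2.symm).symm

theorem IsMultiparameter.exists_isBerezinian (h : IsMultiparameter q p r) :
    ∃ b b' : QGL m n q p r, b * b' = 1 ∧ b' * b = 1 ∧ IsBerezinian q p r b ∧
      b' = qDetRev (oddPart p) (blockD q p r).transpose *
        qDetRev (evenPart p) ((matT q p r).submatrix (Fin.castAdd n) (Fin.castAdd n)) := by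
  obtain ⟨Φ, hΦ, hΦm⟩ := h.exists_koszulEquiv
  obtain ⟨b, b', h1, h2, ⟨x, hx⟩, h3⟩ := exists_super_berezinian h (isQuantumMatrix_matZ q p r)
    (sum_matZ_mul_matT q p r) (sum_matT_mul_matZ q p r)
  refine ⟨b, b', h1, h2, ⟨Φ.toLinearMap.rTensor _ x, ?_⟩, h3⟩
  rw [← LinearMap.comp_apply, ← LinearMap.rTensor_comp, ← hΦ, LinearMap.rTensor_comp,
    LinearMap.comp_apply, hx, map_sub, LinearMap.rTensor_tmul, LinearEquiv.coe_coe, hΦm,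
    koszulCoaction, map_sum]
  congr 1
  refine Finset.sum_congr rfl fun J _ => ?_
  rw [map_sum]
  refine Finset.sum_congr rfl fun J' _ => ?_
  rw [map_smul, LinearMap.rTensor_tmul, LinearEquiv.coe_coe, hΦm]
  rfl

theorem IsMultiparameter.isUnit_blockD_and_qDet_eq (h : IsMultiparameter q p r)
    (hu : IsUnit (qDetRev (oddPart p) (blockD q p r).transpose *
      qDetRev (evenPart p) ((matT q p r).submatrix (Fin.castAdd n) (Fin.castAdd n)))) :
    IsUnit (blockD q p r) ∧
      IsQuantumMatrix (fun _ => 0) q (evenPart p) (evenPart r) (schurD q p r) ∧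
      IsUnit (qDetEven (evenPart p) (schurD q p r)) ∧
      qDetRev (oddPart p) (blockD q p r).transpose *
        qDetRev (evenPart p) ((matT q p r).submatrix (Fin.castAdd n) (Fin.castAdd n)) =
        qDetOdd (oddPart r) (blockD q p r) *
          Ring.inverse (qDetEven (evenPart p) (schurD q p r)) := by
  have he : IsMultiparameter q (evenPart p) (evenPart r) := h.comp (Fin.strictMono_castAdd n)
  have ho : IsMultiparameter q (oddPart p) (oddPart r) := h.comp (Fin.strictMono_natAdd m)
  have e1 : cPar (fun _ => 0) (evenPart p) = evenPart p := by ext; simp [cPar]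
  have e2 : -cPar (fun _ => 1) (oddPart p) = oddPart p := by ext; simp [cPar]
  have t1 := he.isQType_ext fun _ => 0
  rw [e1] at t1
  have t2 := ho.isQType_sym fun _ => 1
  rw [e2] at t2
  have ht := ho.triangularData fun _ => 1
  have hTZ := boseT_mul_boseZ (sum_matT_mul_matZ q p r)
  have hW := rRelOp_even ((rRel_boseZ (isQuantumMatrix_matZ q p r)).inv
    (boseZ_mul_boseT (sum_matZ_mul_matT q p r)) hTZ)
  -- In the even rows of the relation TZ = 1 the terms with odd summation index carry the sign -1;
  -- it is absorbed into the block W₂.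
  have hA : (matT q p r).submatrix (Fin.castAdd n) (Fin.castAdd n) * blockA q p r +
      -(matT q p r).submatrix (Fin.castAdd n) (Fin.natAdd m) * blockC q p r = 1 := by
    ext i j
    have := sum_matT_mul_matZ q p r (Fin.castAdd n i) (Fin.castAdd n j)
    rw [Fin.sum_univ_add] at this
    simpa [Matrix.mul_apply, blockA, blockC, Matrix.one_apply, eq_comm] using this
  have hB : (matT q p r).submatrix (Fin.castAdd n) (Fin.castAdd n) * blockB q p r +
      -(matT q p r).submatrix (Fin.castAdd n) (Fin.natAdd m) * blockD q p r = 0 := by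
    ext i j
    have := sum_matT_mul_matZ q p r (Fin.castAdd n i) (Fin.natAdd m j)
    have hne : Fin.natAdd m j ≠ Fin.castAdd n i := by
      intro h1
      have := congrArg (parity m n) h1
      simp at this
    rw [Fin.sum_univ_add, if_neg hne] at this
    simpa [Matrix.mul_apply, blockB, blockD] using this
  obtain ⟨h1, h2, h3, h4⟩ := isUnit_block_and_qDet_eq h.q_ne_zero h.eq_one_of_pow_eq_one t1
    he.p_mul_swap he.p_self (ho.isQType_odd fun _ => rfl) t2
    (fun i j => by rw [← mul_inv, ho.r_mul_swap, inv_one]) (fun i => by rw [ho.r_self, inv_one])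
    ho.p_mul_swap ho.p_self ht.beta_ne_zero ht.order
    ((isQuantumMatrix_const_iff 1 _ _ _ _).1 (isQuantumMatrix_odd (isQuantumMatrix_matZ q p r)))
    hW hA hB hu
  exact ⟨h1, (isQuantumMatrix_const_iff 0 _ _ _ _).2 h2, h3, h4⟩

end Main

end QuantumBerezinian

end

theorem mainTheorem5 {k : Type*} [Field k] [CharZero k] (m n : ℕ) (q : k)
    (p r : Fin (m + n) → Fin (m + n) → k)
    (hpar : QuantumBerezinian.IsMultiparameter q p r) :
    IsUnit (QuantumBerezinian.blockD q p r) ∧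
    QuantumBerezinian.IsQuantumMatrix (fun _ => 1) q
      (QuantumBerezinian.oddPart p) (QuantumBerezinian.oddPart r)
      (QuantumBerezinian.blockD q p r) ∧
    QuantumBerezinian.IsQuantumMatrix (fun _ => 0) q
      (QuantumBerezinian.evenPart p) (QuantumBerezinian.evenPart r)
      (QuantumBerezinian.schurD q p r) ∧
    IsUnit (QuantumBerezinian.qDetEven (QuantumBerezinian.evenPart p)
      (QuantumBerezinian.schurD q p r)) ∧
    ∃ Ber : (QuantumBerezinian.QGL m n q p r)ˣ,
      (∀ b : QuantumBerezinian.QGL m n q p r,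
        QuantumBerezinian.IsBerezinian q p r b ↔ b = (Ber : QuantumBerezinian.QGL m n q p r)) ∧
      ((Ber⁻¹ : (QuantumBerezinian.QGL m n q p r)ˣ) : QuantumBerezinian.QGL m n q p r) =
        QuantumBerezinian.qDetOdd (QuantumBerezinian.oddPart r) (QuantumBerezinian.blockD q p r) *
          Ring.inverse (QuantumBerezinian.qDetEven (QuantumBerezinian.evenPart p)
            (QuantumBerezinian.schurD q p r)) := by
  obtain ⟨b, b', hb1, hb2, hb, hb'⟩ := hpar.exists_isBerezinian
  -- The invertibility of the Berezinian comes first; that of D and of the determinant of the Schur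
  -- complement is extracted from it.
  have hu : IsUnit b' := ⟨⟨b', b, hb2, hb1⟩, rfl⟩
  rw [hb'] at hu
  obtain ⟨h1, h2, h3, h4⟩ := hpar.isUnit_blockD_and_qDet_eq hu
  refine ⟨h1, QuantumBerezinian.isQuantumMatrix_odd
    (QuantumBerezinian.isQuantumMatrix_matZ q p r), h2, h3, ⟨b, b', hb1, hb2⟩, fun c => ?_, ?_⟩
  · exact ⟨fun hc => hpar.isBerezinian_unique hc hb, fun hc => by rw [hc]; exact hb⟩
  · rw [← h4, ← hb']
    rfl
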